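/- Rings are associative and unital, not necessarily commutative, and homomorphisms preserve $1$. A \emph{pair} $(A,I)$ is a ring $A$ with a two-sided ideal $I$; a \emph{morphism} $\phi:(A,I)\to(B,J)$ is a ring homomorphism with $\phi^{-1}(J)=I$, and $\bar\phi:A/I\to B/J$ is the induced map. A bar also denotes reduction modulo $I$. Put $I^{(1)}=I$ and let $I^{(n+1)}$ be the ideal generated by all $ai-ia$ with $a\in A$, $i\in I^{(n)}$. The pair is \emph{perfect} if $\bigcap_n I^{(n)}=0$, and \emph{Jacobson} if $I\subseteq \mathrm{rad}(A)$. Polynomials $f_1,f_2\in R[x]$ (with $x$ central) are \emph{left coprime} if $g_1f_1+g_2f_2=1$ for some $g_1,g_2\in R[x]$, and \emph{right coprime} if $f_1g_1+f_2g_2=1$ for some $g_1,g_2\in R[x]$. A pair $(A,I)$ is \emph{left Henselian} if it is Jacobson and, for every monic $F\in A[x]$ and all left coprime monic $f_1,f_2\in(A/I)[x]$ with $\bar F=f_1f_2$, there are unique monic $F_1,F_2\in A[x]$ with $F=F_1F_2$, $\bar F_1=f_1$, $\bar F_2=f_2$. \emph{Right Henselian} is defined in the same way with right coprime $f_1,f_2$.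 For $F,f_1,f_2$ as above (so $F$ is monic, $f_1,f_2$ are monic and left coprime, and $\bar F=f_1f_2$), let $d_i=\deg f_i$. Adjoin to $A$ free noncommuting variables $y_0,\dots,y_{d_1-1},z_0,\dots,z_{d_2-1}$ subject to the relations that equate the coefficients of $(x^{d_1}+\sum_i y_ix^i)(x^{d_2}+\sum_i z_ix^i)$ with those of $F$. Sending the variables to the coefficients of $f_1,f_2$ gives a homomorphism $\beta$ from this ring to $A/I$. Let $R$ be the localization at $\beta$: universally invert all elements that become invertible in $A/I$, repeat this countably often, and take the direct limit. Let $J$ be the kernel of $R\to A/I$. The morphism from $(A,I)$ to $(R/N,J/N)$, where $N=\bigcap_nJ^{(n)}$, is called a \emph{simple LF-extension} of $(A,I)$. An \emph{LF-extension} is a composite of a finite nonempty sequence of simple LF-extensions. For LF-extensions $\phi_1,\phi_2$ of $(A,I)$ write $\phi_1\le\phi_2$ if $\phi_2=\psi\circ\phi_1$ for some morphism $\psi$ of pairs. \emph{Right LF-extensions} are defined in the same way with right coprime $f_1,f_2$. A \emph{left Henselization} of $(A,I)$ is a morphism $\phi^{lh}:(A,I)\to(A^{lh},I^{lh})$ to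 a left Henselian perfect pair such that for every morphism $\phi:(A,I)\to(B,J)$ to a left Henselian perfect pair there is a unique morphism $\psi:(A^{lh},I^{lh})\to(B,J)$ with $\phi=\psi\circ\phi^{lh}$. \textbf{Theorem.} Let $(A,I)$ be a perfect pair. (1) For LF-extensions $\phi_1,\phi_2$ of $(A,I)$ there is at most one morphism $\psi$ of pairs with $\phi_2=\psi\circ\phi_1$, and the LF-extensions form a nonempty directed system under $\le$. (2) The direct limit $(A^{lh},I^{lh})$ of this system exists in the category of pairs, and the canonical morphism $\phi^{lh}:(A,I)\to(A^{lh},I^{lh})$ is a left Henselization of $(A,I)$. In particular $(A,I)$ has a left Henselization. (3) The left Henselization is unique up to unique isomorphism: for any two left Henselizations $\phi:(A,I)\to(L,K)$ and $\phi':(A,I)\to(L',K')$ there is a unique isomorphism of pairs $e:(L,K)\to(L',K')$ with $e\circ\phi=\phi'$. The same three statements hold with ``right'' in place of ``left'' throughout. -/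

import Mathlib

open CategoryTheory CategoryTheory.Limits Polynomial

universe u v w

noncomputable section

/-! ### The category of pairs -/

/-- A pair `(A, I)`: a unital, not necessarily commutative ring and a two-sided ideal of it. -/
structure RingPair : Type (u + 1) where
  carrier : Type u
  [ring : Ring carrier]
  ideal : Ideal carrier
  [isTwoSided : ideal.IsTwoSided]

namespace RingPair

instance : CoeSort RingPair.{u} (Type u) := ⟨RingPair.carrier⟩

attribute [instance] RingPair.ring RingPair.isTwoSided

/-- A morphism of pairs `(A, I) → (B, J)`: a unital ring homomorphism with `φ⁻¹(J) = I`. -/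
@[ext]
structure Hom (P Q : RingPair.{u}) where
  toRingHom : P →+* Q
  comap_ideal : Q.ideal.comap toRingHom = P.ideal

instance : Category RingPair.{u} where
  Hom P Q := Hom P Q
  id P := ⟨RingHom.id P, Ideal.comap_id _⟩
  comp f g := ⟨g.toRingHom.comp f.toRingHom, by
    rw [← Ideal.comap_comap, g.comap_ideal, f.comap_ideal]⟩

/-- The residue ring `A / I` of the pair `(A, I)`. -/
abbrev Residue (P : RingPair.{u}) : Type u := P.carrier ⧸ P.ideal

/-- The quotient map `A → A / I`. -/
abbrev residue (P : RingPair.{u}) : P →+* P.Residue := Ideal.Quotient.mk P.ideal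

/-- `(A, I)` is a Jacobson pair if `I` is contained in the Jacobson radical of `A`. -/
def IsJacobson (P : RingPair.{u}) : Prop := P.ideal ≤ Ring.jacobson P

/-- The commutator filtration. The index is shifted: `P.commFiltration n` is `I⁽ⁿ⁺¹⁾`, so the
value at `0` is `I`, and the next term is the two-sided ideal generated by all `a i - i a` with
`a ∈ A` and `i` in the preceding term. -/
def commFiltration (P : RingPair.{u}) : ℕ → Ideal P
  | 0 => P.ideal
  | n + 1 => (TwoSidedIdeal.span
      {x : P | ∃ a : P, ∃ i ∈ P.commFiltration n, x = a * i - i * a}).asIdeal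

instance (P : RingPair.{u}) (n : ℕ) : (P.commFiltration n).IsTwoSided := by
  cases n with
  | zero => exact P.isTwoSided
  | succ n => exact inferInstanceAs (TwoSidedIdeal.asIdeal _).IsTwoSided

/-- The intersection of the commutator filtration. -/
def commCore (P : RingPair.{u}) : Ideal P := ⨅ n, P.commFiltration n

instance (P : RingPair.{u}) : P.commCore.IsTwoSided :=
  inferInstanceAs (⨅ n, P.commFiltration n).IsTwoSided

/-- A pair is perfect if it is separated with respect to its commutator filtration. -/
def IsPerfect (P : RingPair.{u}) : Prop := P.commCore = ⊥

lemma commCore_le (P : RingPair.{u}) : P.commCore ≤ P.ideal := iInf_le _ 0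

lemma comap_map_commCore (P : RingPair.{u}) :
    (P.ideal.map (Ideal.Quotient.mk P.commCore)).comap (Ideal.Quotient.mk P.commCore) =
      P.ideal := by
  rw [Ideal.comap_map_of_surjective _ Ideal.Quotient.mk_surjective]
  refine sup_eq_left.2 fun x hx => P.commCore_le ?_
  exact Ideal.Quotient.eq_zero_iff_mem.1 (by simpa using hx)

/-- The pair `(A / N, I / N)`, where `N` is the intersection of the commutator filtration. -/
def perfection (P : RingPair.{u}) : RingPair.{u} where
  carrier := P ⧸ P.commCore
  ideal := P.ideal.map (Ideal.Quotient.mk P.commCore)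

/-- The quotient morphism from a pair to its perfection. -/
def toPerfection (P : RingPair.{u}) : P ⟶ P.perfection where
  toRingHom := Ideal.Quotient.mk P.commCore
  comap_ideal := P.comap_map_commCore

end RingPair

/-! ### Left and right Henselian pairs -/

/-- The two sides, so that the left and the right notions are defined together. -/
inductive Side
  | left
  | right

/-- `f` and `g` are left coprime if `1 = a f + b g`, and right coprime if `1 = f a + g b`, for
some `a` and `b`. -/
def Side.Coprime {R : Type u} [Ring R] : Side → R → R → Prop
  | .left, f, g => ∃ a b : R, a * f + b * g = 1
  | .right, f, g => ∃ a b : R, f * a + g * b = 1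

/-- `(A, I)` is left (right) Henselian if it is a Jacobson pair and, for every monic `F` over `A`,
every factorization of `F` over `A / I` into left (right) coprime monic `f₁`, `f₂` lifts uniquely
to a factorization of `F` into monic polynomials over `A`. -/
def RingPair.IsHenselian (s : Side) (P : RingPair.{u}) : Prop :=
  P.IsJacobson ∧
    ∀ (F : P[X]) (f₁ f₂ : P.Residue[X]), F.Monic → f₁.Monic → f₂.Monic → s.Coprime f₁ f₂ →
      F.map P.residue = f₁ * f₂ →
      ∃! G : P[X] × P[X], G.1.Monic ∧ G.2.Monic ∧ F = G.1 * G.2 ∧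
        G.1.map P.residue = f₁ ∧ G.2.map P.residue = f₂

/-! ### Free extensions and localizations of noncommutative rings -/

/-- The relations that make `A → ℤ⟨A ⊔ X⟩` a unital ring homomorphism. -/
inductive FreeExt.Rel (A : Type u) [Ring A] (X : Type v) :
    FreeAlgebra ℤ (A ⊕ X) → FreeAlgebra ℤ (A ⊕ X) → Prop
  | one : Rel A X (FreeAlgebra.ι ℤ (Sum.inl 1)) 1
  | add (a b : A) : Rel A X (FreeAlgebra.ι ℤ (Sum.inl (a + b)))
      (FreeAlgebra.ι ℤ (Sum.inl a) + FreeAlgebra.ι ℤ (Sum.inl b))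
  | mul (a b : A) : Rel A X (FreeAlgebra.ι ℤ (Sum.inl (a * b)))
      (FreeAlgebra.ι ℤ (Sum.inl a) * FreeAlgebra.ι ℤ (Sum.inl b))

/-- The free `A`-ring `A⟨X⟩` on the noncommuting variables `X`; the variables do not commute with
the elements of `A` either. -/
abbrev FreeExt (A : Type u) [Ring A] (X : Type v) : Type (max u v) := RingQuot (FreeExt.Rel A X)

namespace FreeExt

variable (A : Type u) [Ring A] (X : Type v)

/-- The canonical homomorphism `A → A⟨X⟩`. -/
def of : A →+* FreeExt A X :=
  RingHom.mk'
    { toFun := fun a => RingQuot.mkRingHom (Rel A X) (FreeAlgebra.ι ℤ (Sum.inl a))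
      map_one' := by rw [RingQuot.mkRingHom_rel Rel.one, map_one]
      map_mul' := fun a b => by rw [RingQuot.mkRingHom_rel (Rel.mul a b), map_mul] }
    fun a b => by
      change RingQuot.mkRingHom (Rel A X) _ = _
      rw [RingQuot.mkRingHom_rel (Rel.add a b), map_add]; rfl

/-- The variables of `A⟨X⟩`. -/
def var (x : X) : FreeExt A X := RingQuot.mkRingHom (Rel A X) (FreeAlgebra.ι ℤ (Sum.inr x))

variable {A X} {B : Type w} [Ring B]

/-- The homomorphism `A⟨X⟩ → B` given by a homomorphism `A → B` and the images of the variables. -/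
def lift (φ : A →+* B) (t : X → B) : FreeExt A X →+* B :=
  RingQuot.lift ⟨(FreeAlgebra.lift ℤ (Sum.elim φ t) : FreeAlgebra ℤ (A ⊕ X) →ₐ[ℤ] B).toRingHom, by
    intro a b h
    cases h <;> simp⟩

@[simp] lemma lift_of (φ : A →+* B) (t : X → B) (a : A) : lift φ t (of A X a) = φ a := by
  change RingQuot.lift _ (RingQuot.mkRingHom _ _) = _
  rw [RingQuot.lift_mkRingHom_apply]
  simp

@[simp] lemma lift_var (φ : A →+* B) (t : X → B) (x : X) : lift φ t (var A X x) = t x := by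
  change RingQuot.lift _ (RingQuot.mkRingHom _ _) = _
  rw [RingQuot.lift_mkRingHom_apply]
  simp

end FreeExt

/-- The relations `s s⁻¹ = 1 = s⁻¹ s`, for `s ∈ S`. -/
inductive UnivLoc.Rel (A : Type u) [Ring A] (S : Set A) : FreeExt A S → FreeExt A S → Prop
  | mul_inv (s : S) : Rel A S (FreeExt.of A S s * FreeExt.var A S s) 1
  | inv_mul (s : S) : Rel A S (FreeExt.var A S s * FreeExt.of A S s) 1

/-- The (universal) localization `A_S` of a noncommutative ring `A` at a subset `S`. -/
abbrev UnivLoc (A : Type u) [Ring A] (S : Set A) : Type u := RingQuot (UnivLoc.Rel A S)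

namespace UnivLoc

variable (A : Type u) [Ring A] (S : Set A)

/-- The canonical homomorphism `A → A_S`. -/
def of : A →+* UnivLoc A S := (RingQuot.mkRingHom (Rel A S)).comp (FreeExt.of A S)

variable {A S} {B : Type w} [Ring B]

/-- A homomorphism `A → B` that makes the elements of `S` invertible extends to `A_S`. -/
def lift (φ : A →+* B) (h : ∀ s ∈ S, IsUnit (φ s)) : UnivLoc A S →+* B :=
  RingQuot.lift ⟨FreeExt.lift φ fun s : S => ((h s s.2).unit⁻¹ : Bˣ), by
    intro a b r
    cases r <;> simp⟩

@[simp] lemma lift_of (φ : A →+* B) (h : ∀ s ∈ S, IsUnit (φ s)) (a : A) :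
    lift φ h (of A S a) = φ a := by
  change RingQuot.lift _ (RingQuot.mkRingHom _ _) = _
  rw [RingQuot.lift_mkRingHom_apply]
  simp

end UnivLoc

/-- A ring `A` with a homomorphism `φ : A → B`. -/
structure RingOver (B : Type u) [Ring B] : Type (u + 1) where
  carrier : Type u
  [ring : Ring carrier]
  hom : carrier →+* B

attribute [instance] RingOver.ring

namespace RingOver

variable {B : Type u} [Ring B]

/-- The localization of `A` at all elements whose image under `φ : A → B` is invertible, with the
induced homomorphism to `B`. -/
def step (X : RingOver B) : RingOver B where
  carrier := UnivLoc X.carrier {s | IsUnit (X.hom s)}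
  hom := UnivLoc.lift (S := {s | IsUnit (X.hom s)}) X.hom fun _ h => h

/-- The canonical homomorphism `A → A_S`, where `S = {s | φ s is invertible}`. -/
def toStep (X : RingOver B) : X.carrier →+* X.step.carrier := UnivLoc.of _ _

@[simp] lemma step_hom_toStep (X : RingOver B) (a : X.carrier) : X.step.hom (X.toStep a) = X.hom a :=
  UnivLoc.lift_of (S := {s | IsUnit (X.hom s)}) X.hom (fun _ h => h) a

/-- The iterated localizations `A₀ = A, A₁, A₂, …`. -/
def stage (X : RingOver B) : ℕ → RingOver B
  | 0 => X
  | n + 1 => (X.stage n).step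

/-- The sequence `A₀ → A₁ → A₂ → ⋯`. -/
def seq (X : RingOver B) : ℕ ⥤ RingCat.{u} :=
  Functor.ofSequence (X := fun n => RingCat.of (X.stage n).carrier)
    fun n => RingCat.ofHom (X.stage n).toStep

/-- The compatible homomorphisms `Aₙ → B`. -/
def seqCocone (X : RingOver B) : Cocone X.seq where
  pt := RingCat.of B
  ι := NatTrans.ofSequence (F := X.seq) (G := (Functor.const ℕ).obj (RingCat.of B))
    (fun n => RingCat.ofHom (X.stage n).hom) fun n => by
      ext a
      have h : X.seq.map (homOfLE n.le_succ) = RingCat.ofHom (X.stage n).toStep :=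
        Functor.ofSequence_map_homOfLE_succ _ n
      rw [h]
      exact (X.stage n).step_hom_toStep a

/-- The localization `A_φ`, the direct limit of the rings `Aₙ`, with the homomorphism
`Ψ_φ : A_φ → B`. -/
def localization (X : RingOver B) : RingOver B where
  carrier := (colimit X.seq : RingCat.{u})
  hom := (colimit.desc X.seq X.seqCocone).hom

/-- The canonical homomorphism `Λ_φ : A → A_φ`. -/
def toLocalization (X : RingOver B) : X.carrier →+* X.localization.carrier :=
  (colimit.ι X.seq 0).hom

lemma localization_hom_comp (X : RingOver B) :
    X.localization.hom.comp X.toLocalization = X.hom :=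
  congrArg RingCat.Hom.hom (colimit.ι_desc X.seqCocone 0)

end RingOver

/-! ### Simple LF-extensions -/

/-- A monic polynomial `F` over `A` with a factorization of its reduction into left (right) coprime
monic polynomials `f₁`, `f₂` over `A / I`. -/
structure FactDatum (s : Side) (P : RingPair.{u}) : Type u where
  F : P[X]
  f₁ : P.Residue[X]
  f₂ : P.Residue[X]
  monic_F : F.Monic
  monic_f₁ : f₁.Monic
  monic_f₂ : f₂.Monic
  coprime : s.Coprime f₁ f₂
  map_F : F.map P.residue = f₁ * f₂

namespace FactDatum

variable {s : Side} {P : RingPair.{u}} (d : FactDatum s P)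

/-- The index set of the variables `y₀, …, y_{d₁-1}, z₀, …, z_{d₂-1}`. -/
abbrev Vars : Type := Fin d.f₁.natDegree ⊕ Fin d.f₂.natDegree

/-- The polynomial `y₀ + y₁ x + ⋯ + x ^ d₁` over `A⟨y, z⟩`. -/
def G₁ : (FreeExt P d.Vars)[X] :=
  X ^ d.f₁.natDegree + ∑ i : Fin d.f₁.natDegree, C (FreeExt.var P d.Vars (Sum.inl i)) * X ^ (i : ℕ)

/-- The polynomial `z₀ + z₁ x + ⋯ + x ^ d₂` over `A⟨y, z⟩`. -/
def G₂ : (FreeExt P d.Vars)[X] :=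
  X ^ d.f₂.natDegree + ∑ i : Fin d.f₂.natDegree, C (FreeExt.var P d.Vars (Sum.inr i)) * X ^ (i : ℕ)

/-- The relations that equate the coefficients of `G₁ G₂` with those of `F`. -/
inductive Rel : FreeExt P d.Vars → FreeExt P d.Vars → Prop
  | coeff (k : ℕ) : Rel ((d.G₁ * d.G₂).coeff k) ((d.F.map (FreeExt.of P d.Vars)).coeff k)

/-- The ring `A⟨y, z⟩ / (G₁ G₂ = F)`. -/
abbrev Univ : Type u := RingQuot d.Rel

/-- The homomorphism `α : A⟨y, z⟩ → A / I` that sends the variables to the coefficients of `f₁`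
and `f₂`. -/
def toResidueFree : FreeExt P d.Vars →+* P.Residue :=
  FreeExt.lift P.residue (Sum.elim (fun i => d.f₁.coeff i) (fun i => d.f₂.coeff i))

lemma eq_of_monic {R : Type u} [Ring R] {f : R[X]} (hf : f.Monic) :
    X ^ f.natDegree + ∑ i : Fin f.natDegree, C (f.coeff i) * X ^ (i : ℕ) = f := by
  rw [Fin.sum_univ_eq_sum_range (fun i => C (f.coeff i) * X ^ i) f.natDegree]
  exact hf.as_sum.symm

lemma map_G₁ : d.G₁.map d.toResidueFree = d.f₁ := by
  conv_rhs => rw [← eq_of_monic d.monic_f₁]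
  simp [G₁, toResidueFree, Polynomial.map_sum]

lemma map_G₂ : d.G₂.map d.toResidueFree = d.f₂ := by
  conv_rhs => rw [← eq_of_monic d.monic_f₂]
  simp [G₂, toResidueFree, Polynomial.map_sum]

/-- The homomorphism `β : A⟨y, z⟩ / (G₁ G₂ = F) → A / I` induced by `α`. -/
def toResidue : d.Univ →+* P.Residue :=
  RingQuot.lift ⟨d.toResidueFree, by
    intro a b r
    cases r with
    | coeff k =>
      rw [← Polynomial.coeff_map, Polynomial.map_mul, map_G₁, map_G₂, ← d.map_F,
        Polynomial.coeff_map, Polynomial.coeff_map, toResidueFree, FreeExt.lift_of]⟩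

/-- The canonical homomorphism `A → A⟨y, z⟩ / (G₁ G₂ = F)`. -/
def ofBase : P →+* d.Univ := (RingQuot.mkRingHom d.Rel).comp (FreeExt.of P d.Vars)

@[simp] lemma toResidue_ofBase (a : P) : d.toResidue (d.ofBase a) = P.residue a := by
  change RingQuot.lift _ (RingQuot.mkRingHom _ _) = _
  rw [RingQuot.lift_mkRingHom_apply]
  exact FreeExt.lift_of _ _ _

/-- The ring `A⟨y, z⟩ / (G₁ G₂ = F)` over `A / I`, via `β`. -/
def univOver : RingOver P.Residue := ⟨d.Univ, d.toResidue⟩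

/-- The pair `(R, J)`, where `R` is the localization `(A⟨y, z⟩ / (G₁ G₂ = F))_β` and `J` is the
kernel of `γ : R → A / I`. -/
def localPair : RingPair.{u} where
  carrier := d.univOver.localization.carrier
  ideal := RingHom.ker d.univOver.localization.hom

/-- The morphism `η : (A, I) → (R, J)`. -/
def toLocalPair : P ⟶ d.localPair where
  toRingHom := d.univOver.toLocalization.comp d.ofBase
  comap_ideal := by
    ext a
    have h : d.univOver.localization.hom (d.univOver.toLocalization (d.ofBase a)) = P.residue a :=
      (RingHom.congr_fun d.univOver.localization_hom_comp (d.ofBase a)).trans (d.toResidue_ofBase a)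
    change d.univOver.localization.hom (d.univOver.toLocalization (d.ofBase a)) = 0 ↔ _
    rw [h]
    exact Ideal.Quotient.eq_zero_iff_mem

/-- The pair `(A⟨F; f₁, f₂⟩, I⟨F; f₁, f₂⟩)`. -/
def ext : RingPair.{u} := d.localPair.perfection

/-- The simple LF-extension `Φ_⟨F; f₁, f₂⟩ : (A, I) → (A⟨F; f₁, f₂⟩, I⟨F; f₁, f₂⟩)`. -/
def toExt : P ⟶ d.ext := d.toLocalPair ≫ d.localPair.toPerfection

end FactDatum

/-! ### LF-extensions -/

/-- Sequences of `n + 1` successive simple LF-extensions that start at a given pair. -/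
def LFTower (s : Side) : ℕ → RingPair.{u} → Type u
  | 0, P => FactDatum s P
  | n + 1, P => Σ d : FactDatum s P, LFTower s n d.ext

/-- The last pair of a sequence of simple LF-extensions. -/
def LFTower.target {s : Side} : ∀ (n : ℕ) (P : RingPair.{u}), LFTower s n P → RingPair.{u}
  | 0, _, d => FactDatum.ext d
  | n + 1, _, ⟨_, t⟩ => LFTower.target n _ t

/-- The composite of a sequence of simple LF-extensions. -/
def LFTower.hom {s : Side} :
    ∀ (n : ℕ) (P : RingPair.{u}) (t : LFTower s n P), P ⟶ LFTower.target n P t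
  | 0, _, d => FactDatum.toExt d
  | n + 1, _, ⟨d, t⟩ => d.toExt ≫ LFTower.hom n _ t

/-- The set of (left or right) LF-extensions of `P`: composites of finite nonempty sequences of
simple LF-extensions. -/
def LFExt (s : Side) (P : RingPair.{u}) : Type u := Σ n : ℕ, LFTower s n P

namespace LFExt

variable {s : Side} {P : RingPair.{u}}

/-- The target of an LF-extension. -/
def target (x : LFExt s P) : RingPair.{u} := LFTower.target x.1 P x.2

/-- The morphism `P ⟶ x.target` of an LF-extension. -/
def hom (x : LFExt s P) : P ⟶ x.target := LFTower.hom x.1 P x.2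

/-- An LF-extension as an object under `P`. -/
def toUnder (x : LFExt s P) : Under P := Under.mk x.hom

/-- A morphism `φ₁ ⟶ φ₂` of LF-extensions is a morphism `ψ` of pairs with `φ₂ = ψ ∘ φ₁`. -/
instance : Category (LFExt s P) := inferInstanceAs (Category (InducedCategory (Under P) toUnder))

/-- The system of the targets of all LF-extensions of `P`. -/
def system (s : Side) (P : RingPair.{u}) : LFExt s P ⥤ RingPair.{u} :=
  (inducedFunctor (toUnder (s := s) (P := P)) : InducedCategory (Under P) toUnder ⥤ Under P) ⋙
    Under.forget P

end LFExt

/-! ### Henselizations -/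

/-- A morphism `φ : P ⟶ L` is a left (right) Henselization of `P` if `L` is a left (right)
Henselian perfect pair and every morphism from `P` to a left (right) Henselian perfect pair factors
uniquely through `φ`. -/
def IsHenselization (s : Side) {P L : RingPair.{u}} (φ : P ⟶ L) : Prop :=
  L.IsHenselian s ∧ L.IsPerfect ∧
    ∀ (Q : RingPair.{u}), Q.IsHenselian s → Q.IsPerfect →
      ∀ θ : P ⟶ Q, ∃! ψ : L ⟶ Q, φ ≫ ψ = θ

end

/-! Two facts carry the theorem. The first is rigidity: in a perfect Jacobson pair a coprime
factorization lifts in at most one way (`IsJacobson.factorization_unique`). Modulo the next term of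
the commutator filtration, the differences `u`, `v` of two lifts have coefficients in a central
ideal and satisfy a linear equation `f₁ v + u g₂ = 0`. A central ideal is killed by all commutators,
so this equation can be treated over the largest commutative quotient. There left and right
coprimality coincide, and Nakayama's lemma provides comaximality. Degrees then force `u = v = 0`,
and perfectness turns agreement modulo every term into equality.

A simple LF-extension is a perfect Jacobson pair, and a morphism to a perfect Jacobson pair extends
to it as soon as the given factorization lifts (`FactDatum.exists_ext_lift`), uniquely by rigidity
(`FactDatum.ext_hom_ext`). Hence there is at most one morphism between two LF-extensions, and
pushing one tower forward along another gives upper bounds (`LFTower.exists_pushforward`). The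
residue ring never changes, so the direct limit is Jacobson, and a coprime factorization over the
limit is defined at one stage and lifts at a later one. Morphisms to Henselian perfect pairs extend
uniquely to all stages, hence to the limit.

The difficulty is that the limit is perfect, because an infinite intersection need not be compatible
with direct limits. The second fact settles this: a nonzero element of a perfect Jacobson pair
survives under some morphism to a Henselian perfect pair (`exists_isHenselian_ringHom_ne_zero`).
Applied at a stage, that morphism extends over the limit, where it kills the whole commutator core.

For the second fact the commutator filtration may be assumed to terminate. In a finitely generated
subring containing the element `a`, take an ideal inside `I` maximal among those that miss `(1 + I)
a`. In the quotient by it, dévissage to commutative noetherian rings and Krull's intersection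
theorem show that every element of `I` is killed by a power of `I`
(`isLocallyNilpotent_of_essential`). Such a pair is Henselian, by finitely many central corrections
of square zero (`IsLocallyNilpotent.isHenselian`). A reduced product over the finite subsets glues
these morphisms on subrings to one on the whole ring (`isHenselian_reducedProduct`). -/

noncomputable section

/-! ### Two-sided ideals -/

section TwoSided

variable {R : Type u} [Ring R]

/-- The two-sided ideal generated by a set, as an ideal. -/
def twoSidedSpan (S : Set R) : Ideal R := (TwoSidedIdeal.span S).asIdeal

instance (S : Set R) : (twoSidedSpan S).IsTwoSided :=
  inferInstanceAs (TwoSidedIdeal.asIdeal _).IsTwoSided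

lemma subset_twoSidedSpan (S : Set R) : S ⊆ twoSidedSpan S := TwoSidedIdeal.subset_span

lemma twoSidedSpan_le {S : Set R} {I : Ideal R} [I.IsTwoSided] :
    twoSidedSpan S ≤ I ↔ S ⊆ I := by
  refine ⟨fun h => (subset_twoSidedSpan S).trans h, fun h => ?_⟩
  have : TwoSidedIdeal.span S ≤ I.toTwoSided :=
    TwoSidedIdeal.span_le.2 fun x hx => Ideal.mem_toTwoSided.2 (h hx)
  intro x hx
  exact Ideal.mem_toTwoSided.1 (this hx)

lemma Ideal.isTwoSided_map_of_surjective {S : Type v} [Ring S] {f : R →+* S}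
    (hf : Function.Surjective f) (I : Ideal R) [I.IsTwoSided] : (I.map f).IsTwoSided := by
  refine ⟨fun {a'} b ha' => ?_⟩
  obtain ⟨a, ha, rfl⟩ := (Ideal.mem_map_iff_of_surjective f hf).1 ha'
  obtain ⟨b, rfl⟩ := hf b
  rw [← map_mul]
  exact Ideal.mem_map_of_mem _ (Ideal.mul_mem_right _ I ha)

/-- The radical directly supplies only left inverses. A left inverse of an element of `1 + I` lies
in `1 + I` again, so it has a left inverse too, and both are two-sided. -/
lemma isUnit_of_sub_one_mem_jacobson {I : Ideal R} (hI : I ≤ Ring.jacobson R) {a : R}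
    (ha : a - 1 ∈ I) : IsUnit a := by
  have key : ∀ a : R, a - 1 ∈ I → ∃ z : R, z - 1 ∈ I ∧ z * a = 1 := by
    intro a ha
    have h := hI ha
    rw [← Ideal.jacobson_bot] at h
    obtain ⟨z, hz⟩ := Ideal.exists_mul_sub_mem_of_sub_one_mem_jacobson a h
    have hz' : z * a = 1 := sub_eq_zero.1 (by simpa using hz)
    refine ⟨z, ?_, hz'⟩
    have : z - 1 = -(z * (a - 1)) := by rw [mul_sub, hz']; simp
    rw [this]
    exact I.neg_mem (I.mul_mem_left _ ha)
  obtain ⟨z, hz, hza⟩ := key a ha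
  obtain ⟨w, -, hwz⟩ := key z hz
  have : w = a := by rw [← mul_one w, ← hza, ← mul_assoc, hwz, one_mul]
  subst this
  exact ⟨⟨w, z, hwz, hza⟩, rfl⟩

lemma le_jacobson_of_forall_isUnit {I : Ideal R} (h : ∀ i ∈ I, IsUnit (1 + i)) :
    I ≤ Ring.jacobson R := by
  intro x hx
  rw [← Ideal.jacobson_bot, Ideal.mem_jacobson_iff]
  intro y
  obtain ⟨u, hu⟩ := h _ (I.mul_mem_left y hx)
  refine ⟨(u⁻¹ : Rˣ), ?_⟩
  have : ((u⁻¹ : Rˣ) : R) * (1 + y * x) = 1 := by rw [← hu]; simp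
  rw [mul_add, mul_one, ← mul_assoc] at this
  rw [add_comm, this, sub_self]
  exact zero_mem _

end TwoSided

/-! ### Pairs: residue maps, the Jacobson property, the commutator filtration and quotients -/

namespace RingPair

variable {P Q S : RingPair.{u}}

/-- The ring homomorphism underlying a morphism of pairs. -/
abbrev ringHom (f : P ⟶ Q) : P →+* Q := Hom.toRingHom f

lemma hom_ext {f g : P ⟶ Q} (h : ∀ a, ringHom f a = ringHom g a) : f = g :=
  Hom.ext (RingHom.ext h)

lemma ringHom_mem_iff (f : P ⟶ Q) {a : P} : ringHom f a ∈ Q.ideal ↔ a ∈ P.ideal := by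
  conv_rhs => rw [← f.comap_ideal]
  rfl

lemma residue_eq_zero_iff {a : P} : P.residue a = 0 ↔ a ∈ P.ideal :=
  Ideal.Quotient.eq_zero_iff_mem

lemma residue_surjective : Function.Surjective P.residue := Ideal.Quotient.mk_surjective

/-- The homomorphism of residue rings induced by a morphism of pairs. -/
def residueMap (f : P ⟶ Q) : P.Residue →+* Q.Residue :=
  Ideal.quotientMap Q.ideal (ringHom f) f.comap_ideal.ge

@[simp] lemma residueMap_residue (f : P ⟶ Q) (a : P) :
    residueMap f (P.residue a) = Q.residue (ringHom f a) := rfl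

lemma residueMap_comp_residue (f : P ⟶ Q) :
    (residueMap f).comp P.residue = Q.residue.comp (ringHom f) := rfl

lemma residueMap_injective (f : P ⟶ Q) : Function.Injective (residueMap f) := by
  rw [injective_iff_map_eq_zero]
  intro a
  obtain ⟨a, rfl⟩ := residue_surjective a
  rw [residueMap_residue, residue_eq_zero_iff, ringHom_mem_iff, residue_eq_zero_iff]
  exact id

/-- If `b` lifts an inverse of the residue of `a`, then `a b` and `b a` lie in `1 + I`. Detection of
units modulo `I` is the form of the Jacobson property that passes easily to localizations, quotients
and direct limits. -/
lemma isJacobson_iff : P.IsJacobson ↔ ∀ a : P, IsUnit (P.residue a) → IsUnit a := by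
  constructor
  · intro h a ha
    obtain ⟨u, hu⟩ := ha
    obtain ⟨b, hb⟩ := residue_surjective ((u⁻¹ : (P.Residue)ˣ) : P.Residue)
    have h1 : a * b - 1 ∈ P.ideal := by
      rw [← residue_eq_zero_iff, map_sub, map_mul, map_one, hb, ← hu]; simp
    have h2 : b * a - 1 ∈ P.ideal := by
      rw [← residue_eq_zero_iff, map_sub, map_mul, map_one, hb, ← hu]; simp
    obtain ⟨v, hv⟩ := isUnit_of_sub_one_mem_jacobson h h1
    obtain ⟨w, hw⟩ := isUnit_of_sub_one_mem_jacobson h h2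
    refine isUnit_iff_exists_and_exists.2
      ⟨⟨b * (v⁻¹ : (P.carrier)ˣ), ?_⟩, ⟨(w⁻¹ : (P.carrier)ˣ) * b, ?_⟩⟩
    · rw [← mul_assoc, ← hv]; simp
    · rw [mul_assoc, ← hw]; simp
  · intro h
    refine le_jacobson_of_forall_isUnit fun i hi => h _ ?_
    rw [map_add, residue_eq_zero_iff.2 hi]
    simp

lemma commFiltration_succ (n : ℕ) : P.commFiltration (n + 1) =
    twoSidedSpan {x : P | ∃ a : P, ∃ i ∈ P.commFiltration n, x = a * i - i * a} := rfl

lemma commutator_mem (n : ℕ) (a : P) {i : P} (hi : i ∈ P.commFiltration n) :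
    a * i - i * a ∈ P.commFiltration (n + 1) :=
  subset_twoSidedSpan _ ⟨a, i, hi, rfl⟩

lemma commFiltration_succ_le (n : ℕ) : P.commFiltration (n + 1) ≤ P.commFiltration n := by
  rw [commFiltration_succ, twoSidedSpan_le]
  rintro _ ⟨a, i, hi, rfl⟩
  exact sub_mem (Ideal.mul_mem_left _ _ hi) (Ideal.mul_mem_right _ _ hi)

lemma commFiltration_antitone : Antitone P.commFiltration :=
  antitone_nat_of_succ_le commFiltration_succ_le

lemma commFiltration_le_ideal (n : ℕ) : P.commFiltration n ≤ P.ideal :=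
  commFiltration_antitone (Nat.zero_le n)

lemma ringHom_mem_commFiltration (f : P ⟶ Q) (n : ℕ) :
    ∀ {a : P}, a ∈ P.commFiltration n → ringHom f a ∈ Q.commFiltration n := by
  induction n with
  | zero => exact (ringHom_mem_iff f).2
  | succ n ih =>
    intro a ha
    have : P.commFiltration (n + 1) ≤ (Q.commFiltration (n + 1)).comap (ringHom f) := by
      rw [commFiltration_succ, twoSidedSpan_le]
      rintro _ ⟨a, i, hi, rfl⟩
      simpa using commutator_mem n (ringHom f a) (ih hi)
    exact this ha

lemma ringHom_mem_commCore (f : P ⟶ Q) {a : P} (ha : a ∈ P.commCore) :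
    ringHom f a ∈ Q.commCore := by
  simp only [commCore, Submodule.mem_iInf] at ha ⊢
  exact fun n => ringHom_mem_commFiltration f n (ha n)

lemma IsPerfect.ringHom_eq_zero (hQ : Q.IsPerfect) (f : P ⟶ Q) {a : P} (ha : a ∈ P.commCore) :
    ringHom f a = 0 := by
  have := ringHom_mem_commCore f ha
  rwa [hQ] at this

/-- The image of a two-sided ideal under a surjection is two-sided, so generating commutators can be
lifted one at a time. The start uses that `P.ideal` is the full preimage of `Q.ideal`. -/
lemma exists_mem_commFiltration_of_surjective (f : P ⟶ Q) (hf : Function.Surjective (ringHom f))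
    (n : ℕ) : ∀ {b : Q}, b ∈ Q.commFiltration n → ∃ a ∈ P.commFiltration n, ringHom f a = b := by
  suffices Q.commFiltration n ≤ (P.commFiltration n).map (ringHom f) from fun {b} hb =>
    (Ideal.mem_map_iff_of_surjective _ hf).1 (this hb)
  induction n with
  | zero =>
    intro b hb
    obtain ⟨a, rfl⟩ := hf b
    exact Ideal.mem_map_of_mem _ ((ringHom_mem_iff f).1 hb)
  | succ n ih =>
    have := Ideal.isTwoSided_map_of_surjective hf (P.commFiltration (n + 1))
    rw [commFiltration_succ, twoSidedSpan_le]
    rintro _ ⟨b, j, hj, rfl⟩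
    obtain ⟨i, hi, rfl⟩ := (Ideal.mem_map_iff_of_surjective _ hf).1 (ih hj)
    obtain ⟨a, rfl⟩ := hf b
    rw [← map_mul, ← map_mul, ← map_sub]
    exact Ideal.mem_map_of_mem _ (commutator_mem n a hi)

lemma IsJacobson.of_surjective (hP : P.IsJacobson) (f : P ⟶ Q)
    (hf : Function.Surjective (ringHom f)) : Q.IsJacobson := by
  rw [isJacobson_iff] at hP ⊢
  intro b hb
  obtain ⟨a, rfl⟩ := hf b
  refine (hP a ?_).map (ringHom f)
  obtain ⟨u, hu⟩ := hb
  obtain ⟨c, hc⟩ := residue_surjective ((u⁻¹ : (Q.Residue)ˣ) : Q.Residue)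
  obtain ⟨c, rfl⟩ := hf c
  refine isUnit_iff_exists.2 ⟨P.residue c, residueMap_injective f ?_, residueMap_injective f ?_⟩
  · rw [map_mul, residueMap_residue, residueMap_residue, ← hu, hc]; simp
  · rw [map_mul, residueMap_residue, residueMap_residue, ← hu, hc]; simp

/-- The pair `(A / N, I / N)`. -/
def quotient (P : RingPair.{u}) (N : Ideal P) [N.IsTwoSided] : RingPair.{u} where
  carrier := P ⧸ N
  ideal := P.ideal.map (Ideal.Quotient.mk N)

/-- The quotient morphism `(A, I) → (A / N, I / N)`. -/
def toQuotient (N : Ideal P) [N.IsTwoSided] (h : N ≤ P.ideal) : P ⟶ P.quotient N where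
  toRingHom := Ideal.Quotient.mk N
  comap_ideal := by
    change (P.ideal.map (Ideal.Quotient.mk N)).comap (Ideal.Quotient.mk N) = _
    rw [Ideal.comap_map_of_surjective _ Ideal.Quotient.mk_surjective]
    refine sup_eq_left.2 fun x hx => h ?_
    exact Ideal.Quotient.eq_zero_iff_mem.1 (by simpa using hx)

lemma toQuotient_surjective (N : Ideal P) [N.IsTwoSided] (h : N ≤ P.ideal) :
    Function.Surjective (ringHom (toQuotient N h)) := Ideal.Quotient.mk_surjective

lemma toQuotient_eq_zero_iff (N : Ideal P) [N.IsTwoSided] (h : N ≤ P.ideal) {a : P} :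
    ringHom (toQuotient N h) a = 0 ↔ a ∈ N := Ideal.Quotient.eq_zero_iff_mem

/-- A morphism of pairs that vanishes on `N` factors through `(A / N, I / N)`. -/
def quotientLift (N : Ideal P) [N.IsTwoSided] (h : N ≤ P.ideal) (f : P ⟶ Q)
    (hf : ∀ a ∈ N, ringHom f a = 0) : P.quotient N ⟶ Q where
  toRingHom := Ideal.Quotient.lift N (ringHom f) hf
  comap_ideal := by
    ext a
    obtain ⟨a, rfl⟩ := toQuotient_surjective N h a
    rw [ringHom_mem_iff (toQuotient N h), ← ringHom_mem_iff f]
    rfl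

lemma commFiltration_quotient_eq_bot (n : ℕ) :
    (P.quotient (P.commFiltration n)).commFiltration n = ⊥ := by
  rw [eq_bot_iff]
  intro b hb
  obtain ⟨a, ha, rfl⟩ := exists_mem_commFiltration_of_surjective
    (toQuotient _ (commFiltration_le_ideal n)) (toQuotient_surjective _ _) n hb
  exact (toQuotient_eq_zero_iff _ _).2 ha

lemma IsPerfect.of_commFiltration_eq_bot {n : ℕ} (h : P.commFiltration n = ⊥) : P.IsPerfect :=
  eq_bot_iff.2 ((iInf_le _ n).trans h.le)

lemma isPerfect_iff : P.IsPerfect ↔ ∀ a : P, (∀ n, a ∈ P.commFiltration n) → a = 0 := by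
  rw [IsPerfect, eq_bot_iff, commCore, SetLike.le_def]
  simp only [Submodule.mem_iInf, Submodule.mem_bot]

lemma toPerfection_surjective : Function.Surjective (ringHom P.toPerfection) :=
  Ideal.Quotient.mk_surjective

/-- Lifts of an element to the various terms of the filtration differ by elements of the core, which
lies in every term. So any one lift already lies in all of them. -/
lemma perfection_isPerfect : P.perfection.IsPerfect := by
  rw [isPerfect_iff]
  intro b hb
  obtain ⟨a, rfl⟩ := toPerfection_surjective b
  refine Ideal.Quotient.eq_zero_iff_mem.2 ?_
  simp only [commCore, Submodule.mem_iInf]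
  intro n
  obtain ⟨a', ha', h⟩ := exists_mem_commFiltration_of_surjective _ toPerfection_surjective n (hb n)
  have : a - a' ∈ P.commCore := Ideal.Quotient.eq.1 h.symm
  have := (iInf_le P.commFiltration n) this
  simpa using add_mem this ha'

end RingPair

/-! ### Polynomials over noncommutative rings -/

section Poly

variable {R : Type u} [Ring R]

/-- The polynomials with coefficients in a two-sided ideal. -/
def polyIdeal (E : Ideal R) [E.IsTwoSided] : Ideal R[X] :=
  RingHom.ker (Polynomial.mapRingHom (Ideal.Quotient.mk E))

instance (E : Ideal R) [E.IsTwoSided] : (polyIdeal E).IsTwoSided :=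
  inferInstanceAs (RingHom.ker _).IsTwoSided

lemma mem_polyIdeal_iff_map {E : Ideal R} [E.IsTwoSided] {p : R[X]} :
    p ∈ polyIdeal E ↔ p.map (Ideal.Quotient.mk E) = 0 := Iff.rfl

lemma mem_polyIdeal {E : Ideal R} [E.IsTwoSided] {p : R[X]} :
    p ∈ polyIdeal E ↔ ∀ k, p.coeff k ∈ E := by
  rw [mem_polyIdeal_iff_map, Polynomial.ext_iff]
  simp [Ideal.Quotient.eq_zero_iff_mem]

lemma polyIdeal_mono {E E' : Ideal R} [E.IsTwoSided] [E'.IsTwoSided] (h : E ≤ E') :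
    polyIdeal E ≤ polyIdeal E' := fun _ hp =>
  mem_polyIdeal.2 fun k => h (mem_polyIdeal.1 hp k)

lemma map_mem_polyIdeal {S : Type v} [Ring S] (f : R →+* S) {E : Ideal R} [E.IsTwoSided]
    {E' : Ideal S} [E'.IsTwoSided] (h : ∀ e ∈ E, f e ∈ E') {p : R[X]} (hp : p ∈ polyIdeal E) :
    p.map f ∈ polyIdeal E' :=
  mem_polyIdeal.2 fun k => by
    rw [coeff_map]
    exact h _ (mem_polyIdeal.1 hp k)

/-- The elements of `E` commute with all elements of the ring. -/
def Ideal.IsCentral (E : Ideal R) : Prop := ∀ e ∈ E, ∀ r : R, r * e = e * r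

lemma Ideal.IsCentral.commute {E : Ideal R} [E.IsTwoSided] (hE : E.IsCentral) {m : R[X]}
    (hm : m ∈ polyIdeal E) (p : R[X]) : p * m = m * p := by
  ext k
  rw [coeff_mul, coeff_mul, ← Finset.Nat.sum_antidiagonal_swap]
  exact Finset.sum_congr rfl fun x _ => hE _ (mem_polyIdeal.1 hm _) _

lemma Ideal.IsCentral.left_comm {E : Ideal R} [E.IsTwoSided] (hE : E.IsCentral) {m : R[X]}
    (hm : m ∈ polyIdeal E) (p q : R[X]) : p * (q * m) = q * (p * m) := by
  rw [hE.commute (Ideal.mul_mem_left _ q hm), mul_assoc, ← hE.commute hm]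

variable (R) in
/-- The ideal generated by the commutators. -/
def commutatorIdeal : Ideal R := twoSidedSpan {x : R | ∃ a b : R, x = a * b - b * a}

instance : (commutatorIdeal R).IsTwoSided := inferInstanceAs (twoSidedSpan _).IsTwoSided

lemma commutator_mem_commutatorIdeal (a b : R) : a * b - b * a ∈ commutatorIdeal R :=
  subset_twoSidedSpan _ ⟨a, b, rfl⟩

variable (R) in
/-- The largest commutative quotient of a ring. -/
abbrev CommQuotient : Type u := R ⧸ commutatorIdeal R

instance : CommRing (CommQuotient R) :=
  { (inferInstance : Ring (R ⧸ commutatorIdeal R)) with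
    mul_comm := by
      intro a b
      obtain ⟨a, rfl⟩ := Ideal.Quotient.mk_surjective a
      obtain ⟨b, rfl⟩ := Ideal.Quotient.mk_surjective b
      exact Ideal.Quotient.eq.2 (commutator_mem_commutatorIdeal a b) }

/-- Since `b e` lies in `E` again, `a (b e) = (b e) a = b (e a) = b (a e)`. Thus a central ideal is
a module over the commutative quotient, which is how commutative algebra enters. -/
lemma Ideal.IsCentral.commutatorIdeal_mul {E : Ideal R} [E.IsTwoSided] (hE : E.IsCentral)
    {c : R} (hc : c ∈ commutatorIdeal R) {e : R} (he : e ∈ E) : c * e = 0 := by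
  have h : commutatorIdeal R ≤ Module.annihilator R E := by
    rw [commutatorIdeal, twoSidedSpan_le]
    rintro _ ⟨a, b, rfl⟩
    refine Module.mem_annihilator.2 fun ⟨e, he⟩ => Subtype.ext ?_
    change (a * b - b * a) * e = 0
    rw [sub_mul, mul_assoc, mul_assoc, hE _ (E.mul_mem_left b he) a, hE e he a, mul_assoc, sub_self]
  exact congrArg Subtype.val (Module.mem_annihilator.1 (h hc) ⟨e, he⟩)

lemma Ideal.IsCentral.polyIdeal_commutatorIdeal_mul {E : Ideal R} [E.IsTwoSided]
    (hE : E.IsCentral) {h : R[X]} (hh : h ∈ polyIdeal (commutatorIdeal R)) {m : R[X]}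
    (hm : m ∈ polyIdeal E) : h * m = 0 := by
  ext k
  rw [coeff_mul, coeff_zero]
  exact Finset.sum_eq_zero fun x _ =>
    hE.commutatorIdeal_mul (mem_polyIdeal.1 hh _) (mem_polyIdeal.1 hm _)

/-- `p = X ^ d + ` terms of degree less than `d`. -/
def MonicOfDegree (d : ℕ) (p : R[X]) : Prop := p.natDegree ≤ d ∧ p.coeff d = 1

namespace MonicOfDegree

variable {d d' : ℕ} {p q : R[X]}

lemma monic (h : MonicOfDegree d p) : p.Monic :=
  monic_of_natDegree_le_of_coeff_eq_one d h.1 h.2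

lemma of_monic (h : p.Monic) : MonicOfDegree p.natDegree p := ⟨le_rfl, h⟩

lemma map {S : Type v} [Ring S] (h : MonicOfDegree d p) (f : R →+* S) :
    MonicOfDegree d (p.map f) :=
  ⟨natDegree_map_le.trans h.1, by rw [coeff_map, h.2, map_one]⟩

lemma mul (hp : MonicOfDegree d p) (hq : MonicOfDegree d' q) : MonicOfDegree (d + d') (p * q) :=
  ⟨natDegree_mul_le_of_le hp.1 hq.1, by
    rw [coeff_mul_add_eq_of_natDegree_le hp.1 hq.1, hp.2, hq.2, mul_one]⟩

lemma natDegree_eq [Nontrivial R] (h : MonicOfDegree d p) : p.natDegree = d :=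
  le_antisymm h.1 (le_natDegree_of_ne_zero (by rw [h.2]; exact one_ne_zero))

lemma degree_eq [Nontrivial R] (h : MonicOfDegree d p) : p.degree = d := by
  rw [degree_eq_natDegree h.monic.ne_zero, h.natDegree_eq]

lemma add (hp : MonicOfDegree d p) (hq : q.degree < d) : MonicOfDegree d (p + q) := by
  rw [degree_lt_iff_coeff_zero] at hq
  refine ⟨natDegree_le_iff_coeff_eq_zero.2 fun k hk => ?_, ?_⟩
  · rw [coeff_add, hq k hk.le, natDegree_le_iff_coeff_eq_zero.1 hp.1 k hk, add_zero]
  · rw [coeff_add, hq d le_rfl, hp.2, add_zero]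

lemma degree_sub_lt (hp : MonicOfDegree d p) (hq : MonicOfDegree d q) : (p - q).degree < d := by
  rw [degree_lt_iff_coeff_zero]
  intro k hk
  rw [coeff_sub]
  rcases hk.eq_or_lt with rfl | hk
  · rw [hp.2, hq.2, sub_self]
  · rw [natDegree_le_iff_coeff_eq_zero.1 hp.1 k hk, natDegree_le_iff_coeff_eq_zero.1 hq.1 k hk,
      sub_self]

lemma eq_zero_of_mul_degree_lt (hp : MonicOfDegree d p) {w u : R[X]} (h : u = p * w)
    (hu : u.degree < d) : u = 0 := by
  nontriviality R
  by_contra hne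
  have hw : w ≠ 0 := by rintro rfl; simp [h] at hne
  rw [h, hp.monic.degree_mul_comm, hp.monic.degree_mul, hp.degree_eq] at hu
  exact absurd hu (not_lt.2 (le_add_of_nonneg_left (zero_le_degree_iff.2 hw)))

end MonicOfDegree

open Classical in
/-- A polynomial over `S` lifts along a surjective homomorphism to one with coefficients in a
given set and of the same degree. -/
lemma exists_lift_polynomial {S : Type v} [Ring S] (f : R →+* S) {T : Set R} (h0 : 0 ∈ T)
    (p : S[X]) (hp : ∀ k, ∃ a ∈ T, f a = p.coeff k) :
    ∃ q : R[X], q.map f = p ∧ (∀ k, q.coeff k ∈ T) ∧ ∀ d : ℕ, p.degree < d → q.degree < d := by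
  choose g hgT hg using hp
  -- Zero coefficients are lifted to `0`, so that the degree bound survives.
  let q : R[X] := ∑ i ∈ Finset.range (p.natDegree + 1), monomial i (if p.coeff i = 0 then 0 else g i)
  have hq : ∀ k, q.coeff k = if p.coeff k = 0 then 0 else g k := by
    intro k
    simp only [q, finsetSum_coeff, coeff_monomial]
    rw [Finset.sum_ite_eq']
    split_ifs with h1 h2 h2
    · rfl
    · rfl
    · rfl
    · exact absurd (coeff_eq_zero_of_natDegree_lt (by simpa using h1)) h2
  refine ⟨q, ?_, ?_, ?_⟩
  · ext k
    rw [coeff_map, hq]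
    split_ifs with h
    · rw [h, map_zero]
    · exact hg k
  · intro k
    rw [hq]
    split_ifs
    · exact h0
    · exact hgT k
  · intro d hd
    rw [degree_lt_iff_coeff_zero] at hd ⊢
    intro k hk
    rw [hq, if_pos (hd k hk)]

/-- The leading term `X ^ d` is kept and only the terms below it are lifted. -/
lemma exists_lift_monicOfDegree {S : Type v} [Ring S] {f : R →+* S} (hf : Function.Surjective f)
    {d : ℕ} {p : S[X]} (hp : MonicOfDegree d p) :
    ∃ q : R[X], q.map f = p ∧ MonicOfDegree d q := by
  have hX : MonicOfDegree d (X ^ d : S[X]) := ⟨natDegree_X_pow_le d, by simp⟩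
  obtain ⟨q, hq, -, hd⟩ := exists_lift_polynomial f (Set.mem_univ 0) (p - X ^ d)
    fun k => (hf _).imp fun a ha => ⟨trivial, ha⟩
  refine ⟨X ^ d + q, by simp [hq], ?_⟩
  exact MonicOfDegree.add ⟨natDegree_X_pow_le d, by simp⟩ (hd d (hp.degree_sub_lt hX))

end Poly

/-- Comaximality of polynomials, one of them monic, lifts along an ideal in the radical. -/
lemma exists_comaximal_of_le_jacobson {A : Type u} [CommRing A] {J : Ideal A}
    (hJ : J ≤ Ideal.jacobson ⊥) {g₁ g₂ : A[X]} (hg : g₁.Monic) {a b : A[X]}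
    (h : a * g₁ + b * g₂ - 1 ∈ polyIdeal J) : ∃ a b : A[X], a * g₁ + b * g₂ = 1 := by
  -- As `g₁` is monic, `M` is a finite `A`-module. Modulo `J` it is generated by the ideal of `g₂`,
  -- so Nakayama's lemma applies.
  let M := A[X] ⧸ Ideal.span {g₁}
  have : Module.Finite A M := hg.finite_quotient
  let π : A[X] →ₐ[A] M := Ideal.Quotient.mkₐ A (Ideal.span {g₁})
  have hπ : Function.Surjective π := Ideal.Quotient.mk_surjective
  let N : Submodule A M := (Ideal.span {π g₂}).restrictScalars A
  have hJM : ∀ p ∈ polyIdeal J, π p ∈ J • (⊤ : Submodule A M) := by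
    intro p hp
    rw [p.as_sum_support_C_mul_X_pow, map_sum]
    refine Submodule.sum_mem _ fun k _ => ?_
    rw [← smul_eq_C_mul, map_smul]
    exact Submodule.smul_mem_smul (mem_polyIdeal.1 hp k) trivial
  have h1 : (⊤ : Submodule A M) ≤ N ⊔ J • ⊤ := by
    intro x _
    obtain ⟨p, rfl⟩ := hπ x
    have hg₁ : π g₁ = 0 := Ideal.Quotient.eq_zero_iff_mem.2 (Ideal.subset_span rfl)
    have : π p = π (p * b) * π g₂ + - π (p * (a * g₁ + b * g₂ - 1)) := by
      simp only [map_mul, map_sub, map_add, hg₁, map_one]; ring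
    rw [this]
    refine Submodule.add_mem_sup ?_ (Submodule.neg_mem _ (hJM _ (Ideal.mul_mem_left _ _ h)))
    exact Ideal.mul_mem_left (Ideal.span {π g₂}) _ (Ideal.subset_span rfl)
  have h2 := Submodule.le_of_le_smul_of_le_jacobson_bot Module.Finite.fg_top hJ h1
  have h3 : π 1 ∈ Ideal.span {π g₂} := h2 (x := π 1) trivial
  obtain ⟨c, hc⟩ := Ideal.mem_span_singleton'.1 h3
  obtain ⟨c, rfl⟩ := hπ c
  rw [← map_mul] at hc
  obtain ⟨e, he⟩ := Ideal.mem_span_singleton'.1 (Ideal.Quotient.eq.1 hc.symm)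
  exact ⟨e, c, by rw [he]; ring⟩

/-! ### Coprimality and linear equations with central coefficients -/

namespace RingPair

variable {P : RingPair.{u}} {s : Side}

lemma polyIdeal_ideal_iff {p : P[X]} : p ∈ polyIdeal P.ideal ↔ p.map P.residue = 0 := Iff.rfl

lemma IsJacobson.map_le_jacobson (hP : P.IsJacobson) :
    P.ideal.map (Ideal.Quotient.mk (commutatorIdeal P)) ≤
      Ideal.jacobson (⊥ : Ideal (CommQuotient P)) := by
  intro x hx
  obtain ⟨i, hi, rfl⟩ := (Ideal.mem_map_iff_of_surjective _ Ideal.Quotient.mk_surjective).1 hx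
  rw [Ideal.mem_jacobson_bot]
  intro y
  obtain ⟨y, rfl⟩ := Ideal.Quotient.mk_surjective y
  have : IsUnit (i * y + 1) :=
    isUnit_of_sub_one_mem_jacobson hP (by simpa using Ideal.mul_mem_right _ _ hi)
  simpa using this.map (Ideal.Quotient.mk (commutatorIdeal P))

/-- In the commutative quotient the order of the factors is irrelevant, so left and right
coprimality give the same relation modulo the image of `I`. That image lies in the radical, and the
relation can be made exact because `g₁` is monic. -/
lemma IsJacobson.exists_comaximal (hP : P.IsJacobson) {g₁ g₂ : P[X]} (hg : g₁.Monic)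
    (h : s.Coprime (g₁.map P.residue) (g₂.map P.residue)) :
    ∃ a b : P[X], a * g₁ + b * g₂ - 1 ∈ polyIdeal (commutatorIdeal P) := by
  let π := Ideal.Quotient.mk (commutatorIdeal P)
  let J := P.ideal.map π
  have hJ : J ≤ Ideal.jacobson (⊥ : Ideal (CommQuotient P)) := hP.map_le_jacobson
  have hπ : ∀ p ∈ polyIdeal P.ideal, p.map π ∈ polyIdeal J := fun p hp =>
    map_mem_polyIdeal π (fun e he => Ideal.mem_map_of_mem π he) hp
  have key : ∃ a b : (CommQuotient P)[X], a * g₁.map π + b * g₂.map π - 1 ∈ polyIdeal J := by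
    cases s with
    | left =>
      obtain ⟨a, b, hab⟩ := h
      obtain ⟨a, rfl⟩ := map_surjective _ residue_surjective a
      obtain ⟨b, rfl⟩ := map_surjective _ residue_surjective b
      refine ⟨a.map π, b.map π, ?_⟩
      have := hπ (a * g₁ + b * g₂ - 1) (by
        rw [polyIdeal_ideal_iff]; simp [hab])
      simpa using this
    | right =>
      obtain ⟨a, b, hab⟩ := h
      obtain ⟨a, rfl⟩ := map_surjective _ residue_surjective a
      obtain ⟨b, rfl⟩ := map_surjective _ residue_surjective b
      refine ⟨a.map π, b.map π, ?_⟩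
      have := hπ (g₁ * a + g₂ * b - 1) (by
        rw [polyIdeal_ideal_iff]; simp [hab])
      rw [mul_comm (a.map π), mul_comm (b.map π)]
      simpa using this
  obtain ⟨a, b, hab⟩ := key
  obtain ⟨a, b, hab⟩ := exists_comaximal_of_le_jacobson hJ (hg.map π) hab
  obtain ⟨a, rfl⟩ := map_surjective π Ideal.Quotient.mk_surjective a
  obtain ⟨b, rfl⟩ := map_surjective π Ideal.Quotient.mk_surjective b
  refine ⟨a, b, ?_⟩
  rw [mem_polyIdeal_iff_map]
  simpa [sub_eq_zero] using hab

variable {E : Ideal P} [E.IsTwoSided] {d₁ d₂ : ℕ} {g₁ g₂ : P[X]}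

/-- The commutator ideal kills `E`, so comaximality modulo commutators acts as an exact identity on
polynomials over `E`. Centrality then moves the cofactors to the right of `g₁` and `g₂`. -/
lemma IsJacobson.exists_forall_eq_add (hP : P.IsJacobson) (hE : E.IsCentral) (hg : g₁.Monic)
    (h : s.Coprime (g₁.map P.residue) (g₂.map P.residue)) :
    ∃ a b : P[X], ∀ m ∈ polyIdeal E, m = g₁ * (a * m) + g₂ * (b * m) := by
  obtain ⟨a, b, hab⟩ := hP.exists_comaximal hg h
  refine ⟨a, b, fun m hm => ?_⟩
  have h1 := hE.polyIdeal_commutatorIdeal_mul hab hm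
  rw [sub_mul, one_mul, sub_eq_zero, add_mul] at h1
  rw [hE.left_comm hm, hE.left_comm hm g₂, ← mul_assoc, ← mul_assoc, h1]

/-- The equation `g₁ v + u g₂ = e` is solvable for `e` with central coefficients. -/
lemma IsJacobson.exists_mul_add_mul_eq (hP : P.IsJacobson) (hE : E.IsCentral)
    (hg₁ : MonicOfDegree d₁ g₁) (hg₂ : MonicOfDegree d₂ g₂)
    (h : s.Coprime (g₁.map P.residue) (g₂.map P.residue)) {e : P[X]} (he : e ∈ polyIdeal E)
    (hd : e.degree < (d₁ + d₂ : ℕ)) : ∃ u ∈ polyIdeal E, ∃ v ∈ polyIdeal E,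
      u.degree < d₁ ∧ v.degree < d₂ ∧ g₁ * v + u * g₂ = e := by
  rcases subsingleton_or_nontrivial P with hs | hs
  · exact ⟨0, zero_mem _, 0, zero_mem _, by simp, by simp, Subsingleton.elim _ _⟩
  obtain ⟨a, b, hab⟩ := hP.exists_forall_eq_add hE hg₁.monic h
  -- Division by `g₁` reduces the cofactor `b e` to the remainder `u` of degree below `d₁`; the
  -- quotient `q` is absorbed into `v`.
  let w := b * e
  have hw : w ∈ polyIdeal E := Ideal.mul_mem_left _ _ he
  let q := w /ₘ g₁
  let u := w %ₘ g₁
  have hwE : w.map (Ideal.Quotient.mk E) = 0 := hw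
  -- Division by a monic polynomial commutes with reduction modulo `E`, where `w` vanishes.
  have hq : q ∈ polyIdeal E := by
    rw [mem_polyIdeal_iff_map, (map_mod_divByMonic _ hg₁.monic).1, hwE, zero_divByMonic]
  have hu : u ∈ polyIdeal E := by
    rw [mem_polyIdeal_iff_map, (map_mod_divByMonic _ hg₁.monic).2, hwE, zero_modByMonic]
  have hdu : u.degree < d₁ := by
    rw [← hg₁.degree_eq]; exact degree_modByMonic_lt _ hg₁.monic
  let v := a * e + q * g₂
  have hv : v ∈ polyIdeal E := add_mem (Ideal.mul_mem_left _ _ he) (Ideal.mul_mem_right _ _ hq)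
  have heq : g₁ * v + u * g₂ = e := by
    have h1 : u + g₁ * q = w := modByMonic_add_div w g₁
    calc g₁ * v + u * g₂ = g₁ * (a * e) + (u + g₁ * q) * g₂ := by simp only [v]; noncomm_ring
      _ = g₁ * (a * e) + g₂ * (b * e) := by rw [h1, hE.commute hw]
      _ = e := (hab e he).symm
  refine ⟨u, hu, v, hv, hdu, ?_, heq⟩
  -- The bound on `v` is read off from the equation, since multiplying by the monic `g₁` adds
  -- exactly `d₁` to the degree.
  have h3 : (g₁ * v).degree < (d₁ + d₂ : ℕ) := by
    rw [eq_sub_of_add_eq heq]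
    refine (degree_sub_le _ _).trans_lt (max_lt hd ?_)
    refine (degree_mul_le _ _).trans_lt ?_
    rw [hg₂.degree_eq, Nat.cast_add]
    exact WithBot.add_lt_add_right (WithBot.coe_ne_bot) hdu
  rw [hg₁.monic.degree_mul_comm, hg₁.monic.degree_mul, hg₁.degree_eq, Nat.cast_add, add_comm] at h3
  exact lt_of_add_lt_add_left h3

/-- The equation `g₁ v + u g₂ = 0` has only the trivial solution with central coefficients. -/
lemma IsJacobson.eq_zero_of_mul_add_mul_eq_zero (hP : P.IsJacobson) (hE : E.IsCentral)
    (hg₁ : MonicOfDegree d₁ g₁) 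
    (h : s.Coprime (g₁.map P.residue) (g₂.map P.residue)) {u v : P[X]} (hu : u ∈ polyIdeal E)
    (hv : v ∈ polyIdeal E) (hd : u.degree < d₁) (h0 : g₁ * v + u * g₂ = 0) : u = 0 ∧ v = 0 := by
  obtain ⟨a, b, hab⟩ := hP.exists_forall_eq_add hE hg₁.monic h
  -- Expand `u` by the comaximality identity and replace `u g₂` by `-g₁ v`. A multiple of the monic
  -- `g₁` of degree below `d₁` is zero.
  have h1 : u = g₁ * (a * u - b * v) := by
    have h2 : g₂ * (b * u) = - (g₁ * (b * v)) := by
      rw [hE.left_comm hu, hE.commute hu, eq_neg_of_add_eq_zero_right h0, mul_neg, hE.left_comm hv]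
    conv_lhs => rw [hab u hu, h2]
    rw [mul_sub, sub_eq_add_neg]
  have h2 := hg₁.eq_zero_of_mul_degree_lt h1 hd
  refine ⟨h2, ?_⟩
  rw [h2, zero_mul, add_zero] at h0
  exact (hg₁.monic.mul_right_eq_zero_iff).1 h0

end RingPair

/-! ### Uniqueness and existence of lifts of factorizations -/

namespace RingPair

variable {P Q : RingPair.{u}} {s : Side} {d₁ d₂ : ℕ}

lemma _root_.Side.Coprime.map {R : Type u} {S : Type u} [Ring R] [Ring S] {f g : R}
    (h : s.Coprime f g) (φ : R →+* S) : s.Coprime (φ f) (φ g) := by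
  cases s with
  | left =>
    obtain ⟨a, b, hab⟩ := h
    exact ⟨φ a, φ b, by rw [← map_mul, ← map_mul, ← map_add, hab, map_one]⟩
  | right =>
    obtain ⟨a, b, hab⟩ := h
    exact ⟨φ a, φ b, by rw [← map_mul, ← map_mul, ← map_add, hab, map_one]⟩

lemma map_residue_map (f : P ⟶ Q) (p : P[X]) :
    (p.map (ringHom f)).map Q.residue = (p.map P.residue).map (residueMap f) := by
  rw [Polynomial.map_map, Polynomial.map_map, residueMap_comp_residue]

lemma coprime_map_residue_map (f : P ⟶ Q) {g₁ g₂ : P[X]}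
    (h : s.Coprime (g₁.map P.residue) (g₂.map P.residue)) :
    s.Coprime ((g₁.map (ringHom f)).map Q.residue) ((g₂.map (ringHom f)).map Q.residue) := by
  rw [map_residue_map, map_residue_map]
  exact h.map (mapRingHom (residueMap f))

/-- In a Jacobson pair, a monic polynomial has the degree of its reduction. -/
lemma IsJacobson.monicOfDegree (hP : P.IsJacobson) {d : ℕ} {g : P[X]} (hg : g.Monic)
    (h : MonicOfDegree d (g.map P.residue)) : MonicOfDegree d g := by
  rcases subsingleton_or_nontrivial P.Residue with hs | hs
  -- A zero residue ring forces `P` to be zero, and then `MonicOfDegree d` holds for every `d`.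
  · have h0 : IsUnit (0 : P) := isJacobson_iff.1 hP 0 (isUnit_of_subsingleton _)
    have : Subsingleton P := subsingleton_of_zero_eq_one (isUnit_zero_iff.1 h0)
    exact ⟨by rw [natDegree_of_subsingleton]; exact Nat.zero_le _, Subsingleton.elim _ _⟩
  · have := (MonicOfDegree.of_monic hg).map P.residue
    have h1 : g.natDegree = d := by rw [← this.natDegree_eq, h.natDegree_eq]
    exact h1 ▸ MonicOfDegree.of_monic hg

/-- If two factorizations with coprime reductions are congruent modulo an ideal of central
elements, then they agree. -/
lemma IsJacobson.factorization_unique_of_isCentral (hP : P.IsJacobson) {E : Ideal P}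
    [E.IsTwoSided] (hE : E.IsCentral) {f₁ f₂ g₁ g₂ : P[X]} (hf₁ : MonicOfDegree d₁ f₁)
    (hg₁ : MonicOfDegree d₁ g₁)
    (h : s.Coprime (f₁.map P.residue) (g₂.map P.residue)) (heq : f₁ * f₂ = g₁ * g₂)
    (h₁ : f₁ - g₁ ∈ polyIdeal E) (h₂ : f₂ - g₂ ∈ polyIdeal E) : f₁ = g₁ ∧ f₂ = g₂ := by
  have h0 : f₁ * (f₂ - g₂) + (f₁ - g₁) * g₂ = 0 := by
    rw [mul_sub, sub_mul, heq]; abel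
  obtain ⟨hu, hv⟩ := hP.eq_zero_of_mul_add_mul_eq_zero hE hf₁ h h₁ h₂ (hf₁.degree_sub_lt hg₁) h0
  exact ⟨sub_eq_zero.1 hu, sub_eq_zero.1 hv⟩

lemma isCentral_commFiltration_of_eq_bot {n : ℕ} (h : P.commFiltration (n + 1) = ⊥) :
    (P.commFiltration n).IsCentral := by
  intro e he r
  have := commutator_mem n r he
  rw [h] at this
  exact sub_eq_zero.1 this

/-- Lifts of coprime factorizations are unique in perfect Jacobson pairs. -/
theorem IsJacobson.factorization_unique (hP : P.IsJacobson) (hP' : P.IsPerfect)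
    {f₁ f₂ g₁ g₂ : P[X]} (hf₁ : MonicOfDegree d₁ f₁) (hg₁ : MonicOfDegree d₁ g₁)
    (h : s.Coprime (f₁.map P.residue) (f₂.map P.residue)) (heq : f₁ * f₂ = g₁ * g₂)
    (h₁ : f₁.map P.residue = g₁.map P.residue) (h₂ : f₂.map P.residue = g₂.map P.residue) :
    f₁ = g₁ ∧ f₂ = g₂ := by
  have key : ∀ n, f₁ - g₁ ∈ polyIdeal (P.commFiltration n) ∧
      f₂ - g₂ ∈ polyIdeal (P.commFiltration n) := by
    intro n
    induction n with
    | zero =>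
      constructor
      · exact polyIdeal_ideal_iff.2 (by rw [Polynomial.map_sub, h₁, sub_self])
      · exact polyIdeal_ideal_iff.2 (by rw [Polynomial.map_sub, h₂, sub_self])
    | succ n ih =>
      -- Modulo the next term the `n`-th term becomes central, so the differences, known by
      -- induction to have coefficients there, vanish.
      let π := toQuotient _ (P.commFiltration_le_ideal (n + 1))
      have hπ := toQuotient_surjective _ (P.commFiltration_le_ideal (n + 1))
      have hm : ∀ p ∈ polyIdeal (P.commFiltration n), p.map (ringHom π) ∈
          polyIdeal ((P.quotient (P.commFiltration (n + 1))).commFiltration n) := fun p hp =>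
        map_mem_polyIdeal _ (fun e he => ringHom_mem_commFiltration π n he) hp
      have := (hP.of_surjective π hπ).factorization_unique_of_isCentral
        (isCentral_commFiltration_of_eq_bot (commFiltration_quotient_eq_bot (n + 1)))
        (hf₁.map (ringHom π)) (hg₁.map (ringHom π)) (coprime_map_residue_map π (h₂ ▸ h))
        (by rw [← Polynomial.map_mul, ← Polynomial.map_mul, heq])
        (by rw [← Polynomial.map_sub]; exact hm _ ih.1)
        (by rw [← Polynomial.map_sub]; exact hm _ ih.2)
      constructor
      · rw [mem_polyIdeal_iff_map, Polynomial.map_sub, sub_eq_zero]; exact this.1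
      · rw [mem_polyIdeal_iff_map, Polynomial.map_sub, sub_eq_zero]; exact this.2
  rw [isPerfect_iff] at hP'
  constructor <;> rw [← sub_eq_zero] <;> ext k <;> refine hP' _ fun n => ?_
  · exact mem_polyIdeal.1 (key n).1 k
  · exact mem_polyIdeal.1 (key n).2 k

/-- A factorization modulo an ideal of central elements of square zero can be corrected. -/
lemma IsJacobson.exists_factorization_of_isCentral (hP : P.IsJacobson) {E : Ideal P}
    [E.IsTwoSided] (hE : E.IsCentral) (hE2 : ∀ a ∈ E, ∀ b ∈ E, a * b = 0) {F g₁ g₂ : P[X]}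
    (hF : MonicOfDegree (d₁ + d₂) F) (hg₁ : MonicOfDegree d₁ g₁) (hg₂ : MonicOfDegree d₂ g₂)
    (h : s.Coprime (g₁.map P.residue) (g₂.map P.residue)) (heq : F - g₁ * g₂ ∈ polyIdeal E) :
    ∃ u ∈ polyIdeal E, ∃ v ∈ polyIdeal E, u.degree < d₁ ∧ v.degree < d₂ ∧
      F = (g₁ + u) * (g₂ + v) := by
  obtain ⟨u, hu, v, hv, hdu, hdv, h0⟩ :=
    hP.exists_mul_add_mul_eq hE hg₁ hg₂ h heq (hF.degree_sub_lt (hg₁.mul hg₂))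
  refine ⟨u, hu, v, hv, hdu, hdv, ?_⟩
  have huv : u * v = 0 := by
    ext k
    rw [coeff_mul, coeff_zero]
    exact Finset.sum_eq_zero fun x _ => hE2 _ (mem_polyIdeal.1 hu _) _ (mem_polyIdeal.1 hv _)
  rw [add_mul, mul_add, mul_add, huv, add_zero, add_assoc, h0]
  abel

/-- If a chain of ideals, whose steps are central and of square zero, ends in `0`, then every
coprime factorization modulo the first ideal can be corrected to a factorization. -/
lemma IsJacobson.exists_factorization_of_chain (hP : P.IsJacobson) (E : ℕ → Ideal P)
    [∀ k, (E k).IsTwoSided] (hEP : ∀ k, E k ≤ P.ideal)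
    (hc : ∀ k, ∀ e ∈ E k, ∀ a : P, a * e - e * a ∈ E (k + 1))
    (h2 : ∀ k, ∀ a ∈ E k, ∀ b ∈ E k, a * b ∈ E (k + 1)) {N : ℕ} (hN : E N = ⊥) {F g₁ g₂ : P[X]}
    (hF : MonicOfDegree (d₁ + d₂) F) (hg₁ : MonicOfDegree d₁ g₁) (hg₂ : MonicOfDegree d₂ g₂)
    (h : s.Coprime (g₁.map P.residue) (g₂.map P.residue)) (heq : F - g₁ * g₂ ∈ polyIdeal (E 0)) :
    ∃ G₁ G₂ : P[X], MonicOfDegree d₁ G₁ ∧ MonicOfDegree d₂ G₂ ∧ F = G₁ * G₂ ∧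
      G₁.map P.residue = g₁.map P.residue ∧ G₂.map P.residue = g₂.map P.residue := by
  suffices key : ∀ k, ∃ G₁ G₂ : P[X], MonicOfDegree d₁ G₁ ∧ MonicOfDegree d₂ G₂ ∧
      F - G₁ * G₂ ∈ polyIdeal (E k) ∧
      G₁.map P.residue = g₁.map P.residue ∧ G₂.map P.residue = g₂.map P.residue by
    obtain ⟨G₁, G₂, h₁, h₂, h₃, h₄⟩ := key N
    refine ⟨G₁, G₂, h₁, h₂, ?_, h₄⟩
    rw [← sub_eq_zero]
    ext k
    have := mem_polyIdeal.1 h₃ k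
    rw [hN] at this
    exact this
  intro k
  induction k with
  | zero => exact ⟨g₁, g₂, hg₁, hg₂, heq, rfl, rfl⟩
  | succ k ih =>
    obtain ⟨G₁, G₂, hG₁, hG₂, heq, hr₁, hr₂⟩ := ih
    let π := toQuotient _ (hEP (k + 1))
    have hπ : Function.Surjective (ringHom π) := toQuotient_surjective _ (hEP (k + 1))
    -- By `hc` and `h2` the image of `E k` modulo `E (k + 1)` is central and of square zero.
    let E' : Ideal (P.quotient (E (k + 1))) := (E k).map (ringHom π)
    have : E'.IsTwoSided := Ideal.isTwoSided_map_of_surjective hπ _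
    have hE' : ∀ {b}, b ∈ E' ↔ ∃ a ∈ E k, ringHom π a = b :=
      Ideal.mem_map_iff_of_surjective _ hπ
    have hcent : E'.IsCentral := by
      intro e he r
      obtain ⟨e, he', rfl⟩ := hE'.1 he
      obtain ⟨r, rfl⟩ := hπ r
      rw [← sub_eq_zero, ← map_mul, ← map_mul, ← map_sub]
      exact (toQuotient_eq_zero_iff _ _).2 (hc k e he' r)
    have hsq : ∀ a ∈ E', ∀ b ∈ E', a * b = 0 := by
      intro a ha b hb
      obtain ⟨a, ha', rfl⟩ := hE'.1 ha
      obtain ⟨b, hb', rfl⟩ := hE'.1 hb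
      rw [← map_mul]
      exact (toQuotient_eq_zero_iff _ _).2 (h2 k a ha' b hb')
    obtain ⟨u, hu, v, hv, hdu, hdv, hFuv⟩ :=
      (hP.of_surjective π hπ).exists_factorization_of_isCentral hcent hsq
      (hF.map (ringHom π)) (hG₁.map (ringHom π)) (hG₂.map (ringHom π))
      (coprime_map_residue_map π (by rw [hr₁, hr₂]; exact h))
      (by rw [← Polynomial.map_mul, ← Polynomial.map_sub]
          exact map_mem_polyIdeal _ (fun e he => Ideal.mem_map_of_mem _ he) heq)
    -- The corrections are lifted with coefficients in `E k`, hence in `I`, and without raising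
    -- degrees: reductions and leading terms stay unchanged.
    have lift : ∀ (u : (P.quotient (E (k + 1)))[X]), u ∈ polyIdeal E' → ∃ U : P[X],
        U.map (ringHom π) = u ∧ U.map P.residue = 0 ∧ ∀ d : ℕ, u.degree < d → U.degree < d := by
      intro u hu
      obtain ⟨U, h1, h2, h3⟩ := exists_lift_polynomial (ringHom π) (T := (E k : Set P))
        (zero_mem _) u fun k => hE'.1 (mem_polyIdeal.1 hu k)
      exact ⟨U, h1, polyIdeal_ideal_iff.1 (mem_polyIdeal.2 fun j => hEP k (h2 j)), h3⟩
    obtain ⟨U, hU, hU0, hUd⟩ := lift u hu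
    obtain ⟨V, hV, hV0, hVd⟩ := lift v hv
    refine ⟨G₁ + U, G₂ + V, hG₁.add (hUd _ hdu), hG₂.add (hVd _ hdv), ?_, ?_, ?_⟩
    · rw [mem_polyIdeal_iff_map]
      change (F - (G₁ + U) * (G₂ + V)).map (ringHom π) = 0
      rw [Polynomial.map_sub, Polynomial.map_mul, Polynomial.map_add, Polynomial.map_add, hU, hV,
        ← hFuv, sub_self]
    · rw [Polynomial.map_add, hU0, add_zero, hr₁]
    · rw [Polynomial.map_add, hV0, add_zero, hr₂]

/-- For a perfect Jacobson pair, only the existence of lifts has to be checked. -/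
lemma isHenselian_of_exists (hP : P.IsJacobson) (hP' : P.IsPerfect)
    (h : ∀ (d₁ d₂ : ℕ) (F g₁ g₂ : P[X]), MonicOfDegree (d₁ + d₂) F → MonicOfDegree d₁ g₁ →
      MonicOfDegree d₂ g₂ → s.Coprime (g₁.map P.residue) (g₂.map P.residue) →
      F.map P.residue = g₁.map P.residue * g₂.map P.residue →
      ∃ G₁ G₂ : P[X], G₁.Monic ∧ G₂.Monic ∧ F = G₁ * G₂ ∧
        G₁.map P.residue = g₁.map P.residue ∧ G₂.map P.residue = g₂.map P.residue) :
    P.IsHenselian s := by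
  refine ⟨hP, fun F f₁ f₂ hF hf₁ hf₂ hc hmap => ?_⟩
  have hd₁ := MonicOfDegree.of_monic hf₁
  have hd₂ := MonicOfDegree.of_monic hf₂
  obtain ⟨g₁, hg₁, hgd₁⟩ := exists_lift_monicOfDegree residue_surjective hd₁
  obtain ⟨g₂, hg₂, hgd₂⟩ := exists_lift_monicOfDegree residue_surjective hd₂
  obtain ⟨G₁, G₂, hG₁, hG₂, heq, hr₁, hr₂⟩ := h _ _ F g₁ g₂
    (hP.monicOfDegree hF (by rw [hmap]; exact hd₁.mul hd₂)) hgd₁ hgd₂ (by rwa [hg₁, hg₂])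
    (by rw [hg₁, hg₂, hmap])
  rw [hg₁] at hr₁
  rw [hg₂] at hr₂
  refine ⟨(G₁, G₂), ⟨hG₁, hG₂, heq, hr₁, hr₂⟩, ?_⟩
  rintro ⟨H₁, H₂⟩ ⟨hH₁, hH₂, heq', hs₁, hs₂⟩
  dsimp only at hH₁ heq' hs₁ hs₂
  obtain ⟨e₁, e₂⟩ := hP.factorization_unique hP' (s := s)
    (hP.monicOfDegree hH₁ (by rwa [hs₁])) (hP.monicOfDegree hG₁ (by rwa [hr₁])) (by rwa [hs₁, hs₂]) (heq'.symm.trans heq)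
    (hs₁.trans hr₁.symm) (hs₂.trans hr₂.symm)
  exact Prod.ext e₁ e₂

end RingPair

/-! ### Locally nilpotent pairs -/

lemma Ideal.isTwoSided_iSup {R : Type u} [Ring R] {ι : Sort v} (E : ι → Ideal R)
    [∀ i, (E i).IsTwoSided] : (⨆ i, E i).IsTwoSided := by
  refine ⟨fun {a} b ha => ?_⟩
  induction ha using Submodule.iSup_induction' with
  | mem i x hx => exact Submodule.mem_iSup_of_mem i (Ideal.mul_mem_right b (E i) hx)
  | zero => rw [zero_mul]; exact zero_mem _
  | add x y _ _ hx hy => rw [add_mul]; exact add_mem hx hy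

namespace RingPair

variable {P Q : RingPair.{u}} {s : Side}

/-- Every element of the ideal is killed by some power of the ideal. -/
def IsLocallyNilpotent (P : RingPair.{u}) : Prop :=
  ∀ i ∈ P.ideal, ∃ t, ∀ y ∈ P.ideal ^ t, y * i = 0

/-- Some power `i ^ t` kills `i` itself, so every element of the ideal is nilpotent. -/
lemma IsLocallyNilpotent.isJacobson (h : P.IsLocallyNilpotent) : P.IsJacobson := by
  refine le_jacobson_of_forall_isUnit fun i hi => ?_
  obtain ⟨t, ht⟩ := h i hi
  refine IsNilpotent.isUnit_one_add ⟨t + 1, ?_⟩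
  rw [pow_succ]
  exact ht _ (Ideal.pow_mem_pow hi t)

/-- The elements of the ideal that are killed by its `t`-th power. -/
def powAnnihilator (P : RingPair.{u}) (t : ℕ) : Ideal P where
  carrier := {i | i ∈ P.ideal ∧ ∀ y ∈ P.ideal ^ t, y * i = 0}
  zero_mem' := ⟨zero_mem _, fun y _ => mul_zero y⟩
  add_mem' ha hb := ⟨add_mem ha.1 hb.1, fun y hy => by rw [mul_add, ha.2 y hy, hb.2 y hy, add_zero]⟩
  smul_mem' r a ha := ⟨Ideal.mul_mem_left _ r ha.1, fun y hy => by
    rw [smul_eq_mul, ← mul_assoc]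
    exact ha.2 _ (Ideal.mul_mem_right r _ hy)⟩

instance (t : ℕ) : (P.powAnnihilator t).IsTwoSided :=
  ⟨fun b ha => ⟨Ideal.mul_mem_right b _ ha.1, fun y hy => by rw [← mul_assoc, ha.2 y hy, zero_mul]⟩⟩

lemma pow_mul_powAnnihilator (t : ℕ) : P.ideal ^ t * P.powAnnihilator t = ⊥ := by
  rw [eq_bot_iff, Ideal.mul_le]
  exact fun y hy i hi => hi.2 y hy

lemma powAnnihilator_mono : Monotone P.powAnnihilator := fun _ _ h _ hi =>
  ⟨hi.1, fun y hy => hi.2 y (Ideal.pow_le_pow_right h hy)⟩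

lemma IsLocallyNilpotent.exists_mem_polyIdeal (h : P.IsLocallyNilpotent) {p : P[X]}
    (hp : p ∈ polyIdeal P.ideal) : ∃ t, p ∈ polyIdeal (P.powAnnihilator t) := by
  have : ∀ k, ∃ t, p.coeff k ∈ P.powAnnihilator t := fun k =>
    (h _ (mem_polyIdeal.1 hp k)).imp fun t ht => ⟨mem_polyIdeal.1 hp k, ht⟩
  choose t ht using this
  refine ⟨p.support.sup t, mem_polyIdeal.2 fun k => ?_⟩
  by_cases hk : k ∈ p.support
  · exact powAnnihilator_mono (Finset.le_sup hk) (ht k)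
  · rw [notMem_support_iff.1 hk]
    exact zero_mem _

/-- The ideals `∑ I⁽ᵐ⁾ ∩ I ^ r D`, where `m + r = k`. -/
def mixedFiltration (P : RingPair.{u}) (D : Ideal P) (k : ℕ) : Ideal P :=
  ⨆ p : {p : ℕ × ℕ // p.1 + p.2 = k}, P.commFiltration p.1.1 ⊓ P.ideal ^ p.1.2 * D

section mixedFiltration

variable (D : Ideal P)

instance [D.IsTwoSided] (k : ℕ) : (P.mixedFiltration D k).IsTwoSided := by
  have (p : {p : ℕ × ℕ // p.1 + p.2 = k}) :
      (P.commFiltration p.1.1 ⊓ P.ideal ^ p.1.2 * D).IsTwoSided :=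
    ⟨fun b ha => ⟨Ideal.mul_mem_right b _ ha.1, Ideal.mul_mem_right b _ ha.2⟩⟩
  exact Ideal.isTwoSided_iSup _

lemma mem_mixedFiltration {m r k : ℕ} (h : m + r = k) {x : P} (h₁ : x ∈ P.commFiltration m)
    (h₂ : x ∈ P.ideal ^ r * D) : x ∈ P.mixedFiltration D k :=
  Submodule.mem_iSup_of_mem (p := fun p : {p : ℕ × ℕ // p.1 + p.2 = k} =>
    P.commFiltration p.1.1 ⊓ P.ideal ^ p.1.2 * D) ⟨(m, r), h⟩ ⟨h₁, h₂⟩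

lemma mixedFiltration_le (k : ℕ) : P.mixedFiltration D k ≤ P.ideal :=
  iSup_le fun _ => inf_le_left.trans (commFiltration_le_ideal _)

/-- Taking a commutator raises the index `m`, while multiplying by an element of `I`
(`mul_mem_mixedFiltration`) raises `r`. Together these make each step of the filtration central and
of square zero modulo the next. -/
lemma commutator_mem_mixedFiltration [D.IsTwoSided] {k : ℕ} {e : P} (he : e ∈ P.mixedFiltration D k) (a : P) :
    a * e - e * a ∈ P.mixedFiltration D (k + 1) := by
  induction he using Submodule.iSup_induction' with
  | mem p x hx =>
    refine mem_mixedFiltration D (m := p.1.1 + 1) (r := p.1.2) (by have := p.2; omega)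
      (commutator_mem _ _ hx.1) (sub_mem (Ideal.mul_mem_left _ _ hx.2) (Ideal.mul_mem_right _ _ hx.2))
  | zero => simp
  | add x y _ _ hx hy =>
    have := add_mem hx hy
    rwa [show a * x - x * a + (a * y - y * a) = a * (x + y) - (x + y) * a by noncomm_ring] at this

lemma mul_mem_mixedFiltration {k : ℕ} {e : P} (he : e ∈ P.mixedFiltration D k) {a : P}
    (ha : a ∈ P.ideal) : a * e ∈ P.mixedFiltration D (k + 1) := by
  induction he using Submodule.iSup_induction' with
  | mem p x hx =>
    refine mem_mixedFiltration D (m := p.1.1) (r := p.1.2 + 1) (by have := p.2; omega)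
      (Ideal.mul_mem_left _ _ hx.1) ?_
    rw [Ideal.IsTwoSided.pow_succ, Ideal.mul_assoc]
    exact Ideal.mul_mem_mul ha hx.2
  | zero => simp
  | add x y _ _ hx hy => rw [mul_add]; exact add_mem hx hy

/-- If `m + r = n + t`, then `m ≥ n` or `r ≥ t`, so each summand vanishes. -/
lemma mixedFiltration_eq_bot {n t : ℕ} (hn : P.commFiltration n = ⊥) (ht : P.ideal ^ t * D = ⊥) :
    P.mixedFiltration D (n + t) = ⊥ := by
  rw [eq_bot_iff]
  refine iSup_le fun p => ?_
  rcases le_or_gt n p.1.1 with h | h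
  · exact inf_le_left.trans ((commFiltration_antitone h).trans hn.le)
  · have h' : t ≤ p.1.2 := by have := p.2; omega
    exact inf_le_right.trans ((Ideal.mul_mono_left (Ideal.pow_le_pow_right h')).trans ht.le)

end mixedFiltration

/-- A locally nilpotent pair whose commutator filtration terminates is Henselian. -/
theorem IsLocallyNilpotent.isHenselian (h : P.IsLocallyNilpotent) {n : ℕ}
    (hn : P.commFiltration n = ⊥) : P.IsHenselian s := by
  refine isHenselian_of_exists h.isJacobson (IsPerfect.of_commFiltration_eq_bot hn)
    fun d₁ d₂ F g₁ g₂ hF hg₁ hg₂ hc hmap => ?_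
  -- The error has finitely many coefficients, so a single power of `I` kills them all. The mixed
  -- filtration of the annihilator `D` of that power is a finite chain along which to correct.
  obtain ⟨t, ht⟩ := h.exists_mem_polyIdeal (p := F - g₁ * g₂)
    (polyIdeal_ideal_iff.2 (by rw [Polynomial.map_sub, Polynomial.map_mul, hmap, sub_self]))
  let D := P.powAnnihilator t
  obtain ⟨G₁, G₂, hG₁, hG₂, H⟩ := h.isJacobson.exists_factorization_of_chain
    (P.mixedFiltration D) (mixedFiltration_le D)
    (fun k e he a => commutator_mem_mixedFiltration D he a)
    (fun k a ha b hb => mul_mem_mixedFiltration D hb (mixedFiltration_le D k ha))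
    (mixedFiltration_eq_bot D hn (pow_mul_powAnnihilator t)) hF hg₁ hg₂ hc
    (polyIdeal_mono (fun x hx => mem_mixedFiltration D (m := 0) (r := 0) rfl (show x ∈ P.powAnnihilator t from hx).1 (by
      rw [Submodule.pow_zero, Ideal.one_eq_top, Ideal.top_mul]; exact hx)) ht)
  exact ⟨G₁, G₂, hG₁.monic, hG₂.monic, H⟩

end RingPair

/-! ### Finitely generated rings -/

section FG

variable {R : Type u} [Ring R]

lemma commute_of_closure_eq_top {X : Set R} (hX : Subring.closure X = ⊤) {i : R}
    (h : ∀ x ∈ X, x * i = i * x) (r : R) : r * i = i * r := by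
  have hr : r ∈ Subring.closure X := hX ▸ trivial
  induction hr using Subring.closure_induction with
  | mem x hx => exact h x hx
  | zero => simp
  | one => simp
  | add x y _ _ hx hy => rw [add_mul, mul_add, hx, hy]
  | neg x _ hx => rw [neg_mul, mul_neg, hx]
  | mul x y _ _ hx hy => rw [mul_assoc, hy, ← mul_assoc, hx, mul_assoc]

/-- The map `r ↦ r s - s r` is a derivation, and centrality of `i` lets a factor on the right of a
commutator pass through `i`. -/
lemma commutator_mul_eq_zero_of_generator {X : Set R} (hX : Subring.closure X = ⊤) {i s : R}
    (hi : ∀ r : R, r * i = i * r) (h : ∀ x ∈ X, (x * s - s * x) * i = 0) (r : R) :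
    (r * s - s * r) * i = 0 := by
  have hr : r ∈ Subring.closure X := hX ▸ trivial
  induction hr using Subring.closure_induction with
  | mem x hx => exact h x hx
  | zero => simp
  | one => simp
  | add x y _ _ hx hy =>
    have := congrArg₂ (· + ·) hx hy
    simp only [add_zero] at this
    rw [← this]; noncomm_ring
  | neg x _ hx =>
    have := congrArg (- ·) hx
    simp only [neg_zero] at this
    rw [← this]; noncomm_ring
  | mul x y _ _ hx hy =>
    calc (x * y * s - s * (x * y)) * i
        = x * ((y * s - s * y) * i) + (x * s - s * x) * (y * i) := by noncomm_ring
      _ = 0 := by rw [hy, hi y, ← mul_assoc, hx, mul_zero, zero_mul, add_zero]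

lemma commutator_mul_eq_zero_of_generators {X : Set R} (hX : Subring.closure X = ⊤) {i : R}
    (hi : ∀ x ∈ X, x * i = i * x) (h : ∀ x ∈ X, ∀ y ∈ X, (x * y - y * x) * i = 0) (r s : R) :
    (r * s - s * r) * i = 0 := by
  have hi' := commute_of_closure_eq_top hX hi
  refine commutator_mul_eq_zero_of_generator hX hi' (fun x hx => ?_) r
  have := commutator_mul_eq_zero_of_generator hX hi' (s := x) (fun y hy => h y hy x hx) s
  rw [← neg_eq_zero, ← this]; noncomm_ring

/-- The commutators of `i` with generators, and the products of the commutators of the generators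
with `i`. -/
def commutatorGenerators (X : Set R) (i : R) : Set R :=
  (fun x => x * i - i * x) '' X ∪ (fun p : R × R => (p.1 * p.2 - p.2 * p.1) * i) '' (X ×ˢ X)

lemma finite_commutatorGenerators {X : Set R} (hX : X.Finite) (i : R) :
    (commutatorGenerators X i).Finite := (hX.image _).union ((hX.prod hX).image _)

/-- Modulo `commutatorGenerators X i`, the element `i` is central and all commutators kill it, both
because this holds on generators. Its two-sided ideal is then just the left ideal of its multiples
and consists of central elements. -/
lemma twoSidedSpan_commutatorGenerators {X : Set R} (hX : Subring.closure X = ⊤) (i : R) {d : R}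
    (hd : d ∈ twoSidedSpan {i}) :
    (∃ r, d - r * i ∈ twoSidedSpan (commutatorGenerators X i)) ∧
      ∀ r, r * d - d * r ∈ twoSidedSpan (commutatorGenerators X i) := by
  let D' := twoSidedSpan (commutatorGenerators X i)
  let π := Ideal.Quotient.mk D'
  have hπ : ∀ {x}, π x = 0 ↔ x ∈ D' := Ideal.Quotient.eq_zero_iff_mem
  have hX' : Subring.closure (π '' X) = ⊤ := by
    rw [← RingHom.map_closure, hX]
    rw [← RingHom.range_eq_map]
    exact RingHom.range_eq_top.2 Ideal.Quotient.mk_surjective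
  have h1 : ∀ x ∈ π '' X, x * π i = π i * x := by
    rintro _ ⟨x, hx, rfl⟩
    rw [← sub_eq_zero, ← map_mul, ← map_mul, ← map_sub, hπ]
    exact subset_twoSidedSpan _ (Or.inl ⟨x, hx, rfl⟩)
  have h2 : ∀ x ∈ π '' X, ∀ y ∈ π '' X, (x * y - y * x) * π i = 0 := by
    rintro _ ⟨x, hx, rfl⟩ _ ⟨y, hy, rfl⟩
    rw [← map_mul, ← map_mul, ← map_sub, ← map_mul, hπ]
    exact subset_twoSidedSpan _ (Or.inr ⟨(x, y), ⟨hx, hy⟩, rfl⟩)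
  have hc := commute_of_closure_eq_top hX' h1
  have hz := commutator_mul_eq_zero_of_generators hX' h1 h2
  have key : ∃ r, π d = r * π i := by
    have : (Ideal.span {π i}).IsTwoSided := ⟨fun {a} b ha => by
      obtain ⟨c, rfl⟩ := Ideal.mem_span_singleton'.1 ha
      rw [mul_assoc, ← hc, ← mul_assoc]
      exact Ideal.mem_span_singleton'.2 ⟨_, rfl⟩⟩
    have hle : twoSidedSpan {i} ≤ (Ideal.span {π i}).comap π := by
      rw [twoSidedSpan_le, Set.singleton_subset_iff]
      exact Ideal.subset_span (Set.mem_singleton (π i))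
    obtain ⟨r, hr⟩ := Ideal.mem_span_singleton'.1 (hle hd)
    exact ⟨r, hr.symm⟩
  obtain ⟨r₀, hr₀⟩ := key
  obtain ⟨r₀, rfl⟩ := Ideal.Quotient.mk_surjective r₀
  refine ⟨⟨r₀, ?_⟩, fun r => ?_⟩
  · rw [← hπ, map_sub, map_mul, hr₀, sub_self]
  · rw [← hπ, map_sub, map_mul, map_mul, hr₀, mul_assoc, ← hc, ← mul_assoc, ← mul_assoc, ← sub_mul]
    exact hz _ _

/-- `c D ⊆ D'` for `c` in the commutator ideal, if `D'` contains all commutators with elements of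
`D`. -/
lemma commutatorIdeal_mul_le {D D' : Ideal R} [D.IsTwoSided]
    (h : ∀ d ∈ D, ∀ r, r * d - d * r ∈ D') : commutatorIdeal R * D ≤ D' := by
  have : commutatorIdeal R ≤ D'.colon (D : Set R) := by
    rw [commutatorIdeal, twoSidedSpan_le]
    rintro _ ⟨a, b, rfl⟩
    refine Submodule.mem_colon.2 fun d hd => ?_
    have := sub_mem (h _ (D.mul_mem_left b hd) a) (D'.mul_mem_left b (h d hd a))
    convert! this using 1
    rw [smul_eq_mul]
    noncomm_ring
  rw [Ideal.mul_le]
  exact fun c hc d hd => Submodule.mem_colon.1 (this hc) d hd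

/-- This is Hilbert's basis theorem over `ℤ`. -/
lemma isNoetherianRing_commQuotient {X : Set R} (hXf : X.Finite) (hX : Subring.closure X = ⊤) :
    IsNoetherianRing (CommQuotient R) := by
  let π := Ideal.Quotient.mk (commutatorIdeal R)
  have h1 : Algebra.adjoin ℤ (π '' X) = ⊤ := by
    rw [eq_top_iff]
    intro x _
    obtain ⟨x, rfl⟩ := Ideal.Quotient.mk_surjective x
    have : Subring.closure X ≤ (Algebra.adjoin ℤ (π '' X)).toSubring.comap π :=
      Subring.closure_le.2 fun y hy => Algebra.subset_adjoin (Set.mem_image_of_mem π hy)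
    exact this (hX ▸ trivial)
  have : Algebra.FiniteType ℤ (CommQuotient R) :=
    ⟨⟨(hXf.image π).toFinset, by simpa using h1⟩⟩
  exact Algebra.FiniteType.isNoetherianRing ℤ _

lemma isNoetherian_commQuotient (h : IsNoetherianRing (CommQuotient R)) :
    IsNoetherian R (CommQuotient R) := by
  let f : CommQuotient R →ₛₗ[Ideal.Quotient.mk (commutatorIdeal R)] CommQuotient R :=
    { toFun := id
      map_add' := fun _ _ => rfl
      map_smul' := fun r x => by
        obtain ⟨x, rfl⟩ := Ideal.Quotient.mk_surjective x
        rfl }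
  have : RingHomSurjective (Ideal.Quotient.mk (commutatorIdeal R)) :=
    ⟨Ideal.Quotient.mk_surjective⟩
  exact (LinearMap.isNoetherian_iff_of_bijective f Function.bijective_id).2 h

lemma isNoetherian_twoSidedSpan {S : Set R} (hS : S.Finite)
    (h : ∀ x ∈ S, IsNoetherian R (twoSidedSpan {x})) : IsNoetherian R (twoSidedSpan S) := by
  have hle : twoSidedSpan S ≤ ⨆ x : S, twoSidedSpan {(x : R)} := by
    have := Ideal.isTwoSided_iSup fun x : S => twoSidedSpan {(x : R)}
    rw [twoSidedSpan_le]
    exact fun x hx => Submodule.mem_iSup_of_mem (⟨x, hx⟩ : S) (subset_twoSidedSpan _ rfl)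
  have : Finite S := hS
  have (x : S) : IsNoetherian R (twoSidedSpan {(x : R)}) := h x x.2
  exact isNoetherian_of_le hle

/-- Dévissage for principal two-sided ideals of a finitely generated ring. -/
lemma isNoetherian_twoSidedSpan_singleton {X : Set R} (hXf : X.Finite)
    (hX : Subring.closure X = ⊤) (i : R)
    (h : ∀ y ∈ commutatorGenerators X i, IsNoetherian R (twoSidedSpan {y})) :
    IsNoetherian R (twoSidedSpan {i}) := by
  let D := twoSidedSpan {i}
  let D' := twoSidedSpan (commutatorGenerators X i)
  have hD' : IsNoetherian R D' := isNoetherian_twoSidedSpan (finite_commutatorGenerators hXf i) h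
  have hcD : commutatorIdeal R * D ≤ D' :=
    commutatorIdeal_mul_le fun d hd => (twoSidedSpan_commutatorGenerators hX i hd).2
  let f : R →ₗ[R] R ⧸ D' := LinearMap.toSpanSingleton R _ (Submodule.Quotient.mk i)
  have hf : ∀ r, f r = Submodule.Quotient.mk (r * i) := fun r => rfl
  -- The map `r ↦ r i` modulo `D'` kills commutators, and its image contains that of `D`. So `D` is
  -- an extension of a noetherian module over the commutative quotient by a submodule of `D'`.
  let f' : CommQuotient R →ₗ[R] R ⧸ D' := Submodule.liftQ (commutatorIdeal R) f fun c hc => by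
    rw [LinearMap.mem_ker, hf, Submodule.Quotient.mk_eq_zero]
    exact hcD (Ideal.mul_mem_mul hc (subset_twoSidedSpan _ rfl))
  have := isNoetherian_commQuotient (isNoetherianRing_commQuotient hXf hX)
  have h1 : IsNoetherian R (LinearMap.range f') := isNoetherian_range f'
  let g : D →ₗ[R] R ⧸ D' := D'.mkQ.comp D.subtype
  have hg : LinearMap.range g ≤ LinearMap.range f' := by
    rintro _ ⟨⟨d, hd⟩, rfl⟩
    obtain ⟨r, hr⟩ := (twoSidedSpan_commutatorGenerators hX i hd).1
    refine ⟨Submodule.Quotient.mk r, ?_⟩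
    exact ((Submodule.Quotient.eq D').2 hr).symm
  have h2 : IsNoetherian R (LinearMap.range g) := isNoetherian_of_le hg
  let k : LinearMap.ker g →ₗ[R] D' := LinearMap.codRestrict D'
    (D.subtype.comp (LinearMap.ker g).subtype) fun x =>
      (Submodule.Quotient.mk_eq_zero D').1 (LinearMap.mem_ker.1 x.2)
  have h3 : IsNoetherian R (LinearMap.ker g) := isNoetherian_of_injective k fun x y hxy =>
    Subtype.ext (Subtype.ext (show ((k x : D') : R) = (k y : D') by rw [hxy]))
  exact isNoetherian_of_range_eq_ker (LinearMap.ker g).subtype g.rangeRestrict (by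
    rw [Submodule.range_subtype, LinearMap.ker_rangeRestrict])

/-- This translates powers of the noncommutative ideal `I` into powers of its image acting on `N`,
to which the commutative Krull theorem applies. -/
lemma Ideal.mem_pow_smul_top {C : Type u} [CommRing C] {π : R →+* C} {N I : Ideal R}
    [N.IsTwoSided] [I.IsTwoSided] [Module C N] (hsmul : ∀ (r : R) (x : N), π r • x = r • x) (r : ℕ) :
    ∀ x ∈ I ^ r * N, ∃ hx : x ∈ N, (⟨x, hx⟩ : N) ∈ (I.map π) ^ r • (⊤ : Submodule C N) := by
  induction r with
  | zero =>
    intro x hx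
    refine ⟨Ideal.mul_le_right hx, ?_⟩
    rw [Submodule.pow_zero, Ideal.one_eq_top, Submodule.top_smul]
    trivial
  | succ r ih =>
    intro x hx
    rw [Ideal.IsTwoSided.pow_succ, Ideal.mul_assoc] at hx
    refine Submodule.smul_induction_on hx (fun i hi n hn => ?_) fun x y hx hy => ?_
    · obtain ⟨h1, h2⟩ := ih n hn
      refine ⟨Ideal.mul_mem_left _ _ h1, ?_⟩
      rw [pow_succ', Submodule.mul_smul]
      have h3 := Submodule.smul_mem_smul (Ideal.mem_map_of_mem π hi) h2
      rwa [hsmul] at h3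
    · obtain ⟨hx1, hx2⟩ := hx
      obtain ⟨hy1, hy2⟩ := hy
      exact ⟨add_mem hx1 hy1, add_mem hx2 hy2⟩

/-- Krull's intersection theorem for a left ideal with an action of a commutative quotient. -/
lemma Ideal.exists_mul_eq_self {C : Type u} [CommRing C] [IsNoetherianRing C] {π : R →+* C}
    (hπ : Function.Surjective π) {N I : Ideal R} [N.IsTwoSided] [I.IsTwoSided] [IsNoetherian R N]
    [Module C N] (hsmul : ∀ (r : R) (x : N), π r • x = r • x) {a : R}
    (ha : ∀ r, a ∈ I ^ r * N) : ∃ i ∈ I, i * a = a := by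
  have : RingHomSurjective π := ⟨hπ⟩
  let f : N →ₛₗ[π] N :=
    { toFun := id
      map_add' := fun _ _ => rfl
      map_smul' := fun r x => (hsmul r x).symm }
  have hnoeth : IsNoetherian C N :=
    (LinearMap.isNoetherian_iff_of_bijective f Function.bijective_id).1 inferInstance
  obtain ⟨haN, -⟩ := mem_pow_smul_top hsmul 0 a (ha 0)
  obtain ⟨⟨ρ, hρ⟩, h⟩ := ((I.map π).mem_iInf_smul_pow_eq_bot_iff (⟨a, haN⟩ : N)).1 (by
    rw [Submodule.mem_iInf]
    exact fun r => (mem_pow_smul_top hsmul r a (ha r)).2)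
  obtain ⟨i, hi, rfl⟩ := (Ideal.mem_map_iff_of_surjective π hπ).1 hρ
  refine ⟨i, hi, ?_⟩
  have h' : π i • (⟨a, haN⟩ : N) = ⟨a, haN⟩ := h
  rw [hsmul] at h'
  exact congrArg Subtype.val h'

/-- Krull's intersection theorem for an ideal of central elements. -/
lemma Ideal.IsCentral.exists_mul_eq_self {N I : Ideal R} [N.IsTwoSided] [I.IsTwoSided]
    (hN : N.IsCentral) [IsNoetherian R N] (hR : IsNoetherianRing (CommQuotient R)) {a : R}
    (ha : ∀ r, a ∈ I ^ r * N) : ∃ i ∈ I, i * a = a := by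
  have hNz : commutatorIdeal R * N ≤ ⊥ := commutatorIdeal_mul_le fun d hd r => by
    rw [hN d hd r, sub_self]; exact zero_mem _
  have htor : Module.IsTorsionBySet R N (commutatorIdeal R : Set R) := by
    intro x c
    exact Subtype.ext (hNz (Ideal.mul_mem_mul c.2 x.2))
  let _ : Module (CommQuotient R) N := htor.module
  exact Ideal.exists_mul_eq_self (π := Ideal.Quotient.mk (commutatorIdeal R))
    Ideal.Quotient.mk_surjective (fun r x => rfl) ha

end FG

/-! ### Residual local nilpotence of finitely generated pairs -/

namespace RingPair

variable {P : RingPair.{u}} {n : ℕ}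

lemma commFiltration_le_commutatorIdeal (m : ℕ) :
    P.commFiltration (m + 1) ≤ commutatorIdeal P := by
  rw [commFiltration_succ, twoSidedSpan_le]
  rintro _ ⟨a, i, -, rfl⟩
  exact commutator_mem_commutatorIdeal a i

/-- Write `c j = j c - (j c - c j)`: a factor from `I` moves to the left at the cost of the next
term of the filtration. -/
lemma commFiltration_mul_ideal_le (m : ℕ) : P.commFiltration m * P.ideal ≤
    P.ideal * P.commFiltration m ⊔ P.commFiltration (m + 1) := by
  rw [Ideal.mul_le]
  intro c hc j hj
  have h := neg_mem (commutator_mem m j hc)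
  rw [show c * j = j * c + -(j * c - c * j) by abel]
  exact Submodule.add_mem_sup (Ideal.mul_mem_mul hj hc) h

section Centralize

variable {D D' : Ideal P} [D.IsTwoSided] {t : ℕ}

/-- Descending induction along the terminating filtration. Factors from `I` are moved left past one
term, the errors vanish because the next term already kills `I ^ q D`, and what remains is `I ^ t D'
= 0`. -/
lemma exists_commFiltration_mul_pow_mul_eq_bot (hn : P.commFiltration n = ⊥)
    (h : ∀ d ∈ D, ∀ r, r * d - d * r ∈ D') (ht : P.ideal ^ t * D' = ⊥) (m : ℕ) :
    ∃ q, P.commFiltration (m + 1) * (P.ideal ^ q * D) = ⊥ := by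
  suffices ∀ j m, n ≤ m + 1 + j → ∃ q, P.commFiltration (m + 1) * (P.ideal ^ q * D) = ⊥ from
    this n m (by omega)
  intro j
  induction j with
  | zero =>
    intro m hm
    refine ⟨0, ?_⟩
    rw [eq_bot_iff.2 ((commFiltration_antitone hm).trans hn.le), Ideal.bot_mul]
  | succ j ih =>
    intro m hm
    obtain ⟨q, hq⟩ := ih (m + 1) (by omega)
    have key : ∀ r, P.commFiltration (m + 1) * (P.ideal ^ (r + q) * D) ≤ P.ideal ^ r * D' := by
      intro r
      induction r with
      | zero =>
        rw [Submodule.pow_zero, Ideal.one_eq_top, Ideal.top_mul]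
        exact (Ideal.mul_mono (commFiltration_le_commutatorIdeal m) Ideal.mul_le_right).trans
          (commutatorIdeal_mul_le h)
      | succ r ihr =>
        rw [show r + 1 + q = (r + q) + 1 by omega, Ideal.IsTwoSided.pow_succ, Ideal.mul_assoc,
          ← Ideal.mul_assoc]
        refine (Ideal.mul_mono_left (commFiltration_mul_ideal_le (m + 1))).trans ?_
        rw [Ideal.sup_mul, Ideal.mul_assoc, Ideal.IsTwoSided.pow_succ, Ideal.mul_assoc]
        refine sup_le (Ideal.mul_mono_right ihr) ?_
        refine le_trans (Ideal.mul_mono_right (Ideal.mul_mono_left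
          (Ideal.pow_le_pow_right (Nat.le_add_left q r)))) (hq.le.trans bot_le)
    exact ⟨t + q, eq_bot_iff.2 ((key t).trans ht.le)⟩

/-- In `[a, j y] = [a, j] y + j [a, y]` the first summand vanishes once `y` lies in a high enough `I
^ q D`. Each factor `j` can thus be pulled out of the commutator, until `I ^ t D' = 0` is reached.
-/
lemma exists_isCentral_pow_mul (hn : P.commFiltration n = ⊥)
    (h : ∀ d ∈ D, ∀ r, r * d - d * r ∈ D') (ht : P.ideal ^ t * D' = ⊥) :
    ∃ q, (P.ideal ^ q * D).IsCentral := by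
  obtain ⟨q, hq⟩ := exists_commFiltration_mul_pow_mul_eq_bot hn h ht 0
  have key : ∀ r, ∀ y ∈ P.ideal ^ (r + q) * D, ∀ a, a * y - y * a ∈ P.ideal ^ r * D' := by
    intro r
    induction r with
    | zero =>
      intro y hy a
      rw [Submodule.pow_zero, Ideal.one_eq_top, Ideal.top_mul]
      exact h _ (Ideal.mul_le_right hy) a
    | succ r ihr =>
      intro y hy a
      rw [show r + 1 + q = (r + q) + 1 by omega, Ideal.IsTwoSided.pow_succ, Ideal.mul_assoc] at hy
      refine Submodule.smul_induction_on hy (fun j hj y hy => ?_) fun x y hx hy => ?_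
      · have h0 : (a * j - j * a) * y = 0 := by
          rw [← Ideal.mem_bot, ← hq]
          refine Ideal.mul_mem_mul (commutator_mem 0 a hj) ?_
          exact Ideal.mul_mono_left (Ideal.pow_le_pow_right (Nat.le_add_left q r)) hy
        have h1 : a * (j • y) - j • y * a = (a * j - j * a) * y + j * (a * y - y * a) := by
          rw [smul_eq_mul]; noncomm_ring
        rw [h1, h0, zero_add, Ideal.IsTwoSided.pow_succ, Ideal.mul_assoc]
        exact Ideal.mul_mem_mul hj (ihr y hy a)
      · have := add_mem hx hy
        rwa [show a * x - x * a + (a * y - y * a) = a * (x + y) - (x + y) * a by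
          noncomm_ring] at this
  refine ⟨t + q, fun y hy a => ?_⟩
  have := key t y hy a
  rw [ht] at this
  exact sub_eq_zero.1 this

end Centralize

/-! ### The set `1 + I` and Krull's intersection theorem -/

/-- `1 + i` for `i` in the ideal. -/
def IsOneUnit (s : P) : Prop := s - 1 ∈ P.ideal

lemma isOneUnit_iff {s : P} : IsOneUnit s ↔ P.residue s = 1 := by
  rw [IsOneUnit, ← residue_eq_zero_iff, map_sub, map_one, sub_eq_zero]

lemma IsOneUnit.mul {s t : P} (hs : IsOneUnit s) (ht : IsOneUnit t) : IsOneUnit (s * t) := by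
  rw [isOneUnit_iff] at *
  rw [map_mul, hs, ht, one_mul]

lemma IsOneUnit.pow {s : P} (hs : IsOneUnit s) (n : ℕ) : IsOneUnit (s ^ n) := by
  rw [isOneUnit_iff] at *
  rw [map_pow, hs, one_pow]

/-- The Ore condition for `1 + I`, if the commutator filtration terminates. -/
lemma pow_mul_mul_mem (hn : P.commFiltration n = ⊥) {X : Ideal P} {s t a : P}
    (ht : IsOneUnit t) (h : s * a ∈ X) : s ^ (n + 1) * (t * a) ∈ X := by
  -- Modulo `X`, moving one more `s` past the coefficient replaces `c` by its commutator with `s`,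
  -- because `s a` lies in `X`. So `c` descends the filtration to `0`.
  have key : ∀ m, ∃ c ∈ P.commFiltration (m + 1), s ^ (m + 1) * (t * a) - c * a ∈ X := by
    intro m
    induction m with
    | zero =>
      refine ⟨s * (t - 1) - (t - 1) * s, commutator_mem 0 s ht, ?_⟩
      rw [show s ^ (0 + 1) * (t * a) - (s * (t - 1) - (t - 1) * s) * a = t * (s * a) by
        rw [zero_add, pow_one]; noncomm_ring]
      exact X.mul_mem_left _ h
    | succ m ih =>
      obtain ⟨c, hc, hX⟩ := ih
      refine ⟨s * c - c * s, commutator_mem _ s hc, ?_⟩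
      have := add_mem (X.mul_mem_left s hX) (X.mul_mem_left c h)
      rwa [show s * (s ^ (m + 1) * (t * a) - c * a) + c * (s * a) =
        s ^ (m + 1 + 1) * (t * a) - (s * c - c * s) * a by
          rw [pow_succ' s (m + 1)]; noncomm_ring] at this
  obtain ⟨c, hc, hX⟩ := key n
  have : c = 0 := by
    have := commFiltration_succ_le n hc
    rwa [hn] at this
  rwa [this, zero_mul, sub_zero] at hX

/-- In `a = s a - (s - 1) a` the factor `s - 1` lies in `I`, so membership of `a` climbs one power
of `I` at a time. -/
lemma mem_pow_mul_of_mul_mem {N : Ideal P} [N.IsTwoSided] {s a : P} (hs : IsOneUnit s)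
    (ha : a ∈ N) {r : ℕ} (h : s * a ∈ P.ideal ^ r * N) : a ∈ P.ideal ^ r * N := by
  have key : ∀ k ≤ r, a ∈ P.ideal ^ k * N := by
    intro k
    induction k with
    | zero =>
      intro _
      rwa [Submodule.pow_zero, Ideal.one_eq_top, Ideal.top_mul]
    | succ k ih =>
      intro hk
      rw [show a = s * a - (s - 1) * a by noncomm_ring]
      refine sub_mem (Ideal.mul_mono_left (Ideal.pow_le_pow_right hk) h) ?_
      rw [Ideal.IsTwoSided.pow_succ, Ideal.mul_assoc]
      exact Ideal.mul_mem_mul hs (ih (by omega))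
  exact key r le_rfl

/-- If every nonzero ideal inside `I` meets `(1 + I) a`, then an ideal of central elements
that is a noetherian module is killed by a power of `I`. -/
lemma exists_pow_mul_eq_bot_of_isCentral {a : P} (hn : P.commFiltration n = ⊥)
    (h1 : ∀ s : P, IsOneUnit s → s * a ≠ 0)
    (h2 : ∀ X : Ideal P, X.IsTwoSided → X ≤ P.ideal → X ≠ ⊥ → ∃ s, IsOneUnit s ∧ s * a ∈ X)
    {N : Ideal P} [N.IsTwoSided] (hNI : N ≤ P.ideal) (hN : N.IsCentral) [IsNoetherian P N]
    (hR : IsNoetherianRing (CommQuotient P)) : ∃ r, P.ideal ^ r * N = ⊥ := by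
  by_contra! hne
  have h : ∀ r, ∃ s, IsOneUnit s ∧ s * a ∈ P.ideal ^ r * N := fun r =>
    h2 _ inferInstance (Ideal.mul_le_right.trans hNI) (hne r)
  obtain ⟨t, ht, hta⟩ := h 0
  have hta' : t * a ∈ N := Ideal.mul_le_right hta
  -- The Ore condition puts the single element `t a` into every `I ^ r N`. Krull's theorem then
  -- gives `(1 - j) t a = 0` with `j ∈ I`, contradicting `h1`.
  obtain ⟨j, hj, hja⟩ := hN.exists_mul_eq_self (I := P.ideal) hR (a := t * a) fun r => by
    obtain ⟨s, hs, hsa⟩ := h r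
    exact mem_pow_mul_of_mul_mem (hs.pow (n + 1)) hta' (pow_mul_mul_mem hn ht hsa)
  refine h1 ((1 - j) * t) (IsOneUnit.mul ?_ ht) ?_
  · rw [IsOneUnit]
    simpa using hj
  · rw [mul_assoc, sub_mul, hja, one_mul, sub_self]

/-- A finitely generated pair with terminating commutator filtration in which every nonzero ideal
inside `I` meets `(1 + I) a ∌ 0` is locally nilpotent. -/
theorem isLocallyNilpotent_of_essential {a : P} (hn : P.commFiltration n = ⊥)
    (h1 : ∀ s : P, IsOneUnit s → s * a ≠ 0)
    (h2 : ∀ X : Ideal P, X.IsTwoSided → X ≤ P.ideal → X ≠ ⊥ → ∃ s, IsOneUnit s ∧ s * a ∈ X)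
    {X : Set P} (hXf : X.Finite) (hX : Subring.closure X = ⊤) : P.IsLocallyNilpotent := by
  have hgen : ∀ k, ∀ i ∈ P.commFiltration k, ∀ y ∈ commutatorGenerators X i,
      y ∈ P.commFiltration (k + 1) := by
    rintro k i hi y (⟨x, -, rfl⟩ | ⟨⟨x, z⟩, -, rfl⟩)
    · exact commutator_mem k x hi
    -- Here `[x, z] i = [x, z i] - z [x, i]`.
    · have := sub_mem (commutator_mem k x (Ideal.mul_mem_left _ z hi))
        (Ideal.mul_mem_left _ z (commutator_mem k x hi))
      rwa [show x * (z * i) - z * i * x - z * (x * i - i * x) = (x * z - z * x) * i by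
        noncomm_ring] at this
  have hN : ∀ j k, n ≤ k + j → ∀ i ∈ P.commFiltration k, IsNoetherian P (twoSidedSpan {i}) := by
    intro j
    induction j with
    | zero =>
      intro k hk i hi
      have hi0 : i = 0 := by
        have := commFiltration_antitone (show n ≤ k from hk) hi
        rwa [hn] at this
      have : twoSidedSpan {i} = ⊥ := eq_bot_iff.2 (twoSidedSpan_le.2 (by simp [hi0]))
      rw [this]
      infer_instance
    | succ j ih =>
      exact fun k hk i hi => isNoetherian_twoSidedSpan_singleton hXf hX i fun y hy =>
        ih (k + 1) (by omega) y (hgen k i hi y hy)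
  have hK : ∀ j k, n ≤ k + j → ∀ i ∈ P.commFiltration k, i ∈ ⨆ t, P.powAnnihilator t := by
    intro j
    induction j with
    | zero =>
      intro k hk i hi
      have hi0 : i = 0 := by
        have := commFiltration_antitone (show n ≤ k from hk) hi
        rwa [hn] at this
      rw [hi0]
      exact zero_mem _
    | succ j ih =>
      intro k hk i hi
      let D := twoSidedSpan {i}
      let D' := twoSidedSpan (commutatorGenerators X i)
      -- By induction each of the finitely many generators of `D'` is killed by a power of `I`; the
      -- largest exponent serves for all of `D'`.
      obtain ⟨t, ht⟩ : ∃ t, D' ≤ P.powAnnihilator t := by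
        have hf := finite_commutatorGenerators hXf i
        have : ∀ y ∈ commutatorGenerators X i, ∃ t, y ∈ P.powAnnihilator t := fun y hy =>
          (Submodule.mem_iSup_of_directed _ powAnnihilator_mono.directed_le).1
            (ih (k + 1) (by omega) y (hgen k i hi y hy))
        choose! t ht using this
        obtain ⟨T, hT⟩ := (hf.image t).bddAbove
        exact ⟨T, twoSidedSpan_le.2 fun y hy =>
          powAnnihilator_mono (hT (Set.mem_image_of_mem t hy)) (ht y hy)⟩
      have hDI : D ≤ P.ideal :=
        twoSidedSpan_le.2 (Set.singleton_subset_iff.2 (commFiltration_le_ideal k hi))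
      have ht' : P.ideal ^ t * D' = ⊥ :=
        eq_bot_iff.2 ((Ideal.mul_mono_right ht).trans (pow_mul_powAnnihilator t).le)
      obtain ⟨q, hq⟩ := exists_isCentral_pow_mul hn (D := D)
        (fun d hd => (twoSidedSpan_commutatorGenerators hX i hd).2) ht'
      have : IsNoetherian P D := hN (j + 1) k hk i hi
      have : IsNoetherian P ↥(P.ideal ^ q * D) := isNoetherian_of_le Ideal.mul_le_right
      -- With `D'` killed by a power of `I`, the ideal `I ^ q D` is central and noetherian, so
      -- Krull's argument kills it by some `I ^ r`; hence `I ^ (r + q)` kills `i`.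
      obtain ⟨r, hr⟩ := exists_pow_mul_eq_bot_of_isCentral hn h1 h2
        (Ideal.mul_le_right.trans hDI) hq (isNoetherianRing_commQuotient hXf hX)
      refine Submodule.mem_iSup_of_mem (r + q) ⟨commFiltration_le_ideal k hi, fun y hy => ?_⟩
      rw [← Ideal.mem_bot, ← hr, ← Ideal.mul_assoc, ← Ideal.IsTwoSided.pow_add]
      exact Ideal.mul_mem_mul hy (subset_twoSidedSpan _ rfl)
  intro i hi
  obtain ⟨t, ht⟩ := (Submodule.mem_iSup_of_directed _ powAnnihilator_mono.directed_le).1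
    (hK n 0 (by omega) i hi)
  exact ⟨t, ht.2⟩

/-- An element not killed by any element of `1 + I` survives in a locally nilpotent quotient, if
the ring is finitely generated and the commutator filtration terminates. -/
theorem exists_quotient_isLocallyNilpotent {a : P} (hn : P.commFiltration n = ⊥)
    (h1 : ∀ s : P, IsOneUnit s → s * a ≠ 0) {X : Set P} (hXf : X.Finite)
    (hX : Subring.closure X = ⊤) : ∃ (Q : RingPair.{u}) (f : P ⟶ Q),
      Q.IsLocallyNilpotent ∧ Q.commFiltration n = ⊥ ∧ ringHom f a ≠ 0 := by
  let S : Set (Ideal P) :=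
    {M | M.IsTwoSided ∧ M ≤ P.ideal ∧ ∀ s : P, IsOneUnit s → s * a ∉ M}
  obtain ⟨M, hM⟩ : ∃ M, Maximal (· ∈ S) M := by
    refine zorn_le₀ S fun c hc hchain => ?_
    rcases c.eq_empty_or_nonempty with rfl | hne
    · exact ⟨⊥, ⟨inferInstance, bot_le, fun s hs h => h1 s hs (Ideal.mem_bot.1 h)⟩, by simp⟩
    · refine ⟨sSup c, ⟨?_, sSup_le fun M hM => (hc hM).2.1, fun s hs h => ?_⟩,
        fun M hM => le_sSup hM⟩
      · have (M : c) : (M : Ideal P).IsTwoSided := (hc M.2).1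
        rw [sSup_eq_iSup']
        exact Ideal.isTwoSided_iSup _
      · obtain ⟨M, hM, h⟩ := (Submodule.mem_sSup_of_directed hne hchain.directedOn).1 h
        exact (hc hM).2.2 s hs h
  obtain ⟨hM2, hMI, hMa⟩ := hM.prop
  let f := toQuotient M hMI
  have hf : Function.Surjective (ringHom f) := toQuotient_surjective M hMI
  have hf0 : ∀ {x}, ringHom f x = 0 ↔ x ∈ M := toQuotient_eq_zero_iff M hMI
  have hfs : ∀ {s : P}, IsOneUnit (ringHom f s) ↔ IsOneUnit s := by
    intro s
    rw [IsOneUnit, ← map_one (ringHom f), ← map_sub, ringHom_mem_iff, IsOneUnit]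
  have hn' : (P.quotient M).commFiltration n = ⊥ := by
    rw [eq_bot_iff]
    intro b hb
    obtain ⟨c, hc, rfl⟩ := exists_mem_commFiltration_of_surjective f hf n hb
    rw [hn] at hc
    rw [(Submodule.mem_bot _).1 hc, map_zero]
    exact zero_mem _
  refine ⟨P.quotient M, f, isLocallyNilpotent_of_essential (a := ringHom f a)
    (X := ringHom f '' X) hn' ?_ ?_ (hXf.image _) ?_, hn', ?_⟩
  · intro s hs
    obtain ⟨s, rfl⟩ := hf s
    rw [← map_mul, Ne, hf0]
    exact hMa s (hfs.1 hs)
  · intro Y hY hYI hY0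
    by_contra! hcon
    -- A nonzero ideal of the quotient missing the image of `(1 + I) a` would pull back to a larger
    -- member of `S`.
    have hmem : Y.comap (ringHom f) ∈ S := by
      refine ⟨inferInstance, ?_, fun s hs h => hcon _ (hfs.2 hs) (by simpa using h)⟩
      exact fun y hy => (ringHom_mem_iff f).1 (hYI hy)
    have hle : M ≤ Y.comap (ringHom f) := fun y hy => by
      rw [Ideal.mem_comap, hf0.2 hy]; exact zero_mem _
    refine hY0 (eq_bot_iff.2 fun y hy => ?_)
    obtain ⟨y, rfl⟩ := hf y
    exact hf0.2 (hM.2 hmem hle hy)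
  · rw [← RingHom.map_closure, hX, ← RingHom.range_eq_map]
    exact RingHom.range_eq_top.2 hf
  · rw [Ne, hf0]
    have := hMa 1 (by simp [IsOneUnit])
    rwa [one_mul] at this

end RingPair

/-! ### Reduced products of pairs -/

namespace RingPair

open Filter

section ReducedProduct

variable {ι : Type u} (l : Filter ι) (Q : ι → RingPair.{u})

/-- The families that lie eventually in given ideals. -/
def eventuallyIdeal (E : ∀ i, Ideal (Q i)) : Ideal (∀ i, Q i) where
  carrier := {f | ∀ᶠ i in l, f i ∈ E i}
  zero_mem' := Eventually.of_forall fun i => zero_mem (E i)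
  add_mem' hf hg := by
    filter_upwards [hf, hg] with i hi hi'
    exact add_mem hi hi'
  smul_mem' r f hf := by
    filter_upwards [hf] with i hi
    exact Ideal.mul_mem_left _ (r i) hi

instance isTwoSided_eventuallyIdeal (E : ∀ i, Ideal (Q i)) [∀ i, (E i).IsTwoSided] :
    (eventuallyIdeal l Q E).IsTwoSided where
  mul_mem_of_left {f} r hf := by
    have hf : ∀ᶠ i in l, f i ∈ E i := hf
    filter_upwards [hf] with i hi
    exact Ideal.mul_mem_right (r i) _ hi

/-- The product of the rings, with the families that lie eventually in the ideals. -/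
def prod : RingPair.{u} where
  carrier := ∀ i, Q i
  ideal := eventuallyIdeal l Q fun i => (Q i).ideal

/-- The families that are eventually `0`. -/
def eventuallyZero : Ideal (prod l Q) := eventuallyIdeal l Q fun _ => ⊥

instance : (eventuallyZero l Q).IsTwoSided :=
  inferInstanceAs (eventuallyIdeal l Q fun _ => ⊥).IsTwoSided

lemma eventuallyZero_le : eventuallyZero l Q ≤ (prod l Q).ideal := by
  intro f hf
  have hf : ∀ᶠ i in l, f i ∈ (⊥ : Ideal (Q i)) := hf
  change ∀ᶠ i in l, f i ∈ (Q i).ideal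
  filter_upwards [hf] with i hi
  rw [(Submodule.mem_bot _).1 hi]
  exact zero_mem _

/-- The reduced product of pairs with respect to a filter. -/
def reducedProduct : RingPair.{u} := (prod l Q).quotient (eventuallyZero l Q)

/-- The quotient morphism to the reduced product. -/
def toReducedProduct : prod l Q ⟶ reducedProduct l Q :=
  toQuotient (eventuallyZero l Q) (eventuallyZero_le l Q)

lemma toReducedProduct_surjective : Function.Surjective (ringHom (toReducedProduct l Q)) :=
  toQuotient_surjective _ _

variable {l Q}

lemma mem_prod_ideal {f : prod l Q} : f ∈ (prod l Q).ideal ↔ ∀ᶠ i in l, f i ∈ (Q i).ideal := Iff.rfl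

lemma toReducedProduct_eq_zero_iff {f : prod l Q} :
    ringHom (toReducedProduct l Q) f = 0 ↔ ∀ᶠ i in l, f i = 0 :=
  toQuotient_eq_zero_iff _ _

lemma toReducedProduct_eq_iff {f g : prod l Q} :
    ringHom (toReducedProduct l Q) f = ringHom (toReducedProduct l Q) g ↔ ∀ᶠ i in l, f i = g i := by
  rw [← sub_eq_zero, ← map_sub, toReducedProduct_eq_zero_iff]
  exact eventually_congr (Eventually.of_forall fun i => sub_eq_zero)

lemma isJacobson_reducedProduct (h : ∀ i, (Q i).IsJacobson) : (reducedProduct l Q).IsJacobson := by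
  refine le_jacobson_of_forall_isUnit fun x hx => ?_
  obtain ⟨f, rfl⟩ := toReducedProduct_surjective l Q x
  have hf : ∀ᶠ i in l, f i ∈ (Q i).ideal := (ringHom_mem_iff _).1 hx
  let g : prod l Q := fun i => Ring.inverse (1 + f i)
  have hu : ∀ᶠ i in l, IsUnit (1 + f i) := by
    filter_upwards [hf] with i hi
    exact isUnit_of_sub_one_mem_jacobson (h i) (by simpa using hi)
  rw [← map_one (ringHom (toReducedProduct l Q)), ← map_add]
  refine isUnit_iff_exists.2 ⟨ringHom (toReducedProduct l Q) g, ?_, ?_⟩ <;>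
    rw [← map_mul, ← map_one (ringHom (toReducedProduct l Q)), toReducedProduct_eq_iff] <;>
    filter_upwards [hu] with i hi
  · exact Ring.mul_inverse_cancel _ hi
  · exact Ring.inverse_mul_cancel _ hi

/-- Commutators are computed componentwise, so the filtration of the product lies in the families
eventually in the filtrations of the factors. A common `n` makes these eventually zero. -/
lemma commFiltration_reducedProduct {n : ℕ} (h : ∀ i, (Q i).commFiltration n = ⊥) :
    (reducedProduct l Q).commFiltration n = ⊥ := by
  have key : ∀ m, (prod l Q).commFiltration m ≤
      eventuallyIdeal l Q fun i => (Q i).commFiltration m := by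
    intro m
    induction m with
    | zero => exact le_rfl
    | succ m ih =>
      have : (eventuallyIdeal l Q fun i => (Q i).commFiltration (m + 1)).IsTwoSided :=
        isTwoSided_eventuallyIdeal l Q _
      refine (@twoSidedSpan_le (prod l Q) _ _ _ this).2 ?_
      rintro _ ⟨a, f, hf, rfl⟩
      have hf : ∀ᶠ i in l, f i ∈ (Q i).commFiltration m := ih hf
      change ∀ᶠ i in l, a i * f i - f i * a i ∈ (Q i).commFiltration (m + 1)
      filter_upwards [hf] with i hi
      exact commutator_mem m (a i) hi
  rw [eq_bot_iff]
  intro x hx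
  obtain ⟨f, hf, rfl⟩ := exists_mem_commFiltration_of_surjective _
    (toReducedProduct_surjective l Q) n hx
  rw [Submodule.mem_bot, toReducedProduct_eq_zero_iff]
  have hf : ∀ᶠ i in l, f i ∈ (Q i).commFiltration n := key n hf
  filter_upwards [hf] with i hi
  rwa [h i] at hi

variable (l Q) in
/-- The projections of the product. -/
def eval (i : ι) : prod l Q →+* Q i := Pi.evalRingHom (fun i => (Q i).carrier) i

/-- Finite support turns a statement that holds eventually for each coefficient into one that holds
eventually for all of them. -/
lemma eventually_map_eval_mem {E : ∀ i, Ideal (Q i)} [∀ i, (E i).IsTwoSided] {p : (prod l Q)[X]}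
    (h : ∀ k, ∀ᶠ i in l, p.coeff k i ∈ E i) : ∀ᶠ i in l, p.map (eval l Q i) ∈ polyIdeal (E i) := by
  have : ∀ᶠ i in l, ∀ k ∈ p.support, p.coeff k i ∈ E i :=
    (Finset.eventually_all p.support).2 fun k _ => h k
  filter_upwards [this] with i hi
  refine mem_polyIdeal.2 fun k => ?_
  rw [coeff_map]
  by_cases hk : k ∈ p.support
  · exact hi k hk
  · rw [notMem_support_iff.1 hk, map_zero]
    exact zero_mem _

lemma eventually_map_residue_eq {p q : (prod l Q)[X]}
    (h : p.map (prod l Q).residue = q.map (prod l Q).residue) :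
    ∀ᶠ i in l, (p.map (eval l Q i)).map (Q i).residue = (q.map (eval l Q i)).map (Q i).residue := by
  have h1 : p - q ∈ polyIdeal (prod l Q).ideal := by
    rw [polyIdeal_ideal_iff, Polynomial.map_sub, h, sub_self]
  filter_upwards [eventually_map_eval_mem (E := fun i => (Q i).ideal) (mem_polyIdeal.1 h1)]
    with i hi
  rwa [polyIdeal_ideal_iff, Polynomial.map_sub, Polynomial.map_sub, sub_eq_zero] at hi

lemma eventually_coprime {s : Side} {g₁ g₂ : (prod l Q)[X]}
    (h : s.Coprime (g₁.map (prod l Q).residue) (g₂.map (prod l Q).residue)) :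
    ∀ᶠ i in l, s.Coprime ((g₁.map (eval l Q i)).map (Q i).residue)
      ((g₂.map (eval l Q i)).map (Q i).residue) := by
  cases s with
  | left =>
    obtain ⟨a, b, hab⟩ := h
    obtain ⟨a, rfl⟩ := map_surjective _ residue_surjective a
    obtain ⟨b, rfl⟩ := map_surjective _ residue_surjective b
    have := eventually_map_residue_eq (p := a * g₁ + b * g₂) (q := 1) (by simpa using hab)
    filter_upwards [this] with i hi
    exact ⟨_, _, by simpa using hi⟩
  | right =>
    obtain ⟨a, b, hab⟩ := h
    obtain ⟨a, rfl⟩ := map_surjective _ residue_surjective a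
    obtain ⟨b, rfl⟩ := map_surjective _ residue_surjective b
    have := eventually_map_residue_eq (p := g₁ * a + g₂ * b) (q := 1) (by simpa using hab)
    filter_upwards [this] with i hi
    exact ⟨_, _, by simpa using hi⟩

lemma exists_polynomial_of_eval {d : ℕ} (G : ∀ i, (Q i)[X]) (hG : ∀ i, MonicOfDegree d (G i)) :
    ∃ p : (prod l Q)[X], MonicOfDegree d p ∧ ∀ i, p.map (eval l Q i) = G i := by
  let c : ℕ → prod l Q := fun k i => (G i).coeff k
  let p : (prod l Q)[X] := ∑ k ∈ Finset.range (d + 1), monomial k (c k)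
  have hp : ∀ k, p.coeff k = c k := by
    intro k
    simp only [p, finsetSum_coeff, coeff_monomial]
    rw [Finset.sum_ite_eq']
    split_ifs with h
    · rfl
    · refine funext fun i => ?_
      have : d < k := by simpa using h
      exact (natDegree_le_iff_coeff_eq_zero.1 (hG i).1 k this).symm
  refine ⟨p, ⟨natDegree_le_iff_coeff_eq_zero.2 fun k hk => ?_, ?_⟩, fun i => ?_⟩
  · rw [hp]
    refine funext fun i => ?_
    exact natDegree_le_iff_coeff_eq_zero.1 (hG i).1 k hk
  · rw [hp]
    refine funext fun i => ?_
    exact (hG i).2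
  · ext k
    rw [coeff_map, hp]
    rfl

lemma map_eq_map_of_eventually {p q : (prod l Q)[X]}
    (h : ∀ᶠ i in l, p.map (eval l Q i) = q.map (eval l Q i)) :
    p.map (ringHom (toReducedProduct l Q)) = q.map (ringHom (toReducedProduct l Q)) := by
  ext k
  rw [coeff_map, coeff_map, toReducedProduct_eq_iff]
  filter_upwards [h] with i hi
  have := congrArg (fun r => r.coeff k) hi
  simp only [coeff_map] at this
  exact this

lemma map_residue_eq_of_eventually {p q : (prod l Q)[X]}
    (h : ∀ᶠ i in l, (p.map (eval l Q i)).map (Q i).residue =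
      (q.map (eval l Q i)).map (Q i).residue) :
    p.map (prod l Q).residue = q.map (prod l Q).residue := by
  ext k
  rw [coeff_map, coeff_map, ← sub_eq_zero, ← map_sub, residue_eq_zero_iff, mem_prod_ideal]
  filter_upwards [h] with i hi
  have := congrArg (fun r => r.coeff k) hi
  simp only [coeff_map] at this
  rwa [← sub_eq_zero, ← map_sub, residue_eq_zero_iff] at this

/-- Coprimality and the factorization of the reduction involve finitely many coefficients, hence
hold at eventually all indices. The lifts there have the fixed degrees `d₁`, `d₂` and assemble to
polynomials over the product. -/
theorem isHenselian_reducedProduct {s : Side} (h : ∀ i, (Q i).IsHenselian s) {n : ℕ}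
    (hn : ∀ i, (Q i).commFiltration n = ⊥) : (reducedProduct l Q).IsHenselian s := by
  refine isHenselian_of_exists (isJacobson_reducedProduct fun i => (h i).1)
    (IsPerfect.of_commFiltration_eq_bot (commFiltration_reducedProduct hn))
    fun d₁ d₂ F g₁ g₂ hF hg₁ hg₂ hc hmap => ?_
  let π := toReducedProduct l Q
  have hπ : Function.Surjective (ringHom π) := toReducedProduct_surjective l Q
  obtain ⟨F, rfl, hF'⟩ := exists_lift_monicOfDegree hπ hF
  obtain ⟨g₁, rfl, hg₁'⟩ := exists_lift_monicOfDegree hπ hg₁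
  obtain ⟨g₂, rfl, hg₂'⟩ := exists_lift_monicOfDegree hπ hg₂
  have hinj : Function.Injective (Polynomial.map (residueMap π)) :=
    map_injective _ (residueMap_injective π)
  have hsurj : Function.Surjective (residueMap π) := by
    intro x
    obtain ⟨x, rfl⟩ := residue_surjective x
    obtain ⟨x, rfl⟩ := hπ x
    exact ⟨_, residueMap_residue π x⟩
  have hmap' : F.map (prod l Q).residue = (g₁ * g₂).map (prod l Q).residue := by
    apply hinj
    rw [Polynomial.map_mul, Polynomial.map_mul, ← map_residue_map, ← map_residue_map,
      ← map_residue_map, hmap]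
  have hc' : s.Coprime (g₁.map (prod l Q).residue) (g₂.map (prod l Q).residue) := by
    let e : (prod l Q).Residue ≃+* (reducedProduct l Q).Residue :=
      RingEquiv.ofBijective (residueMap π) ⟨residueMap_injective π, hsurj⟩
    let φ : (reducedProduct l Q).Residue[X] →+* (prod l Q).Residue[X] :=
      mapRingHom (e.symm : (reducedProduct l Q).Residue →+* (prod l Q).Residue)
    have hφ : ∀ p : (prod l Q)[X],
        φ ((p.map (ringHom π)).map (reducedProduct l Q).residue) = p.map (prod l Q).residue := by
      intro p
      rw [map_residue_map]
      ext k
      simp only [φ, coe_mapRingHom, coeff_map]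
      exact e.symm_apply_apply ((prod l Q).residue (p.coeff k))
    have := Side.Coprime.map hc φ
    rwa [hφ, hφ] at this
  have key : ∀ i, ∃ G : (Q i)[X] × (Q i)[X], MonicOfDegree d₁ G.1 ∧ MonicOfDegree d₂ G.2 ∧
      (s.Coprime ((g₁.map (eval l Q i)).map (Q i).residue)
        ((g₂.map (eval l Q i)).map (Q i).residue) →
      (F.map (eval l Q i)).map (Q i).residue = ((g₁ * g₂).map (eval l Q i)).map (Q i).residue →
      F.map (eval l Q i) = G.1 * G.2 ∧
        G.1.map (Q i).residue = (g₁.map (eval l Q i)).map (Q i).residue ∧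
        G.2.map (Q i).residue = (g₂.map (eval l Q i)).map (Q i).residue) := by
    intro i
    have hm₁ := hg₁'.map (eval l Q i)
    have hm₂ := hg₂'.map (eval l Q i)
    by_cases hcase : s.Coprime ((g₁.map (eval l Q i)).map (Q i).residue)
        ((g₂.map (eval l Q i)).map (Q i).residue) ∧
      (F.map (eval l Q i)).map (Q i).residue = ((g₁ * g₂).map (eval l Q i)).map (Q i).residue
    · obtain ⟨G, ⟨hG₁, hG₂, heq, hr₁, hr₂⟩, -⟩ := (h i).2 (F.map (eval l Q i)) _ _
        (hF'.map (eval l Q i)).monic (hm₁.map _).monic (hm₂.map _).monic hcase.1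
        (by rw [hcase.2, Polynomial.map_mul, Polynomial.map_mul])
      refine ⟨G, (h i).1.monicOfDegree hG₁ ?_, (h i).1.monicOfDegree hG₂ ?_,
        fun _ _ => ⟨heq, hr₁, hr₂⟩⟩
      · rw [hr₁]; exact hm₁.map _
      · rw [hr₂]; exact hm₂.map _
    -- At exceptional indices the approximate factors serve as placeholders of the right degree; the
    -- filter ignores them.
    · exact ⟨(_, _), hm₁, hm₂, fun h1 h2 => absurd ⟨h1, h2⟩ hcase⟩
  choose G hG₁ hG₂ hG using key
  obtain ⟨p₁, hp₁, hpe₁⟩ := exists_polynomial_of_eval (l := l) (fun i => (G i).1) hG₁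
  obtain ⟨p₂, hp₂, hpe₂⟩ := exists_polynomial_of_eval (l := l) (fun i => (G i).2) hG₂
  have hev := (eventually_coprime hc').and (eventually_map_residue_eq hmap')
  refine ⟨p₁.map (ringHom π), p₂.map (ringHom π), (hp₁.map _).monic, (hp₂.map _).monic, ?_, ?_, ?_⟩
  · rw [← Polynomial.map_mul]
    refine map_eq_map_of_eventually ?_
    filter_upwards [hev] with i hi
    rw [Polynomial.map_mul, hpe₁, hpe₂]
    exact (hG i hi.1 hi.2).1
  · rw [map_residue_map, map_residue_map, map_residue_eq_of_eventually (p := p₁) (q := g₁)]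
    filter_upwards [hev] with i hi
    rw [hpe₁]
    exact (hG i hi.1 hi.2).2.1
  · rw [map_residue_map, map_residue_map, map_residue_eq_of_eventually (p := p₂) (q := g₂)]
    filter_upwards [hev] with i hi
    rw [hpe₂]
    exact (hG i hi.1 hi.2).2.2

end ReducedProduct

/-! ### Perfect Jacobson pairs are separated by morphisms to Henselian perfect pairs -/

variable {P : RingPair.{u}} {s : Side}

/-- The pair `(R, R ∩ I)` for a subring `R`. -/
def restrict (P : RingPair.{u}) (R : Subring P) : RingPair.{u} where
  carrier := R
  ideal := P.ideal.comap R.subtype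

/-- The inclusion of `(R, R ∩ I)`. -/
def restrictHom (P : RingPair.{u}) (R : Subring P) : P.restrict R ⟶ P where
  toRingHom := R.subtype
  comap_ideal := rfl

/-- The element of `(R, R ∩ I)` given by an element of `R`. -/
def restrictMk {R : Subring P} (x : P) (hx : x ∈ R) : P.restrict R := ⟨x, hx⟩

lemma restrictHom_injective (R : Subring P) : Function.Injective (ringHom (P.restrictHom R)) :=
  Subtype.val_injective

lemma closure_preimage_subtype_eq_top {R : Type u} [Ring R] (X : Set R) :
    Subring.closure (Subtype.val ⁻¹' X : Set (Subring.closure X)) = ⊤ := by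
  rw [eq_top_iff]
  rintro ⟨x, hx⟩ -
  induction hx using Subring.closure_induction with
  | mem x hx => exact Subring.subset_closure hx
  | zero => exact zero_mem _
  | one => exact one_mem _
  | add x y _ _ hx hy => exact add_mem hx hy
  | neg x _ hx => exact neg_mem hx
  | mul x y _ _ hx hy => exact mul_mem hx hy

-- The finitely generated subrings containing `a` need not be Jacobson pairs, but elements of `1 +
-- I` are units in `P`, so none of them kills `a`. Each subring therefore has a locally nilpotent
-- quotient in which `a` survives, and a reduced product combines these quotients.
open Classical in
lemma exists_isHenselian_of_commFiltration_eq_bot (hP : P.IsJacobson) {n : ℕ}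
    (hn : P.commFiltration n = ⊥) {a : P} (ha : a ≠ 0) :
    ∃ (Q : RingPair.{u}) (f : P ⟶ Q), Q.IsHenselian s ∧ Q.IsPerfect ∧ ringHom f a ≠ 0 := by
  let R : Finset P → Subring P := fun S => Subring.closure (insert a (S : Set P))
  have haR : ∀ S, a ∈ R S := fun S => Subring.subset_closure (Set.mem_insert _ _)
  have hR : ∀ x, ∀ᶠ S in atTop, x ∈ R S := fun x => by
    filter_upwards [eventually_ge_atTop ({x} : Finset P)] with S hS
    exact Subring.subset_closure (Set.mem_insert_of_mem _ (hS (Finset.mem_singleton_self x)))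
  have key : ∀ S, ∃ (Q : RingPair.{u}) (f : P.restrict (R S) ⟶ Q),
      Q.IsLocallyNilpotent ∧ Q.commFiltration n = ⊥ ∧ ringHom f (restrictMk a (haR S)) ≠ 0 := by
    intro S
    have hinj := restrictHom_injective (R S)
    refine exists_quotient_isLocallyNilpotent (X := Subtype.val ⁻¹' (insert a (S : Set P))) ?_ ?_
      ?_ ?_
    · rw [eq_bot_iff]
      intro x hx
      have := ringHom_mem_commFiltration (P.restrictHom (R S)) n hx
      rw [hn] at this
      exact hinj (this.trans (map_zero _).symm)
    · intro t ht h0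
      have h1 : IsUnit (ringHom (P.restrictHom (R S)) t) :=
        isUnit_of_sub_one_mem_jacobson hP ht
      refine ha ((h1.mul_right_eq_zero).1 ?_)
      exact congrArg (ringHom (P.restrictHom (R S))) h0
    · exact ((Finset.finite_toSet S).insert a).preimage Subtype.val_injective.injOn
    · exact closure_preimage_subtype_eq_top _
  choose Q f hQ hQn hfa using key
  -- The value outside `R S` is irrelevant: each `x` lies in `R S` for all large `S`, so the ring
  -- operations are respected eventually.
  let g : P → prod atTop Q := fun x S => if h : x ∈ R S then ringHom (f S) (restrictMk x h) else 0
  have hg : ∀ {x S} (h : x ∈ R S), g x S = ringHom (f S) (restrictMk x h) := fun h => dif_pos h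
  let π := toReducedProduct atTop Q
  let θ : P →+* reducedProduct atTop Q :=
    { toFun := fun x => ringHom π (g x)
      map_one' := by
        rw [← map_one (ringHom π), toReducedProduct_eq_iff]
        exact Eventually.of_forall fun S => (hg (one_mem _)).trans (map_one (ringHom (f S)))
      map_zero' := by
        rw [← map_zero (ringHom π), toReducedProduct_eq_iff]
        exact Eventually.of_forall fun S => (hg (zero_mem _)).trans (map_zero (ringHom (f S)))
      map_mul' := fun x y => by
        rw [← map_mul (ringHom π), toReducedProduct_eq_iff]
        filter_upwards [hR x, hR y] with S hx hy
        change _ = g x S * g y S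
        rw [hg hx, hg hy, hg (mul_mem hx hy)]
        exact map_mul (ringHom (f S)) (restrictMk x hx) (restrictMk y hy)
      map_add' := fun x y => by
        rw [← map_add (ringHom π), toReducedProduct_eq_iff]
        filter_upwards [hR x, hR y] with S hx hy
        change _ = g x S + g y S
        rw [hg hx, hg hy, hg (add_mem hx hy)]
        exact map_add (ringHom (f S)) (restrictMk x hx) (restrictMk y hy) }
  have hθ : (reducedProduct atTop Q).ideal.comap θ = P.ideal := by
    ext x
    rw [Ideal.mem_comap]
    refine (ringHom_mem_iff π).trans ?_
    rw [mem_prod_ideal]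
    have : ∀ᶠ S in atTop, (g x S ∈ (Q S).ideal ↔ x ∈ P.ideal) := by
      filter_upwards [hR x] with S hx
      rw [hg hx, ringHom_mem_iff]
      rfl
    rw [eventually_congr this, eventually_const]
  refine ⟨reducedProduct atTop Q, ⟨θ, hθ⟩,
    isHenselian_reducedProduct (fun S => (hQ S).isHenselian (hQn S)) hQn,
    IsPerfect.of_commFiltration_eq_bot (commFiltration_reducedProduct hQn), ?_⟩
  change ringHom π (g a) ≠ 0
  rw [Ne, toReducedProduct_eq_zero_iff]
  intro h
  obtain ⟨S, hS⟩ := h.exists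
  rw [hg (haR S)] at hS
  exact hfa S hS

/-- A nonzero element of a perfect Jacobson pair survives in some Henselian perfect pair. -/
theorem exists_isHenselian_ringHom_ne_zero (hP : P.IsJacobson) (hP' : P.IsPerfect) {a : P}
    (ha : a ≠ 0) :
    ∃ (Q : RingPair.{u}) (f : P ⟶ Q), Q.IsHenselian s ∧ Q.IsPerfect ∧ ringHom f a ≠ 0 := by
  obtain ⟨n, hn⟩ : ∃ n, a ∉ P.commFiltration n := by
    by_contra! h
    exact ha (isPerfect_iff.1 hP' a h)
  let π := toQuotient _ (P.commFiltration_le_ideal n)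
  obtain ⟨Q, f, hQ, hQ', hf⟩ := exists_isHenselian_of_commFiltration_eq_bot (s := s)
    (hP.of_surjective π (toQuotient_surjective _ _)) (commFiltration_quotient_eq_bot n)
    (a := ringHom π a) (fun h => hn ((toQuotient_eq_zero_iff _ _).1 h))
  exact ⟨Q, π ≫ f, hQ, hQ', hf⟩

end RingPair

/-! ### Universal properties of the constructions -/

lemma FreeExt.hom_ext {A : Type u} [Ring A] {X : Type v} {B : Type w} [Ring B]
    {f g : FreeExt A X →+* B} (h₁ : ∀ a, f (FreeExt.of A X a) = g (FreeExt.of A X a))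
    (h₂ : ∀ x, f (FreeExt.var A X x) = g (FreeExt.var A X x)) : f = g := by
  refine RingQuot.ringQuot_ext f g (RingHom.ext fun p => ?_)
  induction p using FreeAlgebra.induction with
  | grade0 r => rw [eq_intCast (algebraMap ℤ (FreeAlgebra ℤ (A ⊕ X))), map_intCast, map_intCast]
  | grade1 x =>
    rcases x with a | x
    · exact h₁ a
    · exact h₂ x
  | mul a b ha hb => rw [map_mul, map_mul, ha, hb]
  | add a b ha hb => rw [map_add, map_add, ha, hb]

lemma UnivLoc.isUnit_of {A : Type u} [Ring A] {S : Set A} {s : A} (hs : s ∈ S) :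
    IsUnit (UnivLoc.of A S s) := by
  refine isUnit_iff_exists.2 ⟨RingQuot.mkRingHom _ (FreeExt.var A S ⟨s, hs⟩), ?_, ?_⟩
  · have := RingQuot.mkRingHom_rel (UnivLoc.Rel.mul_inv (A := A) (S := S) ⟨s, hs⟩)
    rwa [map_mul, map_one] at this
  · have := RingQuot.mkRingHom_rel (UnivLoc.Rel.inv_mul (A := A) (S := S) ⟨s, hs⟩)
    rwa [map_mul, map_one] at this

/-- Two-sided inverses are unique, so the values on the adjoined inverses are forced. -/
lemma UnivLoc.hom_ext {A : Type u} [Ring A] {S : Set A} {B : Type w} [Ring B]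
    {f g : UnivLoc A S →+* B} (h : ∀ a, f (UnivLoc.of A S a) = g (UnivLoc.of A S a)) : f = g := by
  refine RingQuot.ringQuot_ext f g (FreeExt.hom_ext h fun s => ?_)
  have h₁ := RingQuot.mkRingHom_rel (UnivLoc.Rel.mul_inv (A := A) (S := S) s)
  have h₂ := RingQuot.mkRingHom_rel (UnivLoc.Rel.inv_mul (A := A) (S := S) s)
  rw [map_mul, map_one] at h₁ h₂
  have hf := congrArg f h₂
  have hg := congrArg g h₁
  rw [map_mul, map_one] at hf hg
  have hs : f (RingQuot.mkRingHom (UnivLoc.Rel A S) (FreeExt.of A S s)) =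
    g (RingQuot.mkRingHom (UnivLoc.Rel A S) (FreeExt.of A S s)) := h s
  rw [← hs] at hg
  exact left_inv_eq_right_inv hf hg

namespace RingOver

variable {B : Type u} [Ring B] (X : RingOver B)

/-- The canonical homomorphisms `Aₙ → A_φ`. -/
def ofStage (n : ℕ) : (X.stage n).carrier →+* X.localization.carrier :=
  (colimit.ι X.seq n).hom

lemma ofStage_toStep (n : ℕ) (a : (X.stage n).carrier) :
    X.ofStage (n + 1) ((X.stage n).toStep a) = X.ofStage n a := by
  have h : X.seq.map (homOfLE n.le_succ) = RingCat.ofHom (X.stage n).toStep :=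
    Functor.ofSequence_map_homOfLE_succ _ n
  have := colimit.w X.seq (homOfLE n.le_succ)
  rw [h] at this
  exact congrArg (fun f => f.hom a) this

lemma localization_hom_ofStage (n : ℕ) (a : (X.stage n).carrier) :
    X.localization.hom (X.ofStage n a) = (X.stage n).hom a :=
  congrArg (fun f => f.hom a) (colimit.ι_desc X.seqCocone n)

lemma exists_ofStage (x : X.localization.carrier) : ∃ n a, X.ofStage n a = x := by
  -- The index category `ℕ` lives in universe `0`, below the universe of the rings.
  have : PreservesFilteredColimitsOfSize.{0, 0} (forget RingCat.{u}) :=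
    preservesFilteredColimitsOfSize_shrink.{0, u, 0, u} _
  exact Concrete.colimit_exists_rep X.seq x

variable {X}

/-- This is the purpose of iterating: an element of one stage with invertible image becomes a unit
in the next. -/
lemma isUnit_of_isUnit_hom {x : X.localization.carrier} (h : IsUnit (X.localization.hom x)) :
    IsUnit x := by
  obtain ⟨n, a, rfl⟩ := X.exists_ofStage x
  rw [localization_hom_ofStage] at h
  rw [← ofStage_toStep]
  exact (UnivLoc.isUnit_of (S := {s | IsUnit ((X.stage n).hom s)}) h).map _

lemma localization_hom_ext {T : Type u} [Ring T] {f g : X.localization.carrier →+* T}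
    (h : ∀ a, f (X.toLocalization a) = g (X.toLocalization a)) : f = g := by
  have key : ∀ n, ∀ a, f (X.ofStage n a) = g (X.ofStage n a) := by
    intro n
    induction n with
    | zero => exact h
    | succ n ih =>
      have : f.comp (X.ofStage (n + 1)) = g.comp (X.ofStage (n + 1)) :=
        UnivLoc.hom_ext (S := {s | IsUnit ((X.stage n).hom s)}) fun a => by
          have := ih a
          rw [← ofStage_toStep] at this
          exact this
      exact RingHom.congr_fun this
  ext x
  obtain ⟨n, a, rfl⟩ := X.exists_ofStage x
  exact key n a

variable {T T' : Type u} [Ring T] [Ring T']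

/-- The extension of a homomorphism to the stages of the localization. -/
def liftStage {ρ : T →+* T'} (hρ : ∀ t, IsUnit (ρ t) → IsUnit t) (ψ : B →+* T') (φ : X.carrier →+* T) (h : ∀ a, ρ (φ a) = ψ (X.hom a)) :
    ∀ n, {f : (X.stage n).carrier →+* T // ∀ a, ρ (f a) = ψ ((X.stage n).hom a)}
  | 0 => ⟨φ, h⟩
  | n + 1 =>
    ⟨UnivLoc.lift (liftStage hρ ψ φ h n).1 fun s hs => hρ _ (by
      rw [(liftStage hρ ψ φ h n).2]
      exact IsUnit.map ψ hs), RingHom.congr_fun (UnivLoc.hom_ext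
        (f := ρ.comp (UnivLoc.lift (liftStage hρ ψ φ h n).1 _)) (g := ψ.comp (X.stage n).step.hom)
        fun a => by
          change ρ (UnivLoc.lift _ _ (UnivLoc.of _ _ a)) = ψ ((X.stage n).step.hom ((X.stage n).toStep a))
          rw [UnivLoc.lift_of, step_hom_toStep]
          exact (liftStage hρ ψ φ h n).2 a)⟩

/-- Whatever is inverted in a stage is a unit in `B`, hence in `T'`, hence in `T` by `hρ`. Carrying
the commutative square along lets the extension continue from stage to stage. -/
lemma exists_localization_lift {ρ : T →+* T'} (hρ : ∀ t, IsUnit (ρ t) → IsUnit t)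
    (ψ : B →+* T') (φ : X.carrier →+* T) (h : ∀ a, ρ (φ a) = ψ (X.hom a)) :
    ∃ f : X.localization.carrier →+* T, (∀ a, f (X.toLocalization a) = φ a) ∧
      ∀ x, ρ (f x) = ψ (X.localization.hom x) := by
  let c : Cocone X.seq :=
    { pt := RingCat.of T
      ι := NatTrans.ofSequence (F := X.seq) (G := (Functor.const ℕ).obj (RingCat.of T))
        (fun n => RingCat.ofHom (liftStage hρ ψ φ h n).1) fun n => by
          ext a
          have h' : X.seq.map (homOfLE n.le_succ) = RingCat.ofHom (X.stage n).toStep :=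
            Functor.ofSequence_map_homOfLE_succ _ n
          rw [h']
          exact UnivLoc.lift_of (S := {s | IsUnit ((X.stage n).hom s)}) _ (fun s hs => hρ _ (by
            rw [(liftStage hρ ψ φ h n).2]
            exact IsUnit.map ψ hs)) a }
  let f : X.localization.carrier →+* T := (colimit.desc X.seq c).hom
  have hf : ∀ a, f (X.toLocalization a) = φ a := fun a =>
    congrArg (fun f => f.hom a) (colimit.ι_desc c 0)
  refine ⟨f, hf, RingHom.congr_fun (localization_hom_ext (f := ρ.comp f)
    (g := ψ.comp X.localization.hom) fun a => ?_)⟩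
  rw [RingHom.comp_apply, hf, h, RingHom.comp_apply]
  exact congrArg ψ (RingHom.congr_fun X.localization_hom_comp a).symm

end RingOver

/-! ### The universal property of simple LF-extensions -/

namespace FactDatum

open RingPair

variable {s : Side} {P Q S : RingPair.{u}} (d : FactDatum s P)

/-- The factorization datum `d` lifts to a factorization along the morphism `θ`. -/
def LiftsAlong (θ : P ⟶ Q) : Prop :=
  ∃ G₁ G₂ : Q[X], G₁.Monic ∧ G₂.Monic ∧ d.F.map (ringHom θ) = G₁ * G₂ ∧
    G₁.map Q.residue = d.f₁.map (residueMap θ) ∧ G₂.map Q.residue = d.f₂.map (residueMap θ)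

/-- The image of a factorization datum under a morphism of pairs. -/
def map (θ : P ⟶ Q) : FactDatum s Q where
  F := d.F.map (ringHom θ)
  f₁ := d.f₁.map (residueMap θ)
  f₂ := d.f₂.map (residueMap θ)
  monic_F := d.monic_F.map _
  monic_f₁ := d.monic_f₁.map _
  monic_f₂ := d.monic_f₂.map _
  coprime := d.coprime.map (mapRingHom (residueMap θ))
  map_F := by rw [map_residue_map, d.map_F, Polynomial.map_mul]

variable {d}

lemma LiftsAlong.comp {θ : P ⟶ Q} (h : d.LiftsAlong θ) (ψ : Q ⟶ S) : d.LiftsAlong (θ ≫ ψ) := by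
  obtain ⟨G₁, G₂, h₁, h₂, h, hr₁, hr₂⟩ := h
  refine ⟨G₁.map (ringHom ψ), G₂.map (ringHom ψ), h₁.map _, h₂.map _, ?_, ?_, ?_⟩
  · rw [← Polynomial.map_mul, ← h, Polynomial.map_map]; rfl
  · rw [map_residue_map, hr₁, Polynomial.map_map]
    congr 1
    exact Ideal.Quotient.ringHom_ext rfl
  · rw [map_residue_map, hr₂, Polynomial.map_map]
    congr 1
    exact Ideal.Quotient.ringHom_ext rfl

lemma LiftsAlong.of_map {θ : P ⟶ Q} {ψ : Q ⟶ S} (h : (d.map θ).LiftsAlong ψ) :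
    d.LiftsAlong (θ ≫ ψ) := by
  obtain ⟨G₁, G₂, h₁, h₂, h, hr₁, hr₂⟩ := h
  refine ⟨G₁, G₂, h₁, h₂, ?_, ?_, ?_⟩
  · rw [← h, map, Polynomial.map_map]; rfl
  · rw [hr₁, map, Polynomial.map_map]
    congr 1
    exact Ideal.Quotient.ringHom_ext rfl
  · rw [hr₂, map, Polynomial.map_map]
    congr 1
    exact Ideal.Quotient.ringHom_ext rfl

lemma _root_.RingPair.IsHenselian.liftsAlong (hQ : Q.IsHenselian s) (d : FactDatum s P)
    (θ : P ⟶ Q) : d.LiftsAlong θ := by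
  obtain ⟨⟨G₁, G₂⟩, ⟨h₁, h₂, h, hr₁, hr₂⟩, -⟩ := hQ.2 _ _ _ (d.map θ).monic_F (d.map θ).monic_f₁
    (d.map θ).monic_f₂ (d.map θ).coprime (d.map θ).map_F
  exact ⟨G₁, G₂, h₁, h₂, h, hr₁, hr₂⟩

variable (d)

/-- The morphism `(R, J) → (A⟨F; f₁, f₂⟩, I⟨F; f₁, f₂⟩)`. -/
def localToExt : d.localPair ⟶ d.ext := d.localPair.toPerfection

lemma localToExt_surjective : Function.Surjective (ringHom d.localToExt) :=
  toPerfection_surjective (P := d.localPair)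

/-- The homomorphism `A⟨y, z⟩ → A⟨F; f₁, f₂⟩`. -/
def freeToExt : FreeExt P d.Vars →+* d.ext :=
  (ringHom d.localToExt).comp
    (d.univOver.toLocalization.comp (RingQuot.mkRingHom d.Rel))

lemma isJacobson_ext : d.ext.IsJacobson := by
  refine IsJacobson.of_surjective (P := d.localPair) (isJacobson_iff.2 fun a ha => ?_)
    d.localToExt d.localToExt_surjective
  refine RingOver.isUnit_of_isUnit_hom ?_
  exact ha.map (RingHom.kerLift d.univOver.localization.hom)

lemma isPerfect_ext : d.ext.IsPerfect := perfection_isPerfect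

lemma mk_localization_eq {r : d.localPair} {a : P}
    (h : d.univOver.localization.hom r = P.residue a) :
    d.ext.residue (ringHom d.localToExt r) = residueMap d.toExt (P.residue a) := by
  rw [residueMap_residue, ← sub_eq_zero, ← map_sub, residue_eq_zero_iff]
  change ringHom d.localToExt r -
    ringHom d.localToExt (ringHom d.toLocalPair a) ∈ _
  rw [← map_sub, ringHom_mem_iff]
  change d.univOver.localization.hom (r - ringHom d.toLocalPair a) = 0
  have h' : d.univOver.localization.hom (d.univOver.toLocalization (d.ofBase a)) = P.residue a :=
    (RingHom.congr_fun d.univOver.localization_hom_comp (d.ofBase a)).trans (d.toResidue_ofBase a)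
  exact (map_sub d.univOver.localization.hom _ _).trans (sub_eq_zero.2 (h.trans h'.symm))

/-- The ideal `J` is the kernel of a map to `A / I`, so the extension creates no new residues:
modulo `J` every element agrees with one from the base. -/
lemma residueMap_toExt_surjective : Function.Surjective (residueMap d.toExt) := by
  intro b
  obtain ⟨b, rfl⟩ := residue_surjective b
  obtain ⟨r, rfl⟩ := d.localToExt_surjective b
  obtain ⟨a, ha⟩ := residue_surjective (d.univOver.localization.hom r)
  exact ⟨_, (d.mk_localization_eq ha.symm).symm⟩

lemma residue_freeToExt (p : FreeExt P d.Vars) :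
    d.ext.residue (d.freeToExt p) = residueMap d.toExt (d.toResidueFree p) := by
  obtain ⟨a, ha⟩ := residue_surjective (d.toResidueFree p)
  rw [← ha]
  refine d.mk_localization_eq ?_
  refine (RingHom.congr_fun d.univOver.localization_hom_comp _).trans ?_
  change RingQuot.lift _ (RingQuot.mkRingHom _ _) = _
  rw [RingQuot.lift_mkRingHom_apply, ha]

lemma residue_comp_freeToExt :
    d.ext.residue.comp d.freeToExt = (residueMap d.toExt).comp d.toResidueFree :=
  RingHom.ext d.residue_freeToExt

lemma map_F_toExt :
    d.F.map (ringHom d.toExt) = d.G₁.map d.freeToExt * d.G₂.map d.freeToExt := by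
  have h : ringHom d.toExt = d.freeToExt.comp (FreeExt.of P d.Vars) := rfl
  rw [h, ← Polynomial.map_map, ← Polynomial.map_mul]
  ext k
  rw [coeff_map d.freeToExt, coeff_map d.freeToExt]
  exact congrArg ((ringHom d.localToExt).comp d.univOver.toLocalization)
    (RingQuot.mkRingHom_rel (Rel.coeff k)).symm

lemma monicOfDegree_of_sum {R : Type u} [Ring R] (n : ℕ) (c : Fin n → R) :
    MonicOfDegree n (X ^ n + ∑ i : Fin n, C (c i) * X ^ (i : ℕ)) := by
  have h : ∀ i : Fin n, (C (c i) * X ^ (i : ℕ)).coeff n = 0 := fun i => by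
    rw [coeff_C_mul, coeff_X_pow, if_neg i.2.ne', mul_zero]
  refine ⟨?_, ?_⟩
  · refine natDegree_add_le_of_degree_le (natDegree_X_pow_le n) ?_
    exact natDegree_sum_le_of_forall_le _ _ fun i _ => (natDegree_C_mul_X_pow_le _ _).trans i.2.le
  · rw [coeff_add, coeff_X_pow_self, finsetSum_coeff, Finset.sum_eq_zero fun i _ => h i, add_zero]

lemma coeff_sum {R : Type u} [Ring R] {n : ℕ} (c : Fin n → R) (i : Fin n) :
    (X ^ n + ∑ i : Fin n, C (c i) * X ^ (i : ℕ)).coeff i = c i := by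
  rw [coeff_add, coeff_X_pow, if_neg i.2.ne, zero_add, finsetSum_coeff,
    Finset.sum_eq_single i]
  · rw [coeff_C_mul, coeff_X_pow_self, mul_one]
  · intro j _ hj
    rw [coeff_C_mul, coeff_X_pow, if_neg, mul_zero]
    exact fun h => hj (Fin.ext h.symm)
  · simp

lemma sum_eq_of_monicOfDegree {R : Type u} [Ring R] {n : ℕ} {g : R[X]} (hg : MonicOfDegree n g) :
    X ^ n + ∑ i : Fin n, C (g.coeff i) * X ^ (i : ℕ) = g := by
  ext k
  rcases lt_trichotomy k n with hk | rfl | hk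
  · exact coeff_sum (fun i : Fin n => g.coeff i) ⟨k, hk⟩
  · rw [(monicOfDegree_of_sum _ _).2, hg.2]
  · rw [coeff_eq_zero_of_natDegree_lt ((monicOfDegree_of_sum _ _).1.trans_lt hk),
      coeff_eq_zero_of_natDegree_lt (hg.1.trans_lt hk)]

lemma monicOfDegree_G₁ : MonicOfDegree d.f₁.natDegree d.G₁ := monicOfDegree_of_sum _ _

lemma monicOfDegree_G₂ : MonicOfDegree d.f₂.natDegree d.G₂ := monicOfDegree_of_sum _ _

lemma map_residue_G₁ :
    (d.G₁.map d.freeToExt).map d.ext.residue = d.f₁.map (residueMap d.toExt) := by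
  rw [Polynomial.map_map, residue_comp_freeToExt, ← Polynomial.map_map, map_G₁]

lemma map_residue_G₂ :
    (d.G₂.map d.freeToExt).map d.ext.residue = d.f₂.map (residueMap d.toExt) := by
  rw [Polynomial.map_map, residue_comp_freeToExt, ← Polynomial.map_map, map_G₂]

lemma liftsAlong_toExt : d.LiftsAlong d.toExt :=
  ⟨_, _, (d.monicOfDegree_G₁.map _).monic, (d.monicOfDegree_G₂.map _).monic, d.map_F_toExt,
    d.map_residue_G₁, d.map_residue_G₂⟩

variable {d}

/-- A morphism from a simple LF-extension to a perfect Jacobson pair is determined by its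
restriction to the base. -/
lemma ext_hom_ext (hQ : Q.IsJacobson) (hQ' : Q.IsPerfect) {ψ₁ ψ₂ : d.ext ⟶ Q}
    (h : d.toExt ≫ ψ₁ = d.toExt ≫ ψ₂) : ψ₁ = ψ₂ := by
  have hres : ∀ f : P.Residue[X], (f.map (residueMap d.toExt)).map (residueMap ψ₁) =
      (f.map (residueMap d.toExt)).map (residueMap ψ₂) := fun f => by
    rw [Polynomial.map_map, Polynomial.map_map]
    congr 1
    refine Ideal.Quotient.ringHom_ext ?_
    ext a
    exact congrArg (fun θ => Q.residue (ringHom θ a)) h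
  have hF : (d.G₁.map d.freeToExt).map (ringHom ψ₁) * (d.G₂.map d.freeToExt).map (ringHom ψ₁) =
      (d.G₁.map d.freeToExt).map (ringHom ψ₂) * (d.G₂.map d.freeToExt).map (ringHom ψ₂) := by
    rw [← Polynomial.map_mul (ringHom ψ₁), ← Polynomial.map_mul (ringHom ψ₂), ← map_F_toExt,
      Polynomial.map_map, Polynomial.map_map]
    exact congrArg (fun θ => d.F.map (ringHom θ)) h
  -- Both morphisms carry the universal factors to lifts of the same coprime factorization. Rigidity
  -- makes these equal, so the morphisms agree on the variables, which are the coefficients of those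
  -- factors.
  obtain ⟨h₁, h₂⟩ := hQ.factorization_unique hQ' (s := s)
    ((d.monicOfDegree_G₁.map _).map _) ((d.monicOfDegree_G₁.map _).map _)
    (coprime_map_residue_map ψ₁ (by
      rw [map_residue_G₁, map_residue_G₂]
      exact d.coprime.map (mapRingHom (residueMap d.toExt)))) hF
    (by rw [map_residue_map, map_residue_map, map_residue_G₁, hres])
    (by rw [map_residue_map, map_residue_map, map_residue_G₂, hres])
  have key : (ringHom ψ₁).comp d.freeToExt = (ringHom ψ₂).comp d.freeToExt := by
    refine FreeExt.hom_ext (fun a => congrArg (fun θ => ringHom θ a) h) ?_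
    rintro (i | i)
    · have := congrArg (fun p => p.coeff (i : ℕ)) h₁
      simp only [coeff_map] at this
      rwa [show d.G₁.coeff (i : ℕ) = _ from coeff_sum _ i] at this
    · have := congrArg (fun p => p.coeff (i : ℕ)) h₂
      simp only [coeff_map] at this
      rwa [show d.G₂.coeff (i : ℕ) = _ from coeff_sum _ i] at this
  have hloc : (ringHom ψ₁).comp (ringHom d.localToExt) =
      (ringHom ψ₂).comp (ringHom d.localToExt) :=
    RingOver.localization_hom_ext (X := d.univOver) (RingHom.congr_fun
      (RingQuot.ringQuot_ext
        (((ringHom ψ₁).comp (ringHom d.localToExt)).comp d.univOver.toLocalization)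
        (((ringHom ψ₂).comp (ringHom d.localToExt)).comp d.univOver.toLocalization)
        key))
  refine RingPair.hom_ext fun b => ?_
  obtain ⟨r, rfl⟩ := d.localToExt_surjective b
  exact RingHom.congr_fun hloc r

/-- The coefficients of the lifted factors serve as values of the variables; the Jacobson property
ensures the right degrees. Compatibility with residues allows extension over the localization, and
injectivity of `residueMap θ` yields the condition on ideals. -/
lemma exists_localPair_lift (hQ : Q.IsJacobson) {θ : P ⟶ Q} (h : d.LiftsAlong θ) :
    ∃ ψ : d.localPair ⟶ Q, d.toLocalPair ≫ ψ = θ := by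
  obtain ⟨G₁, G₂, hG₁, hG₂, hF, hr₁, hr₂⟩ := h
  have hm₁ := hQ.monicOfDegree hG₁ (d := d.f₁.natDegree)
    (by rw [hr₁]; exact (MonicOfDegree.of_monic d.monic_f₁).map _)
  have hm₂ := hQ.monicOfDegree hG₂ (d := d.f₂.natDegree)
    (by rw [hr₂]; exact (MonicOfDegree.of_monic d.monic_f₂).map _)
  let α : FreeExt P d.Vars →+* Q := FreeExt.lift (ringHom θ)
    (Sum.elim (fun i => G₁.coeff i) (fun i => G₂.coeff i))
  have hα₁ : d.G₁.map α = G₁ := by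
    conv_rhs => rw [← sum_eq_of_monicOfDegree hm₁]
    simp [FactDatum.G₁, α, Polynomial.map_sum]
  have hα₂ : d.G₂.map α = G₂ := by
    conv_rhs => rw [← sum_eq_of_monicOfDegree hm₂]
    simp [FactDatum.G₂, α, Polynomial.map_sum]
  have hαof : α.comp (FreeExt.of P d.Vars) = ringHom θ := RingHom.ext fun a => FreeExt.lift_of _ _ a
  let φ : d.Univ →+* Q := RingQuot.lift ⟨α, by
    intro a b r
    cases r with
    | coeff k =>
      rw [← coeff_map, Polynomial.map_mul, hα₁, hα₂, ← hF, ← coeff_map α, Polynomial.map_map,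
        hαof]⟩
  have hφ : ∀ p, φ (RingQuot.mkRingHom d.Rel p) = α p := fun p =>
    RingQuot.lift_mkRingHom_apply _ _ _
  have hφρ : ∀ a, Q.residue (φ a) = residueMap θ (d.univOver.hom a) := by
    refine RingHom.congr_fun (RingQuot.ringQuot_ext (Q.residue.comp φ)
      ((residueMap θ).comp d.toResidue) (FreeExt.hom_ext (fun a => ?_) ?_))
    · change Q.residue (φ (RingQuot.mkRingHom _ _)) = residueMap θ (d.toResidue (d.ofBase a))
      rw [hφ, FreeExt.lift_of, toResidue_ofBase, residueMap_residue]
    · intro i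
      change Q.residue (φ (RingQuot.mkRingHom _ _)) =
        residueMap θ (RingQuot.lift _ (RingQuot.mkRingHom _ _))
      rw [hφ, FreeExt.lift_var, RingQuot.lift_mkRingHom_apply, toResidueFree, FreeExt.lift_var]
      rcases i with i | i
      · simpa using congrArg (fun p => p.coeff (i : ℕ)) hr₁
      · simpa using congrArg (fun p => p.coeff (i : ℕ)) hr₂
  obtain ⟨f, hf, hfρ⟩ := RingOver.exists_localization_lift (isJacobson_iff.1 hQ) (residueMap θ)
    (X := d.univOver) φ hφρ
  refine ⟨⟨f, ?_⟩, RingPair.hom_ext fun a => ?_⟩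
  · ext x
    refine residue_eq_zero_iff.symm.trans ?_
    refine (iff_of_eq (congrArg (· = 0) (hfρ x))).trans ?_
    exact map_eq_zero_iff _ (residueMap_injective θ)
  · exact (hf _).trans ((hφ _).trans (FreeExt.lift_of _ _ a))

/-- A morphism to a perfect Jacobson pair extends to a simple LF-extension if the given
factorization lifts. -/
lemma exists_ext_lift (hQ : Q.IsJacobson) (hQ' : Q.IsPerfect) {θ : P ⟶ Q} (h : d.LiftsAlong θ) :
    ∃ ψ : d.ext ⟶ Q, d.toExt ≫ ψ = θ := by
  obtain ⟨ψ, hψ⟩ := exists_localPair_lift hQ h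
  refine ⟨quotientLift _ d.localPair.commCore_le ψ fun a ha => hQ'.ringHom_eq_zero ψ ha, ?_⟩
  rw [← hψ]
  rfl

end FactDatum

/-! ### LF-extensions form a directed system -/

open RingPair

namespace LFTower

variable {s : Side}

lemma isJacobson_target :
    ∀ (n : ℕ) (P : RingPair.{u}) (t : LFTower s n P), (target n P t).IsJacobson
  | 0, _, d => FactDatum.isJacobson_ext d
  | n + 1, _, ⟨_, t⟩ => isJacobson_target n _ t

lemma isPerfect_target :
    ∀ (n : ℕ) (P : RingPair.{u}) (t : LFTower s n P), (target n P t).IsPerfect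
  | 0, _, d => FactDatum.isPerfect_ext d
  | n + 1, _, ⟨_, t⟩ => isPerfect_target n _ t

lemma residueMap_hom_surjective :
    ∀ (n : ℕ) (P : RingPair.{u}) (t : LFTower s n P), Function.Surjective (residueMap (hom n P t))
  | 0, _, d => FactDatum.residueMap_toExt_surjective d
  | n + 1, P, ⟨d, t⟩ => by
    intro b
    obtain ⟨c, rfl⟩ := residueMap_hom_surjective n _ t b
    obtain ⟨a, rfl⟩ := d.residueMap_toExt_surjective c
    obtain ⟨a, rfl⟩ := residue_surjective a
    exact ⟨P.residue a, rfl⟩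

lemma target_hom_ext : ∀ (n : ℕ) (P : RingPair.{u}) (t : LFTower s n P) {Q : RingPair.{u}}
    (_ : Q.IsJacobson) (_ : Q.IsPerfect) {ψ₁ ψ₂ : target n P t ⟶ Q},
    hom n P t ≫ ψ₁ = hom n P t ≫ ψ₂ → ψ₁ = ψ₂
  | 0, _, _, _, hQ, hQ', _, _, h => FactDatum.ext_hom_ext hQ hQ' h
  | n + 1, _, ⟨d, t⟩, _, hQ, hQ', ψ₁, ψ₂, h =>
    target_hom_ext n _ t hQ hQ' (FactDatum.ext_hom_ext (d := d) (ψ₁ := hom n _ t ≫ ψ₁)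
      (ψ₂ := hom n _ t ≫ ψ₂) hQ hQ' h)

lemma exists_target_lift : ∀ (n : ℕ) (P : RingPair.{u}) (t : LFTower s n P) {Q : RingPair.{u}}
    (_ : Q.IsHenselian s) (_ : Q.IsPerfect) (θ : P ⟶ Q), ∃ ψ, hom n P t ≫ ψ = θ
  | 0, _, d, _, hQ, hQ', θ => FactDatum.exists_ext_lift hQ.1 hQ' (hQ.liftsAlong d θ)
  | n + 1, _, ⟨d, t⟩, _, hQ, hQ', θ => by
    obtain ⟨ψ₀, rfl⟩ := FactDatum.exists_ext_lift hQ.1 hQ' (hQ.liftsAlong d θ)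
    obtain ⟨ψ, rfl⟩ := exists_target_lift n _ t hQ hQ' ψ₀
    exact ⟨ψ, rfl⟩

/-- The image of the first datum lifts in its own simple extension of `Q`, so `θ` extends over the
first step. The rest of the tower is pushed forward along that extension. -/
lemma exists_pushforward : ∀ (n : ℕ) (P : RingPair.{u}) (t : LFTower s n P) {Q : RingPair.{u}}
    (θ : P ⟶ Q), ∃ (t' : LFTower s n Q) (ψ : target n P t ⟶ target n Q t'),
      hom n P t ≫ ψ = θ ≫ hom n Q t'
  | 0, _, d, _, θ => ⟨FactDatum.map d θ, FactDatum.exists_ext_lift (FactDatum.isJacobson_ext _)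
      (FactDatum.isPerfect_ext _) (FactDatum.liftsAlong_toExt (FactDatum.map d θ)).of_map⟩
  | n + 1, P, ⟨d, t⟩, Q, θ => by
    obtain ⟨ψ₀, hψ₀⟩ := FactDatum.exists_ext_lift (FactDatum.isJacobson_ext _)
      (FactDatum.isPerfect_ext _) (FactDatum.liftsAlong_toExt (FactDatum.map d θ)).of_map
    obtain ⟨t', ψ, hψ⟩ := exists_pushforward n _ t ψ₀
    refine ⟨⟨d.map θ, t'⟩, ψ, ?_⟩
    change (d.toExt ≫ hom n _ t) ≫ ψ = θ ≫ (d.map θ).toExt ≫ hom n _ t'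
    rw [Category.assoc, hψ, ← Category.assoc, hψ₀, Category.assoc]

/-- A comparison morphism `e` replaces an equality between the targets of the two towers; nothing
more is needed for directedness. -/
lemma exists_concat : ∀ (n : ℕ) (P : RingPair.{u}) (t : LFTower s n P) (m : ℕ)
    (t' : LFTower s m (target n P t)), ∃ (k : ℕ) (t'' : LFTower s k P)
      (e : target m _ t' ⟶ target k P t''), hom n P t ≫ hom m _ t' ≫ e = hom k P t''
  | 0, _, d, m, t' => ⟨m + 1, ⟨d, t'⟩, 𝟙 _, rfl⟩
  | n + 1, _, ⟨d, t⟩, m, t' => by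
    obtain ⟨k, t'', e, he⟩ := exists_concat n _ t m t'
    exact ⟨k + 1, ⟨d, t''⟩, e, congrArg (d.toExt ≫ ·) he⟩

end LFTower

namespace LFExt

variable {s : Side} {P : RingPair.{u}}

lemma isJacobson_target (x : LFExt s P) : x.target.IsJacobson := LFTower.isJacobson_target _ _ _

lemma isPerfect_target (x : LFExt s P) : x.target.IsPerfect := LFTower.isPerfect_target _ _ _

lemma residueMap_hom_surjective (x : LFExt s P) : Function.Surjective (residueMap x.hom) :=
  LFTower.residueMap_hom_surjective _ _ _

lemma target_hom_ext (x : LFExt s P) {Q : RingPair.{u}} (hQ : Q.IsJacobson) (hQ' : Q.IsPerfect)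
    {ψ₁ ψ₂ : x.target ⟶ Q} (h : x.hom ≫ ψ₁ = x.hom ≫ ψ₂) : ψ₁ = ψ₂ :=
  LFTower.target_hom_ext _ _ _ hQ hQ' h

lemma exists_target_lift (x : LFExt s P) {Q : RingPair.{u}} (hQ : Q.IsHenselian s)
    (hQ' : Q.IsPerfect) (θ : P ⟶ Q) : ∃ ψ : x.target ⟶ Q, x.hom ≫ ψ = θ :=
  LFTower.exists_target_lift _ _ _ hQ hQ' θ

/-- The morphism of LF-extensions given by a morphism of pairs. -/
def homMk {x y : LFExt s P} (ψ : x.target ⟶ y.target) (h : x.hom ≫ ψ = y.hom) : x ⟶ y :=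
  InducedCategory.homMk (F := toUnder (s := s) (P := P)) (Under.homMk ψ h)

/-- The morphism of pairs underlying a morphism of LF-extensions. -/
def transition {x y : LFExt s P} (f : x ⟶ y) : x.target ⟶ y.target := (system s P).map f

lemma hom_comp_transition {x y : LFExt s P} (f : x ⟶ y) :
    x.hom ≫ transition f = y.hom :=
  Under.w (InducedCategory.Hom.hom f)

instance : Quiver.IsThin (LFExt s P) := fun x y => ⟨fun f g =>
  InducedCategory.hom_ext (Under.UnderMorphism.ext (x.target_hom_ext y.isJacobson_target
    y.isPerfect_target ((hom_comp_transition f).trans (hom_comp_transition g).symm)))⟩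

lemma exists_hom_of_tower (x : LFExt s P) {m : ℕ} (t : LFTower s m x.target) :
    ∃ (z : LFExt s P) (f : x ⟶ z) (e : LFTower.target m _ t ⟶ z.target),
      transition f = LFTower.hom m _ t ≫ e := by
  obtain ⟨k, t', e, he⟩ := LFTower.exists_concat _ _ x.2 m t
  exact ⟨⟨k, t'⟩, homMk (y := ⟨k, t'⟩) (LFTower.hom m _ t ≫ e) he, e, rfl⟩

instance : Nonempty (LFExt s P) :=
  ⟨⟨0, ({ F := 1, f₁ := 1, f₂ := 1, monic_F := monic_one, monic_f₁ := monic_one,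
          monic_f₂ := monic_one,
          coprime := by cases s <;> exact ⟨1, 0, by simp⟩
          map_F := by simp } : FactDatum s P)⟩⟩

/-- An upper bound of `x` and `y` is `x` followed by the pushforward of `y` along `x.hom`. Parallel
morphisms already agree by thinness. -/
instance : IsFiltered (LFExt s P) where
  cocone_objs x y := by
    obtain ⟨t, ψ, hψ⟩ := LFTower.exists_pushforward _ _ y.2 x.hom
    obtain ⟨z, f, e, hf⟩ := x.exists_hom_of_tower t
    refine ⟨z, f, homMk (ψ ≫ e) ?_, trivial⟩
    rw [← hom_comp_transition f, hf]
    exact congrArg (· ≫ e) hψ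
  cocone_maps _ y _ _ := ⟨y, 𝟙 y, Subsingleton.elim _ _⟩

lemma exists_hom_liftsAlong (x : LFExt s P) (d : FactDatum s x.target) :
    ∃ (z : LFExt s P) (f : x ⟶ z), d.LiftsAlong (transition f) := by
  obtain ⟨z, f, e, hf⟩ := x.exists_hom_of_tower (m := 0) d
  refine ⟨z, f, ?_⟩
  rw [hf]
  exact d.liftsAlong_toExt.comp e

end LFExt

/-! ### Filtered colimits of pairs -/

namespace RingPair

variable {J : Type u} [Category.{u} J] (G : J ⥤ RingPair.{u})

/-- The system of the rings underlying a system of pairs. -/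
def carrierSystem : J ⥤ RingCat.{u} where
  obj j := RingCat.of (G.obj j)
  map f := RingCat.ofHom (ringHom (G.map f))
  map_id j := by rw [G.map_id]; rfl
  map_comp f g := by rw [G.map_comp]; rfl

/-- The system of the residue rings of a system of pairs. -/
def residueSystem : J ⥤ RingCat.{u} where
  obj j := RingCat.of (G.obj j).Residue
  map f := RingCat.ofHom (residueMap (G.map f))
  map_id j := by
    rw [G.map_id]
    exact RingCat.hom_ext (Ideal.Quotient.ringHom_ext rfl)
  map_comp f g := by
    rw [G.map_comp]
    exact RingCat.hom_ext (Ideal.Quotient.ringHom_ext rfl)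

/-- The reduction maps of a system of pairs. -/
def residueSystemHom : carrierSystem G ⟶ residueSystem G where
  app j := RingCat.ofHom (G.obj j).residue

/-- The direct limit of a filtered system of pairs. -/
def filteredColimit : RingPair.{u} where
  carrier := (colimit (carrierSystem G) : RingCat.{u})
  ideal := RingHom.ker (colimMap (residueSystemHom G)).hom

variable [IsFiltered J]

/-- Morphisms of pairs are injective on residue rings, hence so are the maps to their direct limit.
This makes the maps from the stages satisfy the preimage condition. -/
lemma colimit_ι_residueSystem_eq_zero {j : J} {a : (G.obj j).Residue}
    (h : (colimit.ι (residueSystem G) j).hom a = 0) : a = 0 := by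
  rw [← map_zero (colimit.ι (residueSystem G) j).hom] at h
  obtain ⟨k, f, g, hk⟩ := Concrete.colimit_exists_of_rep_eq (residueSystem G) a 0 h
  exact residueMap_injective (G.map f) (hk.trans ((map_zero (residueMap (G.map g))).trans
    (map_zero _).symm))

/-- The morphisms to the direct limit of a filtered system of pairs. -/
def toFilteredColimit (j : J) : G.obj j ⟶ filteredColimit G where
  toRingHom := (colimit.ι (carrierSystem G) j).hom
  comap_ideal := by
    ext a
    have h : (colimMap (residueSystemHom G)).hom ((colimit.ι (carrierSystem G) j).hom a) =
        (colimit.ι (residueSystem G) j).hom ((G.obj j).residue a) :=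
      congrArg (fun f => f.hom a) (ι_colimMap (residueSystemHom G) j)
    rw [← residue_eq_zero_iff]
    refine (iff_of_eq (congrArg (· = 0) h)).trans ⟨colimit_ι_residueSystem_eq_zero G, fun ha => ?_⟩
    rw [ha]
    exact map_zero _

lemma exists_toFilteredColimit (b : filteredColimit G) :
    ∃ j a, ringHom (toFilteredColimit G j) a = b :=
  let b' : (colimit (carrierSystem G) : RingCat.{u}) := b
  Concrete.colimit_exists_rep (carrierSystem G) b'

/-- The cocone of the direct limit of a filtered system of pairs. -/
def filteredCocone : Cocone G where
  pt := filteredColimit G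
  ι :=
    { app := toFilteredColimit G
      naturality := fun _ _ f =>
        Hom.ext (congrArg RingCat.Hom.hom (colimit.w (carrierSystem G) f)) }

/-- The cocone of rings underlying a cocone of pairs. -/
def carrierCocone (c : Cocone G) : Cocone (carrierSystem G) where
  pt := RingCat.of c.pt
  ι :=
    { app := fun j => RingCat.ofHom (ringHom (c.ι.app j))
      naturality := fun _ _ f =>
        congrArg (fun θ => RingCat.ofHom (ringHom θ)) (c.ι.naturality f) }

/-- The morphism from the direct limit of a filtered system of pairs given by a cocone. -/
def filteredDesc (c : Cocone G) : filteredColimit G ⟶ c.pt where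
  toRingHom := (colimit.desc (carrierSystem G) (carrierCocone G c)).hom
  comap_ideal := by
    ext b
    obtain ⟨j, a, rfl⟩ := exists_toFilteredColimit G b
    have h : (colimit.desc (carrierSystem G) (carrierCocone G c)).hom
        (ringHom (toFilteredColimit G j) a) = ringHom (c.ι.app j) a :=
      congrArg (fun f => f.hom a) (colimit.ι_desc (carrierCocone G c) j)
    refine Iff.trans ?_ (ringHom_mem_iff (toFilteredColimit G j)).symm
    rw [← ringHom_mem_iff (c.ι.app j), ← h]
    rfl

lemma toFilteredColimit_desc (c : Cocone G) (j : J) :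
    toFilteredColimit G j ≫ filteredDesc G c = c.ι.app j :=
  Hom.ext (congrArg RingCat.Hom.hom (colimit.ι_desc (carrierCocone G c) j))

/-- The direct limit of a filtered system of pairs has the universal property. -/
def filteredCoconeIsColimit : IsColimit (filteredCocone G) where
  desc := filteredDesc G
  fac := toFilteredColimit_desc G
  uniq c m hm := by
    refine RingPair.hom_ext fun b => ?_
    obtain ⟨j, a, rfl⟩ := exists_toFilteredColimit G b
    exact congrArg (fun θ => ringHom θ a) ((hm j).trans (toFilteredColimit_desc G c j).symm)

variable {G}

lemma exists_map_toFilteredColimit (p : (filteredColimit G)[X]) :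
    ∃ (j : J) (q : (G.obj j)[X]), q.map (ringHom (toFilteredColimit G j)) = p := by
  have hw : ∀ {j k : J} (f : j ⟶ k), (ringHom (toFilteredColimit G k)).comp (ringHom (G.map f)) =
      ringHom (toFilteredColimit G j) := fun f => congrArg ringHom ((filteredCocone G).w f)
  induction p using Polynomial.induction_on' with
  | add p q hp hq =>
    obtain ⟨j, p, rfl⟩ := hp
    obtain ⟨k, q, rfl⟩ := hq
    refine ⟨IsFiltered.max j k, p.map (ringHom (G.map (IsFiltered.leftToMax j k))) +
      q.map (ringHom (G.map (IsFiltered.rightToMax j k))), ?_⟩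
    rw [Polynomial.map_add, Polynomial.map_map, Polynomial.map_map, hw, hw]
  | monomial n b =>
    obtain ⟨j, a, rfl⟩ := exists_toFilteredColimit G b
    exact ⟨j, monomial n a, map_monomial _⟩

/-- A polynomial descended to a stage need not be monic there. Its terms from degree `n` on are
replaced by `X ^ n`, which does not change the image. -/
lemma exists_monicOfDegree_map_toFilteredColimit {n : ℕ} {p : (filteredColimit G)[X]}
    (hp : MonicOfDegree n p) : ∃ (j : J) (q : (G.obj j)[X]), MonicOfDegree n q ∧
      q.map (ringHom (toFilteredColimit G j)) = p := by
  obtain ⟨j, q, rfl⟩ := exists_map_toFilteredColimit p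
  refine ⟨j, _, FactDatum.monicOfDegree_of_sum n fun i => q.coeff i, ?_⟩
  conv_rhs => rw [← FactDatum.sum_eq_of_monicOfDegree hp]
  simp [Polynomial.map_sum]

end RingPair

/-! ### The Henselization -/

namespace LFExt

variable (s : Side) (P : RingPair.{u})

/-- The direct limit of the LF-extensions of a pair. -/
abbrev limit : RingPair.{u} := filteredColimit (system s P)

variable {s P}

/-- The morphism from an LF-extension to the direct limit. -/
abbrev toLimit (x : LFExt s P) : x.target ⟶ limit s P := toFilteredColimit (system s P) x

lemma map_toLimit {x y : LFExt s P} (f : x ⟶ y) : transition f ≫ y.toLimit = x.toLimit :=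
  (filteredCocone (system s P)).w f

lemma exists_toLimit (b : limit s P) : ∃ (x : LFExt s P) (a : x.target), ringHom x.toLimit a = b :=
  exists_toFilteredColimit _ b

lemma hom_toLimit (x y : LFExt s P) : x.hom ≫ x.toLimit = y.hom ≫ y.toLimit := by
  rw [← map_toLimit (IsFiltered.leftToMax x y), ← map_toLimit (IsFiltered.rightToMax x y),
    ← Category.assoc, ← Category.assoc, hom_comp_transition, hom_comp_transition]

lemma bijective_residueMap_toLimit (x : LFExt s P) :
    Function.Bijective (residueMap x.toLimit) := by
  refine ⟨residueMap_injective _, fun b => ?_⟩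
  obtain ⟨b, rfl⟩ := residue_surjective b
  obtain ⟨y, a, rfl⟩ := exists_toLimit b
  obtain ⟨r, hr⟩ := y.residueMap_hom_surjective (y.target.residue a)
  obtain ⟨r, rfl⟩ := residue_surjective r
  refine ⟨x.target.residue (ringHom x.hom r), ?_⟩
  rw [← residueMap_residue y.toLimit, ← hr]
  exact congrArg (fun θ => (limit s P).residue (ringHom θ r)) (hom_toLimit x y)

/-- The residue rings of an LF-extension and of the direct limit agree. -/
def residueEquiv (x : LFExt s P) : x.target.Residue ≃+* (limit s P).Residue :=
  RingEquiv.ofBijective _ x.bijective_residueMap_toLimit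

variable (s P)

lemma isJacobson_limit : (limit s P).IsJacobson := by
  rw [isJacobson_iff]
  intro b hb
  obtain ⟨x, a, rfl⟩ := exists_toLimit b
  refine (isJacobson_iff.1 x.isJacobson_target a ?_).map _
  exact (isUnit_map_iff x.residueEquiv _).1 hb

variable {s P}

/-- The extensions to the stages are chosen independently; uniqueness makes them compatible. -/
lemma exists_limit_lift {Q : RingPair.{u}} (hQ : Q.IsHenselian s) (hQ' : Q.IsPerfect)
    (θ : P ⟶ Q) : ∃ ψ : limit s P ⟶ Q, ∀ x : LFExt s P, x.hom ≫ x.toLimit ≫ ψ = θ := by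
  choose ψ hψ using fun x : LFExt s P => x.exists_target_lift hQ hQ' θ
  let c : Cocone (system s P) :=
    { pt := Q
      ι :=
        { app := ψ
          naturality := fun x y f => x.target_hom_ext hQ.1 hQ' <| by
            refine Eq.trans (b := θ) ?_ (hψ x).symm
            rw [← hψ y, ← hom_comp_transition f]
            rfl } }
  refine ⟨(filteredCoconeIsColimit (system s P)).desc c, fun x => ?_⟩
  rw [← hψ x]
  exact congrArg (x.hom ≫ ·) ((filteredCoconeIsColimit (system s P)).fac c x)

lemma limit_hom_ext {Q : RingPair.{u}} (hQ : Q.IsJacobson) (hQ' : Q.IsPerfect)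
    {ψ₁ ψ₂ : limit s P ⟶ Q}
    (h : ∀ x : LFExt s P, x.hom ≫ x.toLimit ≫ ψ₁ = x.hom ≫ x.toLimit ≫ ψ₂) : ψ₁ = ψ₂ :=
  (filteredCoconeIsColimit (system s P)).hom_ext fun x => x.target_hom_ext hQ hQ' (h x)

variable (s P)

/-- A nonzero core element comes from a nonzero element of some stage, which survives in a Henselian
perfect `Q`. By uniqueness that morphism factors through the limit, where it must kill the core. -/
lemma isPerfect_limit : (limit s P).IsPerfect := by
  refine eq_bot_iff.2 fun b hb => ?_
  obtain ⟨x, a, rfl⟩ := exists_toLimit b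
  by_contra hne
  have ha : a ≠ 0 := by
    rintro rfl
    exact hne (map_zero _)
  obtain ⟨Q, θ, hQ, hQ', hθ⟩ :=
    exists_isHenselian_ringHom_ne_zero (s := s) x.isJacobson_target x.isPerfect_target ha
  obtain ⟨ψ, hψ⟩ := exists_limit_lift hQ hQ' (x.hom ≫ θ)
  have : x.toLimit ≫ ψ = θ := x.target_hom_ext hQ.1 hQ' (hψ x)
  rw [← this] at hθ
  exact hθ (hQ'.ringHom_eq_zero ψ hb)

/-- Only `F` has to descend to a stage: the residue rings agree, so the coprime factors are
transported through `residueEquiv`. One further simple extension provides the lift, and uniqueness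
is rigidity. -/
lemma isHenselian_limit : (limit s P).IsHenselian s := by
  refine isHenselian_of_exists (isJacobson_limit s P) (isPerfect_limit s P) ?_
  intro d₁ d₂ F g₁ g₂ hF hg₁ hg₂ hc hmap
  obtain ⟨x, (F : x.target[X]), hF', rfl⟩ := exists_monicOfDegree_map_toFilteredColimit hF
  let r : (limit s P).Residue →+* x.target.Residue := x.residueEquiv.symm
  have hr : (residueMap x.toLimit).comp r = RingHom.id _ :=
    RingHom.ext x.residueEquiv.apply_symm_apply
  have hr' : ∀ g : (limit s P).Residue[X], (g.map r).map (residueMap x.toLimit) = g := fun g => by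
    rw [Polynomial.map_map, hr, Polynomial.map_id]
  let d : FactDatum s x.target :=
    { F := F
      f₁ := (g₁.map (limit s P).residue).map r
      f₂ := (g₂.map (limit s P).residue).map r
      monic_F := hF'.monic
      monic_f₁ := (hg₁.monic.map _).map _
      monic_f₂ := (hg₂.monic.map _).map _
      coprime := hc.map (mapRingHom r)
      map_F := by
        refine map_injective _ (residueMap_injective x.toLimit) ?_
        rw [Polynomial.map_mul, hr', hr']
        refine (map_residue_map x.toLimit F).symm.trans ?_
        exact hmap }
  obtain ⟨z, f, hf⟩ := x.exists_hom_liftsAlong d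
  have := hf.comp z.toLimit
  rw [map_toLimit] at this
  obtain ⟨G₁, G₂, h₁, h₂, h, hr₁, hr₂⟩ := this
  exact ⟨G₁, G₂, h₁, h₂, h, hr₁.trans (hr' _), hr₂.trans (hr' _)⟩

lemma isHenselization_limit (x : LFExt s P) : IsHenselization s (x.hom ≫ x.toLimit) := by
  refine ⟨isHenselian_limit s P, isPerfect_limit s P, fun Q hQ hQ' θ => ?_⟩
  obtain ⟨ψ, hψ⟩ := exists_limit_lift hQ hQ' θ
  refine ⟨ψ, hψ x, fun ψ' hψ' => limit_hom_ext hQ.1 hQ' fun y => ?_⟩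
  rw [hψ, ← Category.assoc, hom_toLimit y x]
  exact hψ'

end LFExt

/-! ### Uniqueness of Henselizations and the main theorem -/

lemma IsHenselization.existsUnique_iso {s : Side} {P L L' : RingPair.{u}} {φ : P ⟶ L}
    {φ' : P ⟶ L'} (h : IsHenselization s φ) (h' : IsHenselization s φ') :
    ∃! e : L ≅ L', φ ≫ e.hom = φ' := by
  obtain ⟨ψ, hψ, hψu⟩ := h.2.2 L' h'.1 h'.2.1 φ'
  obtain ⟨ψ', hψ', -⟩ := h'.2.2 L h.1 h.2.1 φ
  refine ⟨⟨ψ, ψ', ?_, ?_⟩, hψ, fun e he => Iso.ext (hψu _ he)⟩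
  · refine (h.2.2 L h.1 h.2.1 φ).unique ?_ (Category.comp_id φ)
    rw [← Category.assoc, hψ, hψ']
  · refine (h'.2.2 L' h'.1 h'.2.1 φ').unique ?_ (Category.comp_id φ')
    rw [← Category.assoc, hψ', hψ]

theorem mainTheorem4 (s : Side) (P : RingPair.{u}) (hP : P.IsPerfect) :
    -- the LF-extensions of `P` form a directed system
    (Quiver.IsThin (LFExt s P) ∧ IsFiltered (LFExt s P)) ∧
    -- it has a direct limit in the category of pairs, and this is a Henselization of `P`
    (∃ (c : Cocone (LFExt.system s P)) (φ : P ⟶ c.pt),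
      Nonempty (IsColimit c) ∧ (∀ x : LFExt s P, x.hom ≫ c.ι.app x = φ) ∧
        IsHenselization s φ) ∧
    -- any two Henselizations are isomorphic by a unique isomorphism under `P`
    (∀ (L L' : RingPair.{u}) (φ : P ⟶ L) (φ' : P ⟶ L'),
      IsHenselization s φ → IsHenselization s φ' → ∃! e : L ≅ L', φ ≫ e.hom = φ') := by
  let x : LFExt s P := Classical.arbitrary _
  exact ⟨⟨inferInstance, inferInstance⟩, ⟨filteredCocone (LFExt.system s P), x.hom ≫ x.toLimit,
    ⟨filteredCoconeIsColimit _⟩, fun y => LFExt.hom_toLimit y x, LFExt.isHenselization_limit s P x⟩,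
    fun _ _ _ _ h h' => h.existsUnique_iso h'⟩

end
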